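/- For an origin-symmetric star body $K\subset\mathbb R^m$ (compact, star-shaped about $0$, $0\in\operatorname{int}K$, with continuous Minkowski functional $\|x\|_K=\min\{a\ge 0: x\in aK\}$), $K$ is called the intersection body of an origin-symmetric star body $L$ if $\|\xi\|_K^{-1}=\mathrm{vol}_{m-1}(L\cap\xi^\perp)$ for all $\xi\in S^{m-1}$. An origin-symmetric star body $K$ is an intersection body if it lies in the closure of the class of intersection bodies of star bodies for the radial metric $\sup_{\xi\in S^{m-1}}\bigl|\|\xi\|_K^{-1}-\|\xi\|_M^{-1}\bigr|$. A convex body is a compact convex set with the origin in its interior. **Theorem.** Let $n\ge 5$. There is an origin-symmetric convex body $K$ in $\mathbb R^n$ that is not an intersection body, but such that for every $(n-1)$-dimensional linear subspace $V$ of $\mathbb R^n$ the section $K\cap V$ is an intersection body in $V$. More precisely, fix $x_0\in S^{n-1}$ and, for $\varepsilon>0$ and $\theta\in S^{n-1}$, put $f_\varepsilon(\theta)=2\exp\bigl(-\tfrac{|\theta\mp x_0|^2}{\varepsilon^2-|\theta\mp x_0|^2}\bigr)$ if $|\theta\mp x_0|<\varepsilon$ (for $\varepsilon\le 1$ at most one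 sign is possible), and $f_\varepsilon(\theta)=0$ otherwise. Then there is $\varepsilon_0>0$ such that for every $\varepsilon\in(0,\varepsilon_0)$ there is a body $K$ with the above properties satisfying $$\|x\|_K^{-1}=\Bigl(\bigl(1-f_\varepsilon(x/|x|)\bigr)\,|x|^{-n+1}\Bigr)^{\wedge},$$ where the Fourier transform is that of tempered distributions, $\langle\hat f,\phi\rangle=\langle f,\hat\phi\rangle$ for Schwartz functions $\phi$, with $\hat\phi(x)=\int_{\mathbb R^n}\phi(y)e^{-i(x,y)}\,dy$. -/

import Mathlib

open MeasureTheory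
open scoped SchwartzMap

noncomputable section

/-- Lebesgue measure of a finite-dimensional Euclidean space `E`, normalised so that the unit cube
spanned by an orthonormal basis has measure one. It is spelled out, instead of written `volume`,
because `volume` on a subspace could also be read as the restriction of the ambient measure. -/
def lebesgue (E : Type*) [NormedAddCommGroup E] [InnerProductSpace ℝ E] [FiniteDimensional ℝ E]
    [MeasurableSpace E] [BorelSpace E] : Measure E :=
  (stdOrthonormalBasis ℝ E).toBasis.addHaar

/-- `S` is symmetric about the origin. -/
def IsOriginSymmetric {E : Type*} [AddCommGroup E] (S : Set E) : Prop :=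
  ∀ x ∈ S, -x ∈ S

/-- Convex bodies: compact convex sets with the origin in the interior. -/
structure IsConvexBody {E : Type*} [NormedAddCommGroup E] [NormedSpace ℝ E] (K : Set E) :
    Prop where
  isCompact : IsCompact K
  convex : Convex ℝ K
  zero_mem_interior : (0 : E) ∈ interior K

/-- Star bodies: compact sets, star-shaped about the origin, with the origin in the interior and
with continuous Minkowski functional `‖x‖_K`, which is Mathlib's `gauge K x`. -/
structure IsStarBody {E : Type*} [NormedAddCommGroup E] [NormedSpace ℝ E] (K : Set E) :
    Prop where
  isCompact : IsCompact K
  starConvex : StarConvex ℝ 0 K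
  zero_mem_interior : (0 : E) ∈ interior K
  continuous_gauge : Continuous (gauge K)

/-- The radial function `ρ_K(x) = ‖x‖_K⁻¹`. -/
def radialFunction {E : Type*} [NormedAddCommGroup E] [NormedSpace ℝ E] (K : Set E) (x : E) : ℝ :=
  (gauge K x)⁻¹

section Intersection

variable {E : Type*} [NormedAddCommGroup E] [InnerProductSpace ℝ E] [FiniteDimensional ℝ E]
  [MeasurableSpace E] [BorelSpace E]

/-- The volume of the central hyperplane section `L ∩ ξ^⊥`, as a subset of the Euclidean space
`ξ^⊥` of dimension one less. -/
def centralSectionVolume (L : Set E) (ξ : E) : ℝ :=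
  (lebesgue (ℝ ∙ ξ)ᗮ).real {y : (ℝ ∙ ξ)ᗮ | (y : E) ∈ L}

/-- `K` is the intersection body of `L`, both being origin-symmetric star bodies. -/
structure IsIntersectionBodyOf (K L : Set E) : Prop where
  starBody_left : IsStarBody K
  symmetric_left : IsOriginSymmetric K
  starBody_right : IsStarBody L
  symmetric_right : IsOriginSymmetric L
  radial_eq : ∀ ξ : E, ‖ξ‖ = 1 → radialFunction K ξ = centralSectionVolume L ξ

/-- Intersection bodies: the closure, within the origin-symmetric star bodies, of the class of
intersection bodies of star bodies in the radial metric `sup_{‖ξ‖ = 1} |ρ_K(ξ) - ρ_M(ξ)|`. -/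
structure IsIntersectionBody (K : Set E) : Prop where
  starBody : IsStarBody K
  symmetric : IsOriginSymmetric K
  mem_closure : ∀ δ : ℝ, 0 < δ → ∃ M L : Set E, IsIntersectionBodyOf M L ∧
    ∀ ξ : E, ‖ξ‖ = 1 → |radialFunction K ξ - radialFunction M ξ| ≤ δ

end Intersection

/-- The Fourier transform `φ^(x) = ∫ φ(y) exp(-i (x, y)) dy` of a test function. -/
def testFourier {n : ℕ} (φ : 𝓢(EuclideanSpace ℝ (Fin n), ℂ)) (x : EuclideanSpace ℝ (Fin n)) : ℂ :=
  ∫ y, φ y * Complex.exp (-(Complex.I * ((inner ℝ x y : ℝ) : ℂ)))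

/-- The function `g` is the Fourier transform of the function `f` in the sense of tempered
distributions: `⟨g, φ⟩ = ⟨f, φ^⟩` for every Schwartz function `φ`, with both pairings given by
convergent integrals. -/
def IsDistributionalFourierTransform {n : ℕ} (f g : EuclideanSpace ℝ (Fin n) → ℝ) : Prop :=
  ∀ φ : 𝓢(EuclideanSpace ℝ (Fin n), ℂ),
    Integrable (fun x => (f x : ℂ) * testFourier φ x) ∧
    Integrable (fun x => (g x : ℂ) * φ x) ∧
    ∫ x, (g x : ℂ) * φ x = ∫ x, (f x : ℂ) * testFourier φ x

/-- The even bump `f_ε` around `±x₀` (used on the unit sphere, with `‖x₀‖ = 1`). -/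
def bump {E : Type*} [NormedAddCommGroup E] (x₀ : E) (ε : ℝ) (x : E) : ℝ :=
  if ‖x - x₀‖ < ε then 2 * Real.exp (-(‖x - x₀‖ ^ 2 / (ε ^ 2 - ‖x - x₀‖ ^ 2)))
  else if ‖x + x₀‖ < ε then 2 * Real.exp (-(‖x + x₀‖ ^ 2 / (ε ^ 2 - ‖x + x₀‖ ^ 2)))
  else 0

/-- The function `(1 - f_ε(θ)) r^{-n+1}` on `ℝⁿ` in polar coordinates `x = r θ`. -/
def perturbedKernel {n : ℕ} (x₀ : EuclideanSpace ℝ (Fin n)) (ε : ℝ)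
    (x : EuclideanSpace ℝ (Fin n)) : ℝ :=
  (1 - bump x₀ ε (‖x‖⁻¹ • x)) * ‖x‖ ^ (-(n : ℤ) + 1)

end

/-
For an even function `g` on the sphere, regularising by Gaussians shows that the Fourier transform
of `g(x/|x|) |x|^{-n+1}` is `π |ξ|⁻¹ (R g)(ξ/|ξ|)`, where `R` is the spherical Radon transform. So
the body `K` sought is the one with radial function `π R(1 - f_ε)`.

`R f_ε` is small in `C²`: two derivatives of the bump cost a factor `ε⁻²`, while the part of a great
subsphere of dimension `n - 2` in the support of `f_ε` has measure of order `ε^{n-2}`, and `n ≥ 5`.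
Hence `K` is a small perturbation of a ball, and it is convex.

The intersection body of `L` has radial function `R(ρ_L^{n-1}) / (n - 1)`, which is the Fourier
transform of a nonnegative function. If `K` were an intersection body, testing against a nonnegative
bump would therefore show that `1 - f_ε` is nonnegative; but `f_ε(x₀) = 2`.

For a hyperplane `V` with unit normal `v`, integrating the kernel along the lines parallel to `v`
turns `R(1 - f_ε)` on `V` into `R_V G`, where `G(u)` is a weighted integral of `1 - f_ε` over the
great semicircle through `u` and `±v`. The semicircle meets the caps around `±x₀` in a short set, so
`G > 0`, and `K ∩ V` is the intersection body of the star body in `V` with radial function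
`(π (n - 2) G)^{1/(n-2)}`.
-/

noncomputable section

section SphereIntegration

open Set Metric Module

variable {E G : Type*} [NormedAddCommGroup E] [NormedSpace ℝ E] [FiniteDimensional ℝ E]
  [MeasurableSpace E] [BorelSpace E] [NormedAddCommGroup G]
  (μ : Measure E) [μ.IsAddHaarMeasure]

theorem integrable_toSphere_prod {F : E → G} (hF : Integrable F μ) :
    Integrable (fun p : sphere (0 : E) 1 × Ioi (0 : ℝ) ↦ F ((p.2 : ℝ) • (p.1 : E)))
      (μ.toSphere.prod (.volumeIoiPow (finrank ℝ E - 1))) := by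
  rw [← μ.measurePreserving_homeomorphUnitSphereProd.integrable_comp_emb
    (Homeomorph.measurableEmbedding _)]
  have h : IntegrableOn F ({(0 : E)}ᶜ) μ := hF.integrableOn
  rw [integrableOn_iff_comap_subtypeVal (measurableSet_singleton _).compl] at h
  refine h.congr (.of_forall fun x ↦ ?_)
  simp [smul_smul, norm_ne_zero_iff.2 x.2]

variable [NormedSpace ℝ G]

theorem integral_volumeIoiPow (m : ℕ) (f : ℝ → G) :
    ∫ r : Ioi (0 : ℝ), f r ∂(Measure.volumeIoiPow m) = ∫ r in Ioi (0 : ℝ), r ^ m • f r := by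
  simp only [Measure.volumeIoiPow, ENNReal.ofReal]
  rw [integral_withDensity_eq_integral_smul,
    integral_subtype_comap measurableSet_Ioi fun a ↦ Real.toNNReal (a ^ m) • f a,
    setIntegral_congr_fun measurableSet_Ioi fun x hx ↦ ?_]
  · rw [NNReal.smul_def, Real.coe_toNNReal _ (pow_nonneg hx.out.le _)]
  · exact (measurable_subtype_coe.pow_const _).real_toNNReal

variable [Nontrivial E]

theorem integral_eq_integral_toSphere_prod (F : E → G) :
    ∫ x, F x ∂μ = ∫ p : sphere (0 : E) 1 × Ioi (0 : ℝ), F ((p.2 : ℝ) • (p.1 : E))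
      ∂(μ.toSphere.prod (.volumeIoiPow (finrank ℝ E - 1))) := by
  calc
    ∫ x, F x ∂μ = ∫ x : ({(0)}ᶜ : Set E), F x ∂(μ.comap (↑)) := by
      rw [integral_subtype_comap (measurableSet_singleton _).compl F, restrict_compl_singleton]
    _ = _ := by
      rw [← μ.measurePreserving_homeomorphUnitSphereProd.integral_comp
        (Homeomorph.measurableEmbedding _)]
      refine integral_congr_ae (.of_forall fun x ↦ ?_)
      simp [smul_smul, norm_ne_zero_iff.2 x.2]

theorem integral_eq_integral_toSphere {F : E → G} (hF : Integrable F μ) :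
    ∫ x, F x ∂μ = ∫ θ : sphere (0 : E) 1,
      (∫ r in Ioi (0 : ℝ), r ^ (finrank ℝ E - 1) • F (r • (θ : E))) ∂μ.toSphere := by
  rw [integral_eq_integral_toSphere_prod, integral_prod _ (integrable_toSphere_prod μ hF)]
  congr with θ
  exact integral_volumeIoiPow _ fun r ↦ F (r • (θ : E))

theorem integral_radial_mul_fun_norm (a : E → ℝ) (w : ℝ → ℝ) :
    ∫ x, a (‖x‖⁻¹ • x) * w ‖x‖ ∂μ =
      (∫ θ : sphere (0 : E) 1, a θ ∂μ.toSphere) *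
        ∫ r in Ioi (0 : ℝ), r ^ (finrank ℝ E - 1) * w r := by
  have hw := integral_volumeIoiPow (finrank ℝ E - 1) w
  simp only [smul_eq_mul] at hw
  rw [integral_eq_integral_toSphere_prod, ← hw,
    ← integral_prod_mul (fun θ : sphere (0 : E) 1 ↦ a θ) fun r : Ioi (0 : ℝ) ↦ w r]
  congr with ⟨⟨θ, hθ⟩, ⟨r, hr : 0 < r⟩⟩
  have hθ : ‖θ‖ = 1 := mem_sphere_zero_iff_norm.1 hθ
  simp only [norm_smul, hθ, mul_one, Real.norm_of_nonneg hr.le, smul_smul,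
    inv_mul_cancel₀ hr.ne', one_smul]

theorem setIntegral_ball_radial_mul_norm_pow (a : E → ℝ) (m : ℕ) :
    ∫ x in ball (0 : E) 1, a (‖x‖⁻¹ • x) * ‖x‖ ^ m ∂μ =
      (finrank ℝ E + m : ℝ)⁻¹ * ∫ θ : sphere (0 : E) 1, a θ ∂μ.toSphere := by
  have hd : 0 < finrank ℝ E := finrank_pos
  have hball (x : E) : (ball (0 : E) 1).indicator (fun x ↦ a (‖x‖⁻¹ • x) * ‖x‖ ^ m) x =
      a (‖x‖⁻¹ • x) * (Iio (1 : ℝ)).indicator (· ^ m) ‖x‖ := by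
    by_cases h : ‖x‖ < 1 <;> simp [indicator, h]
  have hradial : ∫ r in Ioi (0 : ℝ), r ^ (finrank ℝ E - 1) * (Iio (1 : ℝ)).indicator (· ^ m) r =
      (finrank ℝ E + m : ℝ)⁻¹ := by
    simp_rw [← indicator_mul_right _ fun r : ℝ ↦ r ^ (finrank ℝ E - 1), ← pow_add]
    rw [setIntegral_indicator measurableSet_Iio, Ioi_inter_Iio, ← integral_Ioc_eq_integral_Ioo,
      ← intervalIntegral.integral_of_le zero_le_one, integral_pow, ← Nat.cast_add_one,
      show finrank ℝ E - 1 + m + 1 = finrank ℝ E + m by omega]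
    simp [hd.ne']
  rw [← integral_indicator measurableSet_ball]
  simp_rw [hball]
  rw [integral_radial_mul_fun_norm μ a, hradial, mul_comm]

end SphereIntegration

section Hyperplane

open Module

section Lebesgue

variable {U W : Type*} [NormedAddCommGroup U] [InnerProductSpace ℝ U] [FiniteDimensional ℝ U]
  [MeasurableSpace U] [BorelSpace U] [NormedAddCommGroup W] [InnerProductSpace ℝ W]
  [FiniteDimensional ℝ W] [MeasurableSpace W] [BorelSpace W]

instance : (lebesgue W).IsAddHaarMeasure := by unfold lebesgue; infer_instance

theorem measurePreserving_lebesgue (f : U ≃ₗᵢ[ℝ] W) :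
    MeasurePreserving f (lebesgue U) (lebesgue W) :=
  f.measurePreserving

theorem lebesgue_real_ball_congr (h : finrank ℝ U = finrank ℝ W) :
    (lebesgue U).real (Metric.ball 0 1) = (lebesgue W).real (Metric.ball 0 1) := by
  let f : U ≃ₗᵢ[ℝ] W := (stdOrthonormalBasis ℝ U).equiv (stdOrthonormalBasis ℝ W) (finCongr h)
  rw [← (measurePreserving_lebesgue f).measureReal_preimage
    Metric.isOpen_ball.measurableSet.nullMeasurableSet]
  simp

end Lebesgue

variable {U W : Type*} [NormedAddCommGroup U] [InnerProductSpace ℝ U]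
  [NormedAddCommGroup W] [InnerProductSpace ℝ W]

/-- The isometry `i` identifies `U` with the hyperplane `v^⊥` of `W`, where `‖v‖ = 1`. Hyperplanes
are handled through such pairs so that subspaces and abstract models are treated alike. -/
structure IsUnitNormal (i : U →ₗᵢ[ℝ] W) (v : W) : Prop where
  norm_eq_one : ‖v‖ = 1
  inner_eq_zero : ∀ u, inner ℝ (i u) v = 0
  finrank_eq : finrank ℝ W = finrank ℝ U + 1

namespace IsUnitNormal

variable {i : U →ₗᵢ[ℝ] W} {v : W}

theorem norm_add_smul_sq (h : IsUnitNormal i v) (u : U) (t : ℝ) :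
    ‖i u + t • v‖ ^ 2 = ‖u‖ ^ 2 + t ^ 2 := by
  rw [norm_add_sq_real, inner_smul_right, h.inner_eq_zero, norm_smul, h.norm_eq_one, i.norm_map]
  simp

theorem exists_homeomorph [FiniteDimensional ℝ U] [MeasurableSpace U] [BorelSpace U]
    [FiniteDimensional ℝ W] [MeasurableSpace W] [BorelSpace W] (h : IsUnitNormal i v) :
    ∃ e : U × ℝ ≃ₜ W, (∀ p, e p = i p.1 + p.2 • v) ∧
      MeasurePreserving e ((lebesgue U).prod volume) (lebesgue W) := by
  let l : WithLp 2 (U × ℝ) →ₗ[ℝ] W :=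
    { toFun := fun p ↦ i p.fst + p.snd • v
      map_add' := fun p q ↦ by
        simp only [WithLp.add_fst, WithLp.add_snd, map_add, add_smul]; abel
      map_smul' := fun c p ↦ by simp [smul_smul] }
  have norm_l (p) : ‖l p‖ = ‖p‖ := by
    rw [← sq_eq_sq₀ (norm_nonneg _) (norm_nonneg _), WithLp.prod_norm_sq_eq_of_L2,
      Real.norm_eq_abs, sq_abs]
    exact h.norm_add_smul_sq p.fst p.snd
  have finrank_prod : finrank ℝ (WithLp 2 (U × ℝ)) = finrank ℝ W := by
    rw [h.finrank_eq, (WithLp.linearEquiv 2 ℝ (U × ℝ)).finrank_eq, finrank_prod, finrank_self]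
  let f : WithLp 2 (U × ℝ) ≃ₗᵢ[ℝ] W := (⟨l, norm_l⟩ : _ →ₗᵢ[ℝ] W).toLinearIsometryEquiv finrank_prod
  exact ⟨(WithLp.prodContinuousLinearEquiv 2 ℝ U ℝ).symm.toHomeomorph.trans f.toHomeomorph,
    fun _ ↦ rfl, f.measurePreserving.comp (WithLp.volume_preserving_toLp U ℝ)⟩

end IsUnitNormal

theorem finrank_orthogonal_span [FiniteDimensional ℝ W] {ξ : W} (hξ : ξ ≠ 0) :
    finrank ℝ W = finrank ℝ (ℝ ∙ ξ)ᗮ + 1 := by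
  rw [← (ℝ ∙ ξ).finrank_add_finrank_orthogonal, finrank_span_singleton hξ, add_comm]

theorem isUnitNormal_orthogonal_span [FiniteDimensional ℝ W] {ξ : W} (hξ : ξ ≠ 0) :
    IsUnitNormal (ℝ ∙ ξ)ᗮ.subtypeₗᵢ (‖ξ‖⁻¹ • ξ) where
  norm_eq_one := by simp [norm_smul, hξ]
  inner_eq_zero u := by
    rw [inner_smul_right]
    exact mul_eq_zero_of_right _ (Submodule.mem_orthogonal_singleton_iff_inner_left.1 u.2)
  finrank_eq := finrank_orthogonal_span hξ

theorem exists_orthonormalBasis_apply_zero [FiniteDimensional ℝ U] {m : ℕ}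
    (h : finrank ℝ U = m + 1) {u : U} (hu : ‖u‖ = 1) :
    ∃ b : OrthonormalBasis (Fin (m + 1)) ℝ U, b 0 = u := by
  have hv : Orthonormal ℝ (({0} : Set (Fin (m + 1))).domRestrict fun _ ↦ u) :=
    ⟨fun _ ↦ hu, fun i j hij ↦ absurd (Subsingleton.elim i j) hij⟩
  obtain ⟨b, hb⟩ := hv.exists_orthonormalBasis_extension_of_card_eq (by simpa using h)
  exact ⟨b, hb 0 rfl⟩

theorem exists_linearIsometryEquiv_map_eq [FiniteDimensional ℝ U] [FiniteDimensional ℝ W]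
    (h : finrank ℝ U = finrank ℝ W) {u : U} {w : W} (hu : ‖u‖ = 1) (hw : ‖w‖ = 1) :
    ∃ f : U ≃ₗᵢ[ℝ] W, f u = w := by
  have : Nontrivial U := ⟨⟨u, 0, fun h0 ↦ by simp [h0] at hu⟩⟩
  obtain ⟨m, hm⟩ : ∃ m, finrank ℝ U = m + 1 :=
    ⟨finrank ℝ U - 1, (Nat.sub_add_cancel finrank_pos).symm⟩
  obtain ⟨b, rfl⟩ := exists_orthonormalBasis_apply_zero hm hu
  obtain ⟨c, rfl⟩ := exists_orthonormalBasis_apply_zero (h ▸ hm) hw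
  exact ⟨b.equiv c (Equiv.refl _), by rw [OrthonormalBasis.equiv_apply_basis, Equiv.refl_apply]⟩

end Hyperplane

section StarBody

open Set Metric Module Filter
open scoped Pointwise Topology

/-- Continuous, absolutely homogeneous functions that are positive off the origin: the Minkowski
functionals of origin-symmetric star bodies. -/
structure IsMinkowskiFunctional {E : Type*} [NormedAddCommGroup E] [NormedSpace ℝ E]
    (N : E → ℝ) : Prop where
  continuous : Continuous N
  smul : ∀ (c : ℝ) (x : E), N (c • x) = |c| * N x
  pos : ∀ x, x ≠ 0 → 0 < N x

namespace IsMinkowskiFunctional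

variable {E : Type*} [NormedAddCommGroup E] [NormedSpace ℝ E] {N : E → ℝ}

theorem zero (h : IsMinkowskiFunctional N) : N 0 = 0 := by
  simpa using h.smul 0 0

theorem nonneg (h : IsMinkowskiFunctional N) (x : E) : 0 ≤ N x := by
  rcases eq_or_ne x 0 with rfl | hx
  · exact h.zero.ge
  · exact (h.pos x hx).le

theorem mem_smul_iff (h : IsMinkowskiFunctional N) {r : ℝ} (hr : 0 < r) (x : E) :
    x ∈ r • {x | N x ≤ 1} ↔ N x ≤ r := by
  rw [mem_smul_set_iff_inv_smul_mem₀ hr.ne', mem_ofPred_eq, h.smul, abs_of_pos (inv_pos.2 hr),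
    inv_mul_le_iff₀ hr, mul_one]

theorem gauge_eq (h : IsMinkowskiFunctional N) : gauge {x | N x ≤ 1} = N := by
  ext x
  apply le_antisymm
  · rcases eq_or_ne x 0 with rfl | hx
    · simp [h.zero]
    · exact gauge_le_of_mem (h.nonneg x) ((h.mem_smul_iff (h.pos x hx) x).2 le_rfl)
  · refine le_csInf ⟨N x + 1, ?_, ?_⟩ ?_
    · have := h.nonneg x; change 0 < N x + 1; positivity
    · exact (h.mem_smul_iff (by have := h.nonneg x; positivity) x).2 (by linarith)
    · rintro r ⟨hr, hx⟩
      exact (h.mem_smul_iff hr x).1 hx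

theorem isOriginSymmetric (h : IsMinkowskiFunctional N) : IsOriginSymmetric {x | N x ≤ 1} := by
  intro x hx
  have := h.smul (-1) x
  simp only [neg_smul, one_smul, abs_neg, abs_one, one_mul] at this
  simpa [this] using hx

theorem zero_mem_interior (h : IsMinkowskiFunctional N) : (0 : E) ∈ interior {x | N x ≤ 1} := by
  rw [mem_interior_iff_mem_nhds]
  have := h.continuous.tendsto 0
  rw [h.zero] at this
  filter_upwards [this.eventually (gt_mem_nhds one_pos)] with x hx using hx.le

theorem exists_pos_mul_norm_le [FiniteDimensional ℝ E] (h : IsMinkowskiFunctional N) :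
    ∃ c, 0 < c ∧ ∀ x, c * ‖x‖ ≤ N x := by
  have : ProperSpace E := FiniteDimensional.proper_real E
  obtain hs | hs := (sphere (0 : E) 1).eq_empty_or_nonempty
  · refine ⟨1, one_pos, fun x ↦ ?_⟩
    obtain rfl : x = 0 := by
      by_contra hx
      have : ‖x‖⁻¹ • x ∈ sphere (0 : E) 1 := by simp [norm_smul, hx]
      simp [hs] at this
    simp [h.zero]
  · obtain ⟨u, hu, hmin⟩ := (isCompact_sphere (0 : E) 1).exists_isMinOn hs h.continuous.continuousOn
    refine ⟨N u, h.pos u (by rintro rfl; simp at hu), fun x ↦ ?_⟩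
    obtain rfl | hx := eq_or_ne x 0
    · simp [h.zero]
    have hux : N u ≤ N (‖x‖⁻¹ • x) := hmin (by simp [norm_smul, hx])
    rwa [h.smul, abs_of_nonneg (by positivity), inv_mul_eq_div,
      le_div_iff₀ (norm_pos_iff.2 hx)] at hux

theorem isCompact [FiniteDimensional ℝ E] (h : IsMinkowskiFunctional N) :
    IsCompact {x | N x ≤ 1} := by
  have : ProperSpace E := FiniteDimensional.proper_real E
  obtain ⟨c, hc, hN⟩ := h.exists_pos_mul_norm_le
  refine isCompact_of_isClosed_isBounded (isClosed_le h.continuous continuous_const) ?_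
  refine (isBounded_closedBall (x := (0 : E)) (r := 1 / c)).subset fun x (hx : N x ≤ 1) ↦ ?_
  rw [mem_closedBall_zero_iff, le_div_iff₀' hc]
  exact (hN x).trans hx

theorem isStarBody [FiniteDimensional ℝ E] (h : IsMinkowskiFunctional N) :
    IsStarBody {x | N x ≤ 1} where
  isCompact := h.isCompact
  starConvex := by
    rw [starConvex_zero_iff]
    intro x hx a ha0 ha1
    have hx' : N x ≤ 1 := hx
    rw [mem_ofPred_eq, h.smul, abs_of_nonneg ha0]
    nlinarith [h.nonneg x]
  zero_mem_interior := h.zero_mem_interior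
  continuous_gauge := by rw [h.gauge_eq]; exact h.continuous

theorem isConvexBody [FiniteDimensional ℝ E] (h : IsMinkowskiFunctional N)
    (hc : ConvexOn ℝ univ N) : IsConvexBody {x | N x ≤ 1} where
  isCompact := h.isCompact
  convex := by simpa using hc.convex_le 1
  zero_mem_interior := h.zero_mem_interior

theorem comp_linearIsometry {F : Type*} [NormedAddCommGroup F] [NormedSpace ℝ F]
    (h : IsMinkowskiFunctional N) (i : F →ₗᵢ[ℝ] E) : IsMinkowskiFunctional fun x ↦ N (i x) where
  continuous := h.continuous.comp i.continuous
  smul c x := by simp [h.smul]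
  pos x hx := h.pos _ ((map_ne_zero_iff i i.injective).2 hx)

theorem finrank_mul_measureReal [FiniteDimensional ℝ E] [MeasurableSpace E] [BorelSpace E]
    [Nontrivial E] (μ : Measure E) [μ.IsAddHaarMeasure] (h : IsMinkowskiFunctional N) :
    finrank ℝ E * μ.real {x | N x ≤ 1} =
      ∫ θ : sphere (0 : E) 1, (N θ)⁻¹ ^ finrank ℝ E ∂μ.toSphere := by
  have hd : 0 < finrank ℝ E := finrank_pos
  have hm : MeasurableSet {x | N x ≤ 1} := (isClosed_le h.continuous continuous_const).measurableSet
  have hi : Integrable (indicator {x | N x ≤ 1} (1 : E → ℝ)) μ :=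
    (integrable_indicator_iff hm).2 (integrableOn_const h.isCompact.measure_lt_top.ne)
  rw [← integral_indicator_one hm, integral_eq_integral_toSphere μ hi, ← integral_const_mul]
  congr with θ
  have hθ : 0 < N θ := h.pos θ (ne_zero_of_mem_unit_sphere θ)
  have hray : ∀ r ∈ Ioi (0 : ℝ), r ^ (finrank ℝ E - 1) •
      indicator {x | N x ≤ 1} (1 : E → ℝ) (r • (θ : E)) =
        (Iic (N θ)⁻¹).indicator (fun r ↦ r ^ (finrank ℝ E - 1)) r := by
    intro r (hr : 0 < r)
    have : N (r • (θ : E)) ≤ 1 ↔ r ≤ (N θ)⁻¹ := by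
      rw [h.smul, abs_of_pos hr, ← le_div_iff₀ hθ, one_div]
    by_cases hrθ : r ≤ (N θ)⁻¹ <;> simp [indicator, this, hrθ]
  rw [setIntegral_congr_fun measurableSet_Ioi hray, setIntegral_indicator measurableSet_Iic,
    Ioi_inter_Iic, ← intervalIntegral.integral_of_le (by positivity), integral_pow,
    ← Nat.cast_add_one, Nat.sub_add_cancel hd, zero_pow hd.ne', sub_zero]
  field_simp

end IsMinkowskiFunctional

variable {E : Type*} [NormedAddCommGroup E] [NormedSpace ℝ E] {L : Set E}

theorem IsStarBody.isMinkowskiFunctional_gauge (h : IsStarBody L) (hs : IsOriginSymmetric L) :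
    IsMinkowskiFunctional (gauge L) where
  continuous := h.continuous_gauge
  smul c x := by
    rcases le_total 0 c with hc | hc
    · rw [gauge_smul_of_nonneg hc, abs_of_nonneg hc, smul_eq_mul]
    · rw [← gauge_neg (fun x hx => hs x hx), ← neg_smul, gauge_smul_of_nonneg (neg_nonneg.2 hc),
        abs_of_nonpos hc, smul_eq_mul]
  pos x hx := (gauge_pos (absorbent_nhds_zero (mem_interior_iff_mem_nhds.1 h.zero_mem_interior))
    (NormedSpace.isVonNBounded_of_isBounded ℝ h.isCompact.isBounded)).2 hx

theorem IsStarBody.mem_of_gauge_lt_one (h : IsStarBody L) {x : E} (hx : gauge L x < 1) :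
    x ∈ L := by
  have habs : Absorbent ℝ L :=
    absorbent_nhds_zero (mem_interior_iff_mem_nhds.1 h.zero_mem_interior)
  obtain ⟨r, hr0, hr1, z, hz, rfl⟩ := exists_lt_of_gauge_lt habs hx
  exact starConvex_zero_iff.1 h.starConvex hz hr0.le hr1.le

theorem IsStarBody.eq_gauge_le_one (h : IsStarBody L) : L = {x | gauge L x ≤ 1} := by
  refine Subset.antisymm (fun x hx ↦ gauge_le_one_of_mem hx) fun x (hx : gauge L x ≤ 1) ↦ ?_
  rw [← h.isCompact.isClosed.closure_eq]
  have hlim : Tendsto (fun r : ℝ ↦ r • x) (𝓝[<] 1) (𝓝 x) := by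
    have : Continuous fun r : ℝ ↦ r • x := by fun_prop
    simpa using (this.tendsto 1).mono_left nhdsWithin_le_nhds
  refine mem_closure_of_tendsto hlim ?_
  filter_upwards [self_mem_nhdsWithin, nhdsWithin_le_nhds (lt_mem_nhds zero_lt_one)]
    with r (hr1 : r < 1) hr0
  apply h.mem_of_gauge_lt_one
  rw [gauge_smul_of_nonneg hr0.le, smul_eq_mul]
  nlinarith

end StarBody

section Angular

open Set Metric Module Filter
open scoped Topology

/-- Even functions that are homogeneous of degree zero and continuous off the origin, that is,
the extensions of continuous even functions on the unit sphere. -/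
structure IsEvenAngular {E : Type*} [NormedAddCommGroup E] [NormedSpace ℝ E] (g : E → ℝ) :
    Prop where
  continuousOn : ContinuousOn g {0}ᶜ
  smul : ∀ (c : ℝ) (x : E), c ≠ 0 → g (c • x) = g x

namespace IsEvenAngular

variable {E : Type*} [NormedAddCommGroup E] [NormedSpace ℝ E] {g : E → ℝ}

theorem neg (h : IsEvenAngular g) (x : E) : g (-x) = g x := by
  simpa using h.smul (-1) x (by norm_num)

theorem radial (h : IsEvenAngular g) {x : E} (hx : x ≠ 0) : g (‖x‖⁻¹ • x) = g x :=
  h.smul _ _ (by simpa using hx)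

theorem continuousAt (h : IsEvenAngular g) {x : E} (hx : x ≠ 0) : ContinuousAt g x :=
  h.continuousOn.continuousAt (isOpen_compl_singleton.mem_nhds hx)

theorem measurable [MeasurableSpace E] [BorelSpace E] (h : IsEvenAngular g) : Measurable g :=
  measurable_of_continuousOn_compl_singleton 0 h.continuousOn

theorem exists_bound [FiniteDimensional ℝ E] (h : IsEvenAngular g) :
    ∃ C, 0 ≤ C ∧ ∀ x, |g x| ≤ C := by
  have : ProperSpace E := FiniteDimensional.proper_real E
  obtain ⟨C, hC⟩ := (isCompact_sphere (0 : E) 1).exists_bound_of_continuousOn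
    (h.continuousOn.mono fun x hx ↦ by rintro rfl; simp at hx)
  refine ⟨max C |g 0|, le_max_of_le_right (abs_nonneg _), fun x ↦ ?_⟩
  rcases eq_or_ne x 0 with rfl | hx
  · exact le_max_right _ _
  · rw [← h.radial hx]
    exact le_max_of_le_left (hC _ (by simp [norm_smul, hx]))

theorem comp_linearIsometry {F : Type*} [NormedAddCommGroup F] [NormedSpace ℝ F]
    (h : IsEvenAngular g) (i : F →ₗᵢ[ℝ] E) : IsEvenAngular fun x ↦ g (i x) where
  continuousOn := h.continuousOn.comp i.continuous.continuousOn fun _ hx ↦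
    (map_ne_zero_iff i i.injective).2 hx
  smul c x hc := by simp [h.smul c _ hc]

theorem mul {f : E → ℝ} (hf : IsEvenAngular f) (hg : IsEvenAngular g) :
    IsEvenAngular fun x ↦ f x * g x where
  continuousOn := hf.continuousOn.mul hg.continuousOn
  smul c x hc := by simp only [hf.smul c x hc, hg.smul c x hc]

theorem isMinkowskiFunctional [FiniteDimensional ℝ E] (h : IsEvenAngular g)
    (hpos : ∀ x, x ≠ 0 → 0 < g x) : IsMinkowskiFunctional fun x ↦ ‖x‖ * g x where
  continuous := by
    rw [continuous_iff_continuousAt]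
    intro x
    rcases eq_or_ne x 0 with rfl | hx
    · obtain ⟨C, -, hC⟩ := h.exists_bound
      have hcont : Continuous fun x : E ↦ ‖x‖ * C := by fun_prop
      have hlim : Tendsto (fun x : E ↦ ‖x‖ * C) (𝓝 0) (𝓝 0) := by
        simpa only [norm_zero, zero_mul] using hcont.tendsto 0
      rw [ContinuousAt, norm_zero, zero_mul]
      refine squeeze_zero_norm (fun x ↦ ?_) hlim
      rw [norm_mul, norm_norm]
      gcongr
      exact hC x
    · exact continuous_norm.continuousAt.mul (h.continuousAt hx)
  smul c x := by
    rcases eq_or_ne c 0 with rfl | hc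
    · simp only [zero_smul, norm_zero, abs_zero, zero_mul]
    · rw [h.smul c x hc, norm_smul, Real.norm_eq_abs, mul_assoc]
  pos x hx := mul_pos (norm_pos_iff.2 hx) (hpos x hx)

end IsEvenAngular

theorem isEvenAngular_comp_inner {E : Type*} [NormedAddCommGroup E] [InnerProductSpace ℝ E]
    {m : ℝ → ℝ} (hm : Continuous m) (heven : m.Even) (ξ : E) :
    IsEvenAngular fun x ↦ m (inner ℝ (‖x‖⁻¹ • x) ξ) where
  continuousOn := by
    have : ContinuousOn (fun x : E ↦ ‖x‖⁻¹ • x) {0}ᶜ :=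
      (continuousOn_id.norm.inv₀ fun x hx ↦ norm_ne_zero_iff.2 hx).smul continuousOn_id
    exact hm.comp_continuousOn (this.inner continuousOn_const)
  smul c x hc := by
    have hdir : ‖c • x‖⁻¹ • c • x = (c / |c|) • ‖x‖⁻¹ • x := by
      rw [norm_smul, Real.norm_eq_abs, smul_smul, smul_smul, mul_inv]
      congr 1
      ring
    rw [hdir, real_inner_smul_left]
    rcases abs_choice c with h | h
    · rw [h, div_self hc, one_mul]
    · rw [h, div_neg, div_self hc, neg_one_mul, heven]

section Sphere

variable {E : Type*} [NormedAddCommGroup E] [NormedSpace ℝ E] [MeasurableSpace E] [BorelSpace E]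
  (μ : Measure E)

theorem ae_toSphere_of_ae_radial {p : E → Prop} (hm : MeasurableSet {x | p x})
    (hp : ∀ᵐ x ∂μ, p (‖x‖⁻¹ • x)) : ∀ᵐ θ : sphere (0 : E) 1 ∂μ.toSphere, p θ := by
  have hm' : MeasurableSet {θ : sphere (0 : E) 1 | ¬ p θ} :=
    (hm.preimage measurable_subtype_coe).compl
  rw [ae_iff, μ.toSphere_apply' hm']
  refine mul_eq_zero_of_right _ (measure_mono_null ?_ (ae_iff.1 hp))
  rintro _ ⟨r, hr, _, ⟨θ, hθ, rfl⟩, rfl⟩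
  simpa [norm_smul, smul_smul, abs_of_pos hr.1, inv_mul_cancel₀ hr.1.ne'] using hθ

theorem integrable_inv_norm_pow_mul [FiniteDimensional ℝ E] [Nontrivial E] [μ.IsAddHaarMeasure]
    {w : ℝ → ℝ} {k : ℕ} (hd : finrank ℝ E = k + 1) (hw : IntegrableOn w (Ioi 0)) :
    Integrable (fun x : E ↦ (‖x‖ ^ k)⁻¹ * w ‖x‖) μ := by
  refine (integrable_fun_norm_addHaar μ (f := fun r ↦ (r ^ k)⁻¹ * w r)).2 ?_
  refine hw.congr_fun (fun r (hr : 0 < r) ↦ ?_) measurableSet_Ioi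
  have : r ^ k ≠ 0 := by positivity
  simp [hd, this]

end Sphere

end Angular

section Projection

open Set Metric Module Filter
open scoped Topology

theorem setIntegral_Ioi_inv_mul_indicator_Icc {q : ℝ} (hq : 0 < q) :
    ∫ r in Ioi (0 : ℝ), r⁻¹ * (Icc 1 (Real.exp 1)).indicator 1 (r * q) = 1 := by
  have hq' : 0 < q⁻¹ := inv_pos.2 hq
  have hind (r : ℝ) : r⁻¹ * (Icc 1 (Real.exp 1)).indicator 1 (r * q) =
      (Icc q⁻¹ (Real.exp 1 * q⁻¹)).indicator (fun r ↦ r⁻¹) r := by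
    have : r * q ∈ Icc 1 (Real.exp 1) ↔ r ∈ Icc q⁻¹ (Real.exp 1 * q⁻¹) := by
      rw [mem_Icc, mem_Icc, ← div_eq_mul_inv, le_div_iff₀ hq, inv_le_iff_one_le_mul₀ hq]
    by_cases h : r ∈ Icc q⁻¹ (Real.exp 1 * q⁻¹)
    · rw [indicator_of_mem (this.2 h), indicator_of_mem h, Pi.one_apply, mul_one]
    · rw [indicator_of_notMem (mt this.1 h), indicator_of_notMem h, mul_zero]
  have hsub : Icc q⁻¹ (Real.exp 1 * q⁻¹) ⊆ Ioi 0 := fun r hr ↦ hq'.trans_le hr.1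
  have hle : q⁻¹ ≤ Real.exp 1 * q⁻¹ :=
    le_mul_of_one_le_left hq'.le (Real.one_le_exp zero_le_one)
  simp_rw [hind]
  rw [setIntegral_indicator measurableSet_Icc, inter_eq_self_of_subset_right hsub,
    integral_Icc_eq_integral_Ioc, ← intervalIntegral.integral_of_le hle,
    integral_inv_of_pos hq' (by positivity), mul_div_cancel_right₀ _ hq'.ne', Real.log_exp]

theorem IsEvenAngular.integral_indicator_mul_inv_norm_pow {W : Type*} [NormedAddCommGroup W]
    [NormedSpace ℝ W] [FiniteDimensional ℝ W] [Nontrivial W] [MeasurableSpace W] [BorelSpace W]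
    (μ : Measure W) [μ.IsAddHaarMeasure] {g q : W → ℝ} (hg : IsEvenAngular g)
    (hq : ∀ r x, 0 < r → q (r • x) = r * q x)
    (hq0 : ∀ᵐ θ : sphere (0 : W) 1 ∂μ.toSphere, 0 < q θ)
    (hi : Integrable (fun x ↦ (Icc 1 (Real.exp 1)).indicator 1 (q x) *
      (g x * (‖x‖ ^ finrank ℝ W)⁻¹)) μ) :
    ∫ x, (Icc 1 (Real.exp 1)).indicator 1 (q x) * (g x * (‖x‖ ^ finrank ℝ W)⁻¹) ∂μ =
      ∫ θ : sphere (0 : W) 1, g θ ∂μ.toSphere := by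
  rw [integral_eq_integral_toSphere _ hi]
  refine integral_congr_ae (hq0.mono fun θ hθ ↦ ?_)
  have hradial : ∀ r ∈ Ioi (0 : ℝ), r ^ (finrank ℝ W - 1) •
      ((Icc 1 (Real.exp 1)).indicator 1 (q (r • (θ : W))) *
        (g (r • (θ : W)) * (‖r • (θ : W)‖ ^ finrank ℝ W)⁻¹)) =
      g θ * (r⁻¹ * (Icc 1 (Real.exp 1)).indicator 1 (r * q θ)) := by
    intro r (hr : 0 < r)
    rw [hq r _ hr, hg.smul r _ hr.ne', norm_smul, norm_eq_of_mem_sphere, Real.norm_of_nonneg hr.le,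
      ← Nat.sub_add_cancel (finrank_pos (R := ℝ) (M := W)), pow_succ, Nat.add_sub_cancel,
      smul_eq_mul]
    field_simp
  simp only []
  rw [setIntegral_congr_fun measurableSet_Ioi hradial, integral_const_mul,
    setIntegral_Ioi_inv_mul_indicator_Icc hθ, mul_one]

variable {U W : Type*} [NormedAddCommGroup U] [InnerProductSpace ℝ U] [NormedAddCommGroup W]
  [InnerProductSpace ℝ W]

/-- The integral over the line through `i u` in direction `v` of the homogeneous extension of `g`
of degree `-k`. For `k = dim W`, projection along `v` preserves integrals over spheres. -/
def lineIntegral (g : W → ℝ) (k : ℕ) (i : U →ₗᵢ[ℝ] W) (v : W) (u : U) : ℝ :=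
  ∫ t : ℝ, g (i u + t • v) * (‖i u + t • v‖ ^ k)⁻¹

theorem IsEvenAngular.lineIntegral_smul {g : W → ℝ} (hg : IsEvenAngular g) (k : ℕ)
    (i : U →ₗᵢ[ℝ] W) (v : W) {c : ℝ} (hc : c ≠ 0) (u : U) :
    lineIntegral g k i v (c • u) = |c| * (|c| ^ k)⁻¹ * lineIntegral g k i v u := by
  have hscale (t : ℝ) : i (c • u) + (c * t) • v = c • (i u + t • v) := by
    rw [map_smul, smul_add, smul_smul]
  have hsubst := Measure.integral_comp_mul_left
    (fun t : ℝ ↦ g (i (c • u) + t • v) * (‖i (c • u) + t • v‖ ^ k)⁻¹) c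
  simp only [hscale, hg.smul _ _ hc, norm_smul, Real.norm_eq_abs, mul_pow, mul_inv, abs_inv,
    mul_left_comm (g _), integral_const_mul, smul_eq_mul] at hsubst
  change (|c| ^ k)⁻¹ * lineIntegral g k i v u =
    |c|⁻¹ * lineIntegral g k i v (c • u) at hsubst
  rw [eq_inv_mul_iff_mul_eq₀ (abs_ne_zero.2 hc)] at hsubst
  rw [← hsubst, mul_assoc]

namespace IsUnitNormal

variable {i : U →ₗᵢ[ℝ] W} {v : W} {k : ℕ}

theorem two_le_finrank [FiniteDimensional ℝ U] [Nontrivial U] (h : IsUnitNormal i v) :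
    2 ≤ finrank ℝ W := by
  rw [h.finrank_eq]
  exact Nat.succ_le_succ finrank_pos

theorem one_add_sq_le_norm_pow (h : IsUnitNormal i v) (hk : 2 ≤ k) {u : U} (hu : 1 ≤ ‖u‖) (t : ℝ) :
    1 + t ^ 2 ≤ ‖i u + t • v‖ ^ k := by
  have hsq := h.norm_add_smul_sq u t
  have hle : 1 + t ^ 2 ≤ ‖i u + t • v‖ ^ 2 := by rw [hsq]; gcongr; nlinarith
  refine hle.trans (pow_le_pow_right₀ ?_ hk)
  nlinarith [norm_nonneg (i u + t • v), sq_nonneg t]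

variable {g : W → ℝ}

theorem abs_mul_inv_norm_pow_le (h : IsUnitNormal i v) (hk : 2 ≤ k) {C : ℝ}
    (hC : ∀ x, |g x| ≤ C) {u : U} (hu : 1 ≤ ‖u‖) (t : ℝ) :
    ‖g (i u + t • v) * (‖i u + t • v‖ ^ k)⁻¹‖ ≤ C * (1 + t ^ 2)⁻¹ := by
  have hC0 : 0 ≤ C := (abs_nonneg _).trans (hC 0)
  rw [norm_mul, norm_inv, norm_pow, norm_norm]
  gcongr
  · exact hC _
  · exact h.one_add_sq_le_norm_pow hk hu t

variable [FiniteDimensional ℝ W] [MeasurableSpace W] [BorelSpace W]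

theorem continuousOn_lineIntegral (h : IsUnitNormal i v) (hk : 2 ≤ k) (hg : IsEvenAngular g) :
    ContinuousOn (lineIntegral g k i v) (sphere 0 1) := by
  obtain ⟨C, -, hC⟩ := hg.exists_bound
  have := hg.measurable
  intro u hu
  refine continuousWithinAt_of_dominated (bound := fun t ↦ C * (1 + t ^ 2)⁻¹)
    (.of_forall fun w ↦ Measurable.aestronglyMeasurable ?_) ?_
    (integrable_inv_one_add_sq.const_mul C) (.of_forall fun t ↦ ?_)
  · fun_prop
  · filter_upwards [self_mem_nhdsWithin] with w hw
    exact .of_forall (h.abs_mul_inv_norm_pow_le hk hC (mem_sphere_zero_iff_norm.1 hw).ge)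
  · have hne : i u + t • v ≠ 0 := by
      rw [← norm_ne_zero_iff, ← sq_pos_iff, h.norm_add_smul_sq, mem_sphere_zero_iff_norm.1 hu]
      positivity
    have hline : ContinuousAt (fun w : U ↦ i w + t • v) u := by
      have := i.continuous
      fun_prop
    exact ((ContinuousAt.comp (f := fun w : U ↦ i w + t • v) (hg.continuousAt hne) hline).mul
      ((hline.norm.pow _).inv₀ (pow_ne_zero _ (norm_ne_zero_iff.2 hne)))).continuousWithinAt

theorem isEvenAngular_lineIntegral (h : IsUnitNormal i v) (hk : 2 ≤ k) (hg : IsEvenAngular g) :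
    IsEvenAngular fun u ↦ lineIntegral g k i v (‖u‖⁻¹ • u) where
  continuousOn := by
    refine (h.continuousOn_lineIntegral hk hg).comp ?_ fun u hu ↦ ?_
    · exact (continuousOn_id.norm.inv₀ fun u hu ↦ norm_ne_zero_iff.2 hu).smul continuousOn_id
    · rw [mem_sphere_zero_iff_norm, norm_smul, norm_inv, norm_norm,
        inv_mul_cancel₀ (norm_ne_zero_iff.2 hu)]
  smul c u hc := by
    have hc' : |c| ≠ 0 := abs_ne_zero.2 hc
    have hcu : ‖c • u‖⁻¹ • c • u = (|c|⁻¹ * c) • (‖u‖⁻¹ • u) := by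
      rw [norm_smul, Real.norm_eq_abs, mul_inv, smul_smul, smul_smul, mul_right_comm]
    have habs : |(|c|⁻¹ * c)| = 1 := by rw [abs_mul, abs_inv, abs_abs, inv_mul_cancel₀ hc']
    simp only [hcu]
    rw [hg.lineIntegral_smul k i v (mul_ne_zero (inv_ne_zero hc') hc), habs, one_pow, inv_one,
      one_mul, one_mul]

variable [MeasurableSpace U] [BorelSpace U] [FiniteDimensional ℝ U] [Nontrivial U]

theorem integrable_indicator_mul_line (h : IsUnitNormal i v) (hg : IsEvenAngular g) :
    Integrable (fun p : U × ℝ ↦ (Icc 1 (Real.exp 1)).indicator 1 ‖p.1‖ *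
      (g (i p.1 + p.2 • v) * (‖i p.1 + p.2 • v‖ ^ finrank ℝ W)⁻¹)) ((lebesgue U).prod volume) := by
  obtain ⟨C, hC0, hC⟩ := hg.exists_bound
  have hbound : Integrable (fun p : U × ℝ ↦ (closedBall (0 : U) (Real.exp 1)).indicator
      (fun _ ↦ C) p.1 * (1 + p.2 ^ 2)⁻¹) ((lebesgue U).prod volume) :=
    ((integrable_indicator_iff measurableSet_closedBall).2
      (integrableOn_const measure_closedBall_lt_top.ne)).mul_prod integrable_inv_one_add_sq
  refine hbound.mono' (Measurable.aestronglyMeasurable ?_) (.of_forall fun ⟨u, t⟩ ↦ ?_)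
  · have := hg.measurable
    have hind : Measurable ((Icc 1 (Real.exp 1)).indicator (1 : ℝ → ℝ)) :=
      measurable_one.indicator measurableSet_Icc
    have := i.continuous.measurable
    fun_prop
  · by_cases hu : ‖u‖ ∈ Icc 1 (Real.exp 1)
    · rw [indicator_of_mem hu, indicator_of_mem (by simpa using hu.2), Pi.one_apply, one_mul]
      exact h.abs_mul_inv_norm_pow_le h.two_le_finrank hC hu.1 t
    · rw [indicator_of_notMem hu, zero_mul, norm_zero]
      exact mul_nonneg (indicator_nonneg (fun _ _ ↦ hC0) _) (by positivity)

theorem integral_indicator_mul_lineIntegral (h : IsUnitNormal i v) (hg : IsEvenAngular g) :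
    ∫ u, (Icc 1 (Real.exp 1)).indicator 1 ‖u‖ * lineIntegral g (finrank ℝ W) i v u ∂lebesgue U =
      ∫ θ : sphere (0 : U) 1, lineIntegral g (finrank ℝ W) i v θ ∂(lebesgue U).toSphere := by
  have hint := (h.integrable_indicator_mul_line hg).integral_prod_left
  simp only [integral_const_mul] at hint
  change Integrable (fun u ↦ _ * lineIntegral g (finrank ℝ W) i v u) _ at hint
  rw [integral_eq_integral_toSphere _ hint]
  congr with θ
  have hradial : ∀ r ∈ Ioi (0 : ℝ), r ^ (finrank ℝ U - 1) •
      ((Icc 1 (Real.exp 1)).indicator 1 ‖r • (θ : U)‖ *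
        lineIntegral g (finrank ℝ W) i v (r • (θ : U))) =
      lineIntegral g (finrank ℝ W) i v θ * (r⁻¹ * (Icc 1 (Real.exp 1)).indicator 1 (r * 1)) := by
    intro r (hr : 0 < r)
    have hpow : r ^ finrank ℝ W = r ^ (finrank ℝ U - 1) * r * r := by
      rw [h.finrank_eq, ← pow_succ, Nat.sub_add_cancel finrank_pos, pow_succ]
    rw [hg.lineIntegral_smul _ i v hr.ne', norm_smul, norm_eq_of_mem_sphere,
      Real.norm_of_nonneg hr.le, abs_of_pos hr, hpow, smul_eq_mul]
    field_simp
  rw [setIntegral_congr_fun measurableSet_Ioi hradial, integral_const_mul,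
    setIntegral_Ioi_inv_mul_indicator_Icc one_pos, mul_one]

theorem integral_toSphere_eq_integral_lineIntegral (h : IsUnitNormal i v)
    (hg : IsEvenAngular g) :
    ∫ θ : sphere (0 : W) 1, g θ ∂(lebesgue W).toSphere =
      ∫ θ : sphere (0 : U) 1, lineIntegral g (finrank ℝ W) i v θ ∂(lebesgue U).toSphere := by
  have : Nontrivial W := i.injective.nontrivial
  obtain ⟨e, he, hmp⟩ := h.exists_homeomorph
  set q : W → ℝ := fun x ↦ ‖(e.symm x).1‖
  have hq_e (p) : q (e p) = ‖p.1‖ := by simp only [q, e.symm_apply_apply]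
  have hq_smul (r : ℝ) (x : W) (hr : 0 < r) : q (r • x) = r * q x := by
    obtain ⟨p, rfl⟩ := e.surjective x
    rw [show r • e p = e (r • p) by simp [he, smul_smul], hq_e, hq_e, Prod.smul_fst, norm_smul,
      Real.norm_of_nonneg hr.le]
  have hq_pos : ∀ᵐ θ : sphere (0 : W) 1 ∂(lebesgue W).toSphere, 0 < q θ := by
    have hq : Continuous q := (continuous_fst.comp e.symm.continuous).norm
    refine ae_toSphere_of_ae_radial _ (p := fun x ↦ 0 < q x)
      (measurableSet_lt measurable_const hq.measurable) ?_
    have hfst : ∀ᵐ p ∂((lebesgue U).prod (volume : Measure ℝ)), p.1 ≠ 0 :=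
      Measure.quasiMeasurePreserving_fst.ae (p := (· ≠ (0 : U))) (Measure.ae_ne _ _)
    have hsymm := (hmp.symm e.toMeasurableEquiv).quasiMeasurePreserving.ae hfst
    filter_upwards [hsymm, Measure.ae_ne _ 0] with x hx hx0
    rw [hq_smul _ _ (by positivity)]
    exact mul_pos (by positivity) (norm_pos_iff.2 hx)
  set F : W → ℝ := fun x ↦ (Icc 1 (Real.exp 1)).indicator 1 (q x) *
    (g x * (‖x‖ ^ finrank ℝ W)⁻¹)
  have hFe (p) : F (e p) = (Icc 1 (Real.exp 1)).indicator 1 ‖p.1‖ *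
      (g (i p.1 + p.2 • v) * (‖i p.1 + p.2 • v‖ ^ finrank ℝ W)⁻¹) := by
    simp only [F, hq_e, ← he]
  have hFe_int : Integrable (fun p ↦ F (e p)) ((lebesgue U).prod volume) := by
    simpa only [hFe] using h.integrable_indicator_mul_line hg
  rw [← hg.integral_indicator_mul_inv_norm_pow _ hq_smul hq_pos
      ((hmp.integrable_comp_emb e.measurableEmbedding).1 hFe_int),
    ← hmp.integral_comp e.measurableEmbedding, integral_prod _ hFe_int,
    ← h.integral_indicator_mul_lineIntegral hg]
  simp only [hFe, integral_const_mul, lineIntegral]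

end IsUnitNormal

end Projection

section Gaussian

open Set Metric Module Filter
open scoped Topology

theorem integral_exp_neg_mul_sq_mul_cos {b : ℝ} (hb : 0 < b) (a : ℝ) :
    ∫ x : ℝ, Real.exp (-b * x ^ 2) * Real.cos (x * a) =
      √(Real.pi / b) * Real.exp (-(a ^ 2 / (4 * b))) := by
  have hb' : 0 < (b : ℂ).re := by rwa [Complex.ofReal_re]
  have hre (x : ℝ) : Real.exp (-b * x ^ 2) * Real.cos (x * a) =
      RCLike.re (Complex.exp (Complex.I * a * x) * Complex.exp (-(b : ℂ) * x ^ 2)) := by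
    rw [show -(b : ℂ) * x ^ 2 = ((-b * x ^ 2 : ℝ) : ℂ) by push_cast; rfl,
      show Complex.I * a * x = ((x * a : ℝ) : ℂ) * Complex.I by push_cast; ring,
      ← Complex.ofReal_exp, RCLike.re_eq_complex_re, Complex.re_mul_ofReal,
      Complex.exp_ofReal_mul_I_re, mul_comm]
  have hint : Integrable fun x : ℝ ↦
      Complex.exp (Complex.I * a * x) * Complex.exp (-(b : ℂ) * x ^ 2) := by
    refine (integrable_cexp_quadratic hb' (Complex.I * a) 0).congr (.of_forall fun x ↦ ?_)
    beta_reduce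
    rw [← Complex.exp_add, add_zero, add_comm]
  have hsqrt : ((Real.pi : ℂ) / b) ^ (1 / 2 : ℂ) = (√(Real.pi / b) : ℝ) := by
    rw [← Complex.ofReal_div, show (1 / 2 : ℂ) = ((1 / 2 : ℝ) : ℂ) by push_cast; rfl,
      ← Complex.ofReal_cpow (by positivity), ← Real.sqrt_eq_rpow]
  simp_rw [hre]
  rw [integral_re hint, fourierIntegral_gaussian hb', hsqrt,
    show -(a : ℂ) ^ 2 / (4 * b) = ((-(a ^ 2 / (4 * b)) : ℝ) : ℂ) by push_cast; ring,
    ← Complex.ofReal_exp, ← Complex.ofReal_mul, RCLike.re_eq_complex_re, Complex.ofReal_re]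

theorem integral_Ioi_exp_mul_cos {h : ℝ} (hh : 0 < h) (a : ℝ) :
    ∫ r in Ioi (0 : ℝ), Real.exp (-(h ^ 2 / 2) * r ^ 2) * Real.cos (r * a) =
      √(2 * Real.pi) / (2 * h) * Real.exp (-(a ^ 2 / (2 * h ^ 2))) := by
  have heven := integral_comp_abs (f := fun r ↦ Real.exp (-(h ^ 2 / 2) * r ^ 2) * Real.cos (r * a))
  have hcos (x : ℝ) : Real.cos (|x| * a) = Real.cos (x * a) := by
    rcases abs_choice x with hx | hx <;> simp [hx]
  simp only [sq_abs, hcos] at heven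
  rw [integral_exp_neg_mul_sq_mul_cos (by positivity),
    show Real.pi / (h ^ 2 / 2) = 2 * Real.pi / h ^ 2 by field_simp,
    Real.sqrt_div (by positivity), Real.sqrt_sq hh.le] at heven
  rw [← mul_right_injective₀ (two_ne_zero' ℝ) |>.eq_iff, ← heven]
  ring_nf

section Transform

variable {E : Type*} [NormedAddCommGroup E] [InnerProductSpace ℝ E] [FiniteDimensional ℝ E]
  [MeasurableSpace E] [BorelSpace E]

theorem integral_even_mul_cexp {μ : Measure E} [μ.IsAddHaarMeasure] {G : E → ℝ}
    (hG : Integrable G μ) (heven : ∀ x, G (-x) = G x) (ξ : E) :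
    ∫ x, (G x : ℂ) * Complex.exp (-(Complex.I * (inner ℝ x ξ : ℝ))) ∂μ =
      (∫ x, G x * Real.cos (inner ℝ x ξ) ∂μ : ℝ) := by
  have hnorm (s : ℝ) : ‖Complex.exp (-(Complex.I * s))‖ = 1 := by
    rw [show -(Complex.I * s) = ((-s : ℝ) : ℂ) * Complex.I by push_cast; ring]
    exact Complex.norm_exp_ofReal_mul_I _
  have hint : Integrable (fun x ↦ (G x : ℂ) * Complex.exp (-(Complex.I * (inner ℝ x ξ : ℝ)))) μ :=
    hG.ofReal.mul_bdd (c := 1) (Continuous.aestronglyMeasurable (by fun_prop))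
      (.of_forall fun x ↦ (hnorm _).le)
  have hneg := integral_neg_eq_self
    (fun x ↦ (G x : ℂ) * Complex.exp (-(Complex.I * (inner ℝ x ξ : ℝ)))) μ
  rw [← mul_right_injective₀ (two_ne_zero' ℂ) |>.eq_iff, two_mul]
  nth_rewrite 1 [← hneg]
  rw [← integral_add hint.comp_neg hint, ← integral_complex_ofReal, ← integral_const_mul]
  congr with x
  rw [heven, inner_neg_left]
  push_cast
  rw [← mul_add, mul_left_comm, Complex.two_cos]
  ring_nf

/-- The Fourier transform of `g x * ‖x‖ ^ (-k) * exp (-h² ‖x‖² / 2)`, `k = dim E - 1`. As `h → 0`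
the weight concentrates on the great subsphere orthogonal to `ξ`. -/
def gaussianRadon (g : E → ℝ) (h : ℝ) (ξ : E) : ℝ :=
  ∫ θ : sphere (0 : E) 1, g θ * (√(2 * Real.pi) / (2 * h) *
    Real.exp (-((inner ℝ (θ : E) ξ) ^ 2 / (2 * h ^ 2)))) ∂(lebesgue E).toSphere

variable {g : E → ℝ}

theorem measurable_gaussianRadon (hg : IsEvenAngular g) (h : ℝ) :
    Measurable (gaussianRadon g h) := by
  have hm := hg.measurable
  have : Measurable fun p : E × sphere (0 : E) 1 ↦ g p.2 * (√(2 * Real.pi) / (2 * h) *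
      Real.exp (-((inner ℝ (p.2 : E) p.1) ^ 2 / (2 * h ^ 2)))) := by fun_prop
  exact (this.stronglyMeasurable.integral_prod_right (ν := (lebesgue E).toSphere)).measurable

variable [Nontrivial E] {k : ℕ} {h : ℝ}

theorem integrable_gaussian_angular (hg : IsEvenAngular g) (hd : finrank ℝ E = k + 1)
    (hh : 0 < h) :
    Integrable (fun x ↦ g x * (‖x‖ ^ k)⁻¹ * Real.exp (-(h ^ 2 / 2) * ‖x‖ ^ 2)) (lebesgue E) := by
  obtain ⟨C, -, hC⟩ := hg.exists_bound
  have := hg.measurable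
  simp only [mul_assoc]
  exact (integrable_inv_norm_pow_mul (lebesgue E) hd
    (integrable_exp_neg_mul_sq (b := h ^ 2 / 2) (by positivity)).integrableOn).bdd_mul (c := C)
    this.aestronglyMeasurable (.of_forall hC)

theorem integral_gaussian_angular_cos (hg : IsEvenAngular g) (hd : finrank ℝ E = k + 1)
    (hh : 0 < h) (ξ : E) :
    ∫ x, g x * (‖x‖ ^ k)⁻¹ * Real.exp (-(h ^ 2 / 2) * ‖x‖ ^ 2) * Real.cos (inner ℝ x ξ)
        ∂lebesgue E = gaussianRadon g h ξ := by
  have hi : Integrable (fun x ↦ g x * (‖x‖ ^ k)⁻¹ * Real.exp (-(h ^ 2 / 2) * ‖x‖ ^ 2) *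
      Real.cos (inner ℝ x ξ)) (lebesgue E) :=
    (integrable_gaussian_angular hg hd hh).mul_bdd (c := 1)
      (Continuous.aestronglyMeasurable (by fun_prop)) (.of_forall fun x ↦ Real.abs_cos_le_one _)
  rw [integral_eq_integral_toSphere _ hi, gaussianRadon]
  congr with θ
  rw [← integral_Ioi_exp_mul_cos hh, ← integral_const_mul]
  refine setIntegral_congr_fun measurableSet_Ioi fun r (hr : 0 < r) ↦ ?_
  simp only [norm_smul, norm_eq_of_mem_sphere, mul_one, Real.norm_of_nonneg hr.le, hd,
    Nat.add_sub_cancel, hg.smul _ _ hr.ne', real_inner_smul_left, smul_eq_mul]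
  field_simp

theorem integral_gaussian_angular_cexp (hg : IsEvenAngular g) (hd : finrank ℝ E = k + 1)
    (hh : 0 < h) (ξ : E) :
    ∫ x, ((g x * (‖x‖ ^ k)⁻¹ * Real.exp (-(h ^ 2 / 2) * ‖x‖ ^ 2) : ℝ) : ℂ) *
      Complex.exp (-(Complex.I * (inner ℝ x ξ : ℝ))) ∂lebesgue E = gaussianRadon g h ξ := by
  rw [integral_even_mul_cexp (integrable_gaussian_angular hg hd hh)
    (fun x ↦ by rw [hg.neg, norm_neg]), integral_gaussian_angular_cos hg hd hh]

end Transform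

section Limit

variable {U W : Type*} [NormedAddCommGroup U] [InnerProductSpace ℝ U]
  [NormedAddCommGroup W] [InnerProductSpace ℝ W]

/-- The integrand of `gaussianRadon` after projection along `v` (with `ξ = c • v`) and rescaling of
the line parameter by `h`. -/
def rescaledGaussian (g : W → ℝ) (i : U →ₗᵢ[ℝ] W) (v : W) (c h : ℝ) (u : U) (s : ℝ) : ℝ :=
  g (i u + (h * s) • v) * (Real.exp (-(c ^ 2 * s ^ 2 / (2 * ‖i u + (h * s) • v‖ ^ 2))) *
    (‖i u + (h * s) • v‖ ^ finrank ℝ W)⁻¹)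

theorem exp_neg_div_mul_inv_le {N y : ℝ} (hN : 0 < N) (hy : 0 ≤ y) :
    Real.exp (-(y / N)) * N⁻¹ ≤ (N + y)⁻¹ := by
  rw [Real.exp_neg, ← mul_inv]
  gcongr
  calc N + y = (y / N + 1) * N := by field_simp; ring
    _ ≤ Real.exp (y / N) * N := by gcongr; exact Real.add_one_le_exp _

theorem integrable_const_mul_inv_one_add_mul_sq {α : Type*} [MeasurableSpace α] (μ : Measure α)
    [IsFiniteMeasure μ] (C : ℝ) {a : ℝ} (ha : a ≠ 0) :
    Integrable (fun p : α × ℝ ↦ C * (1 + (a * p.2) ^ 2)⁻¹) (μ.prod volume) :=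
  (integrable_const C).mul_prod (integrable_inv_one_add_sq.comp_mul_left' ha)

variable {g : W → ℝ} {i : U →ₗᵢ[ℝ] W} {v : W}

theorem IsUnitNormal.norm_rescaledGaussian_le [FiniteDimensional ℝ U] [Nontrivial U]
    (hi : IsUnitNormal i v) {C : ℝ} (hC : ∀ x, |g x| ≤ C) (c h : ℝ) {u : U} (hu : ‖u‖ = 1) (s : ℝ) :
    ‖rescaledGaussian g i v c h u s‖ ≤ C * (1 + (c / √2 * s) ^ 2)⁻¹ := by
  set x := i u + (h * s) • v
  have hx : ‖x‖ ^ 2 = 1 + (h * s) ^ 2 := by rw [hi.norm_add_smul_sq, hu, one_pow]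
  have hx1 : 1 ≤ ‖x‖ ^ 2 := by rw [hx]; exact le_add_of_nonneg_right (sq_nonneg _)
  have hpow : ‖x‖ ^ 2 ≤ ‖x‖ ^ finrank ℝ W :=
    hx ▸ hi.one_add_sq_le_norm_pow hi.two_le_finrank hu.ge (h * s)
  have hweight : Real.exp (-(c ^ 2 * s ^ 2 / (2 * ‖x‖ ^ 2))) * (‖x‖ ^ finrank ℝ W)⁻¹ ≤
      (1 + (c / √2 * s) ^ 2)⁻¹ := calc
    _ = Real.exp (-(c ^ 2 * s ^ 2 / 2 / ‖x‖ ^ 2)) * (‖x‖ ^ finrank ℝ W)⁻¹ := by rw [div_div]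
    _ ≤ Real.exp (-(c ^ 2 * s ^ 2 / 2 / ‖x‖ ^ 2)) * (‖x‖ ^ 2)⁻¹ := by gcongr
    _ ≤ (‖x‖ ^ 2 + c ^ 2 * s ^ 2 / 2)⁻¹ :=
      exp_neg_div_mul_inv_le (by positivity) (by positivity)
    _ ≤ (1 + c ^ 2 * s ^ 2 / 2)⁻¹ := by gcongr
    _ = _ := by rw [mul_pow, div_pow, Real.sq_sqrt zero_le_two, div_mul_eq_mul_div]
  rw [Real.norm_eq_abs, rescaledGaussian, abs_mul, abs_of_nonneg (a := Real.exp _ * _)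
    (by positivity)]
  exact mul_le_mul (hC _) hweight (by positivity) ((abs_nonneg _).trans (hC 0))

variable (i v) in
theorem tendsto_rescaledGaussian (hg : IsEvenAngular g) (c : ℝ) {u : U}
    (hu : ‖u‖ = 1) (s : ℝ) :
    Tendsto (fun h ↦ rescaledGaussian g i v c h u s) (𝓝 0)
      (𝓝 (g (i u) * Real.exp (-(c ^ 2 / 2) * s ^ 2))) := by
  have hnorm : ‖i u‖ = 1 := by rw [i.norm_map, hu]
  have hline : Tendsto (fun h : ℝ ↦ i u + (h * s) • v) (𝓝 0) (𝓝 (i u)) := by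
    have : Continuous fun h : ℝ ↦ i u + (h * s) • v := by fun_prop
    simpa using this.tendsto 0
  have hg' := (hg.continuousAt (norm_ne_zero_iff.1 (hnorm.trans_ne one_ne_zero))).tendsto.comp hline
  have hnorm' := hline.norm
  rw [hnorm] at hnorm'
  have hexp := (tendsto_const_nhds (x := c ^ 2 * s ^ 2)).div ((hnorm'.pow 2).const_mul 2)
    (by norm_num)
  have hlimit : g (i u) * Real.exp (-(c ^ 2 / 2) * s ^ 2) = g (i u) *
      (Real.exp (-(c ^ 2 * s ^ 2 / (2 * 1 ^ 2))) * (1 ^ finrank ℝ W)⁻¹) := by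
    rw [one_pow, one_pow, inv_one, mul_one, mul_one, neg_mul, div_mul_eq_mul_div]
  rw [hlimit]
  exact hg'.mul (((Real.continuous_exp.tendsto _).comp hexp.neg).mul
    ((hnorm'.pow (finrank ℝ W)).inv₀ (by simp)))

theorem IsUnitNormal.lineIntegral_mul_exp_eq [FiniteDimensional ℝ U] [Nontrivial U]
    (hi : IsUnitNormal i v) (g : W → ℝ) (c : ℝ) {h : ℝ} (hh : 0 < h) {u : U} (hu : ‖u‖ = 1) :
    lineIntegral
        (fun x ↦ g x * Real.exp (-((inner ℝ (‖x‖⁻¹ • x) (c • v)) ^ 2 / (2 * h ^ 2))))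
        (finrank ℝ W) i v u =
      h * ∫ s, rescaledGaussian g i v c h u s := by
  set A : W → ℝ := fun x ↦
    g x * Real.exp (-((inner ℝ (‖x‖⁻¹ • x) (c • v)) ^ 2 / (2 * h ^ 2))) with hA_def
  have hchange := Measure.integral_comp_mul_left
    (fun t ↦ A (i u + t • v) * (‖i u + t • v‖ ^ finrank ℝ W)⁻¹) h
  rw [abs_of_pos (inv_pos.2 hh), smul_eq_mul, eq_inv_mul_iff_mul_eq₀ hh.ne'] at hchange
  rw [lineIntegral, ← hchange]
  congr with s
  have hne : ‖i u + (h * s) • v‖ ≠ 0 := by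
    have := hi.one_add_sq_le_norm_pow hi.two_le_finrank hu.ge (h * s)
    contrapose! this
    rw [this, zero_pow (by rw [hi.finrank_eq]; simp)]
    positivity
  have hinner : inner ℝ (i u + (h * s) • v) (c • v) = c * (h * s) := by
    rw [inner_smul_right, inner_add_left, hi.inner_eq_zero, inner_smul_left,
      real_inner_self_eq_norm_sq, hi.norm_eq_one]
    simp
  simp only [hA_def, rescaledGaussian, real_inner_smul_left, hinner]
  rw [mul_assoc]
  congr 4
  field_simp

variable [FiniteDimensional ℝ U] [MeasurableSpace U] [BorelSpace U] [FiniteDimensional ℝ W]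
  [MeasurableSpace W] [BorelSpace W]

variable (i v) in
theorem aestronglyMeasurable_rescaledGaussian (hg : IsEvenAngular g) (c h : ℝ) :
    AEStronglyMeasurable (fun p : sphere (0 : U) 1 × ℝ ↦ rescaledGaussian g i v c h p.1 p.2)
      ((lebesgue U).toSphere.prod volume) := by
  have hm := hg.measurable
  have hi := i.continuous.measurable
  unfold rescaledGaussian
  exact Measurable.aestronglyMeasurable (by fun_prop)

namespace IsUnitNormal

variable [Nontrivial U]

theorem integrable_rescaledGaussian (hi : IsUnitNormal i v) (hg : IsEvenAngular g) {c : ℝ}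
    (hc : 0 < c) (h : ℝ) :
    Integrable (fun p : sphere (0 : U) 1 × ℝ ↦ rescaledGaussian g i v c h p.1 p.2)
      ((lebesgue U).toSphere.prod volume) := by
  obtain ⟨C, -, hC⟩ := hg.exists_bound
  exact (integrable_const_mul_inv_one_add_mul_sq _ C (a := c / √2) (by positivity)).mono'
    (aestronglyMeasurable_rescaledGaussian i v hg c h)
    (.of_forall fun p ↦ hi.norm_rescaledGaussian_le hC c h (norm_eq_of_mem_sphere p.1) p.2)

theorem gaussianRadon_smul (hi : IsUnitNormal i v) (hg : IsEvenAngular g) {c h : ℝ} (hc : 0 < c)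
    (hh : 0 < h) :
    gaussianRadon g h (c • v) = √(2 * Real.pi) / 2 *
      ∫ p : sphere (0 : U) 1 × ℝ, rescaledGaussian g i v c h p.1 p.2
        ∂((lebesgue U).toSphere.prod volume) := by
  set A : W → ℝ := fun x ↦
    g x * Real.exp (-((inner ℝ (‖x‖⁻¹ • x) (c • v)) ^ 2 / (2 * h ^ 2))) with hA_def
  have hA : IsEvenAngular A := hg.mul
    (isEvenAngular_comp_inner (m := fun z ↦ Real.exp (-(z ^ 2 / (2 * h ^ 2)))) (by fun_prop)
      (fun z ↦ by simp only [neg_sq]) _)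
  have hline (u : sphere (0 : U) 1) :
      lineIntegral A (finrank ℝ W) i v u = h * ∫ s, rescaledGaussian g i v c h u s :=
    hi.lineIntegral_mul_exp_eq g c hh (norm_eq_of_mem_sphere u)
  have hsphere : gaussianRadon g h (c • v) =
      √(2 * Real.pi) / (2 * h) * ∫ θ : sphere (0 : W) 1, A θ ∂(lebesgue W).toSphere := by
    rw [gaussianRadon, ← integral_const_mul]
    congr with θ
    rw [hA_def]
    simp only [norm_eq_of_mem_sphere, inv_one, one_smul]
    ring
  rw [hsphere, hi.integral_toSphere_eq_integral_lineIntegral hA,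
    integral_prod _ (hi.integrable_rescaledGaussian hg hc h)]
  simp_rw [hline]
  rw [integral_const_mul]
  field_simp

theorem abs_gaussianRadon_le (hi : IsUnitNormal i v) (hg : IsEvenAngular g) {C : ℝ}
    (hC : ∀ x, |g x| ≤ C) {c h : ℝ} (hc : 0 < c) (hh : 0 < h) :
    |gaussianRadon g h (c • v)| ≤
      √Real.pi * Real.pi * C * (lebesgue U).toSphere.real univ * c⁻¹ := by
  have hbound := norm_integral_le_of_norm_le
    (integrable_const_mul_inv_one_add_mul_sq (lebesgue U).toSphere C (a := c / √2) (by positivity))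
    (.of_forall fun p ↦ hi.norm_rescaledGaussian_le hC c h (norm_eq_of_mem_sphere p.1) p.2)
  rw [integral_prod_mul (fun _ ↦ C) (fun s ↦ (1 + (c / √2 * s) ^ 2)⁻¹), integral_const,
    Measure.integral_comp_mul_left (fun s ↦ (1 + s ^ 2)⁻¹), integral_univ_inv_one_add_sq,
    abs_of_pos (by positivity), Real.norm_eq_abs, smul_eq_mul, smul_eq_mul] at hbound
  rw [hi.gaussianRadon_smul hg hc hh, abs_mul, abs_of_pos (by positivity)]
  refine (mul_le_mul_of_nonneg_left hbound (by positivity)).trans_eq ?_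
  rw [Real.sqrt_mul zero_le_two]
  have := Real.mul_self_sqrt (zero_le_two (α := ℝ))
  field_simp
  linear_combination C * (lebesgue U).toSphere.real univ * this

theorem tendsto_gaussianRadon (hi : IsUnitNormal i v) (hg : IsEvenAngular g) {c : ℝ}
    (hc : 0 < c) :
    Tendsto (fun h ↦ gaussianRadon g h (c • v)) (𝓝[>] 0)
      (𝓝 (Real.pi * c⁻¹ * ∫ θ : sphere (0 : U) 1, g (i θ) ∂(lebesgue U).toSphere)) := by
  obtain ⟨C, -, hC⟩ := hg.exists_bound
  have hlim : Tendsto (fun h ↦ ∫ p : sphere (0 : U) 1 × ℝ, rescaledGaussian g i v c h p.1 p.2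
      ∂((lebesgue U).toSphere.prod volume)) (𝓝[>] 0)
      (𝓝 (∫ p : sphere (0 : U) 1 × ℝ, g (i p.1) * Real.exp (-(c ^ 2 / 2) * p.2 ^ 2)
        ∂((lebesgue U).toSphere.prod volume))) :=
    tendsto_integral_filter_of_dominated_convergence _
      (.of_forall fun h ↦ aestronglyMeasurable_rescaledGaussian i v hg c h)
      (.of_forall fun h ↦ .of_forall fun p ↦
        hi.norm_rescaledGaussian_le hC c h (norm_eq_of_mem_sphere p.1) p.2)
      (integrable_const_mul_inv_one_add_mul_sq _ C (a := c / √2) (by positivity))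
      (.of_forall fun p ↦ (tendsto_rescaledGaussian i v hg c (norm_eq_of_mem_sphere p.1)
        p.2).mono_left nhdsWithin_le_nhds)
  rw [integral_prod_mul (fun θ : sphere (0 : U) 1 ↦ g (i θ))
    (fun s ↦ Real.exp (-(c ^ 2 / 2) * s ^ 2)), integral_gaussian,
    show Real.pi / (c ^ 2 / 2) = 2 * Real.pi / c ^ 2 by field_simp,
    Real.sqrt_div (by positivity), Real.sqrt_sq hc.le] at hlim
  have hconst : √(2 * Real.pi) / 2 * (√(2 * Real.pi) / c) = Real.pi * c⁻¹ := by
    rw [div_mul_div_comm, Real.mul_self_sqrt (by positivity)]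
    field_simp
  rw [← hconst, mul_assoc, mul_comm (√(2 * Real.pi) / c)]
  exact (hlim.const_mul _).congr' (eventually_nhdsWithin_of_forall fun h (hh : 0 < h) ↦
    (hi.gaussianRadon_smul hg hc hh).symm)

end IsUnitNormal

end Limit

end Gaussian

section Fourier

open Set Metric Module Filter
open scoped Topology FourierTransform

section Limit

variable {E : Type*} [NormedAddCommGroup E] [InnerProductSpace ℝ E] [FiniteDimensional ℝ E]

theorem nontrivial_orthogonal_span (hd : 2 ≤ finrank ℝ E) {ξ : E} (hξ : ξ ≠ 0) :
    Nontrivial (ℝ ∙ ξ)ᗮ :=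
  nontrivial_of_finrank_pos (R := ℝ) (by have := finrank_orthogonal_span hξ; lia)

variable [MeasurableSpace E] [BorelSpace E] {g : E → ℝ}

/-- The spherical Radon transform: the integral of `g` over the great subsphere `S ∩ ξ^⊥`. -/
def sphericalRadon (g : E → ℝ) (ξ : E) : ℝ :=
  ∫ θ : sphere (0 : (ℝ ∙ ξ)ᗮ) 1, g (θ : (ℝ ∙ ξ)ᗮ) ∂(lebesgue (ℝ ∙ ξ)ᗮ).toSphere

theorem tendsto_gaussianRadon_sphericalRadon (hd : 2 ≤ finrank ℝ E) (hg : IsEvenAngular g) {ξ : E}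
    (hξ : ξ ≠ 0) :
    Tendsto (fun h ↦ gaussianRadon g h ξ) (𝓝[>] 0)
      (𝓝 (Real.pi * ‖ξ‖⁻¹ * sphericalRadon g ξ)) := by
  have := nontrivial_orthogonal_span hd hξ
  have hlim := (isUnitNormal_orthogonal_span hξ).tendsto_gaussianRadon hg (norm_pos_iff.2 hξ)
  rwa [smul_inv_smul₀ (norm_ne_zero_iff.2 hξ)] at hlim

theorem exists_abs_gaussianRadon_le (hd : 2 ≤ finrank ℝ E) (hg : IsEvenAngular g) :
    ∃ C, 0 ≤ C ∧ ∀ h > 0, ∀ ξ : E, ξ ≠ 0 → |gaussianRadon g h ξ| ≤ C * ‖ξ‖⁻¹ := by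
  obtain ⟨C, hC0, hC⟩ := hg.exists_bound
  set U := EuclideanSpace ℝ (Fin (finrank ℝ E - 1))
  refine ⟨√Real.pi * Real.pi * C * (lebesgue U).toSphere.real univ, by positivity,
    fun h hh ξ hξ ↦ ?_⟩
  have := nontrivial_orthogonal_span hd hξ
  have hrank : finrank ℝ (ℝ ∙ ξ)ᗮ = finrank ℝ U := by
    rw [finrank_euclideanSpace_fin, finrank_orthogonal_span hξ, Nat.add_sub_cancel]
  have hbound :=
    (isUnitNormal_orthogonal_span hξ).abs_gaussianRadon_le hg hC (norm_pos_iff.2 hξ) hh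
  rwa [smul_inv_smul₀ (norm_ne_zero_iff.2 hξ), Measure.toSphere_real_apply_univ, hrank,
    lebesgue_real_ball_congr hrank, ← Measure.toSphere_real_apply_univ] at hbound

end Limit

variable {n : ℕ}

theorem testFourier_eq (φ : 𝓢(EuclideanSpace ℝ (Fin n), ℂ)) (x : EuclideanSpace ℝ (Fin n)) :
    testFourier φ x = 𝓕 φ ((2 * Real.pi)⁻¹ • x) := by
  rw [testFourier, SchwartzMap.fourier_coe, Real.fourier_eq']
  congr with y
  rw [smul_eq_mul, mul_comm, inner_smul_right, real_inner_comm]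
  congr 2
  push_cast
  have : (Real.pi : ℂ) ≠ 0 := by exact_mod_cast Real.pi_ne_zero
  field_simp

theorem continuous_testFourier (φ : 𝓢(EuclideanSpace ℝ (Fin n), ℂ)) :
    Continuous (testFourier φ) := by
  rw [funext (testFourier_eq φ)]
  exact (𝓕 φ).continuous.comp (continuous_const_smul _)

theorem exists_norm_pow_mul_schwartz_le (φ : 𝓢(EuclideanSpace ℝ (Fin n), ℂ)) (k : ℕ) :
    ∃ C, 0 ≤ C ∧ ∀ x, ‖x‖ ^ k * ‖φ x‖ ≤ C * (1 + ‖x‖ ^ 2)⁻¹ := by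
  obtain ⟨A, hA0, hA⟩ := φ.decay k 0
  obtain ⟨B, hB0, hB⟩ := φ.decay (k + 2) 0
  simp only [norm_iteratedFDeriv_zero] at hA hB
  refine ⟨A + B, by positivity, fun x ↦ ?_⟩
  rw [← div_eq_mul_inv, le_div_iff₀ (by positivity)]
  calc ‖x‖ ^ k * ‖φ x‖ * (1 + ‖x‖ ^ 2) = ‖x‖ ^ k * ‖φ x‖ + ‖x‖ ^ (k + 2) * ‖φ x‖ := by ring
    _ ≤ A + B := add_le_add (hA x) (hB x)

theorem exists_norm_testFourier_le (φ : 𝓢(EuclideanSpace ℝ (Fin n), ℂ)) :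
    ∃ C, 0 ≤ C ∧ ∀ x, ‖testFourier φ x‖ ≤ C * (1 + ((2 * Real.pi)⁻¹ * ‖x‖) ^ 2)⁻¹ := by
  obtain ⟨C, hC0, hC⟩ := exists_norm_pow_mul_schwartz_le (𝓕 φ) 0
  refine ⟨C, hC0, fun x ↦ ?_⟩
  have hx := hC ((2 * Real.pi)⁻¹ • x)
  rwa [pow_zero, one_mul, norm_smul, Real.norm_of_nonneg (by positivity), ← testFourier_eq] at hx

variable {k : ℕ}

theorem integrable_inv_norm_mul_schwartz (hk : 1 ≤ k)
    (φ : 𝓢(EuclideanSpace ℝ (Fin (k + 1)), ℂ)) : Integrable (fun x ↦ ‖x‖⁻¹ * ‖φ x‖) := by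
  obtain ⟨j, rfl⟩ : ∃ j, k = j + 1 := ⟨k - 1, by lia⟩
  obtain ⟨C, hC0, hC⟩ := exists_norm_pow_mul_schwartz_le φ j
  have hdom := (integrable_inv_norm_pow_mul (volume : Measure (EuclideanSpace ℝ (Fin (j + 1 + 1))))
    (k := j + 1) (by simp) integrable_inv_one_add_sq.integrableOn).const_mul C
  have hφ := φ.continuous.measurable
  refine hdom.mono' (Measurable.aestronglyMeasurable (by fun_prop)) (.of_forall fun x ↦ ?_)
  rw [Real.norm_of_nonneg (by positivity)]
  rcases eq_or_ne x 0 with rfl | hx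
  · rw [norm_zero, inv_zero, zero_mul]
    positivity
  calc ‖x‖⁻¹ * ‖φ x‖ = (‖x‖ ^ (j + 1))⁻¹ * (‖x‖ ^ j * ‖φ x‖) := by
        have := norm_ne_zero_iff.2 hx
        rw [pow_succ]
        field_simp
    _ ≤ (‖x‖ ^ (j + 1))⁻¹ * (C * (1 + ‖x‖ ^ 2)⁻¹) :=
        mul_le_mul_of_nonneg_left (hC x) (by positivity)
    _ = _ := by ring

variable {g : EuclideanSpace ℝ (Fin (k + 1)) → ℝ}

theorem integrable_angular_mul_testFourier (hg : IsEvenAngular g)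
    (φ : 𝓢(EuclideanSpace ℝ (Fin (k + 1)), ℂ)) :
    Integrable (fun x ↦ ((g x * (‖x‖ ^ k)⁻¹ : ℝ) : ℂ) * testFourier φ x) := by
  obtain ⟨C, -, hC⟩ := exists_norm_testFourier_le φ
  obtain ⟨A, hA0, hA⟩ := hg.exists_bound
  have hdom := (integrable_inv_norm_pow_mul (volume : Measure (EuclideanSpace ℝ (Fin (k + 1))))
    (k := k) (by simp) (integrable_inv_one_add_sq.comp_mul_left' (R := (2 * Real.pi)⁻¹)
      (by positivity)).integrableOn).const_mul (A * C)
  have hφ := (continuous_testFourier φ).measurable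
  have hg' := hg.measurable
  refine hdom.mono' (Measurable.aestronglyMeasurable (by fun_prop)) (.of_forall fun x ↦ ?_)
  rw [norm_mul, Complex.norm_real, norm_mul, norm_inv, norm_pow, norm_norm]
  calc _ ≤ A * (‖x‖ ^ k)⁻¹ * (C * (1 + ((2 * Real.pi)⁻¹ * ‖x‖) ^ 2)⁻¹) := by
        gcongr
        exacts [hA x, hC x]
    _ = _ := by ring

theorem integral_gaussian_angular_mul_testFourier (hg : IsEvenAngular g) {h : ℝ} (hh : 0 < h)
    (φ : 𝓢(EuclideanSpace ℝ (Fin (k + 1)), ℂ)) :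
    ∫ x, ((g x * (‖x‖ ^ k)⁻¹ * Real.exp (-(h ^ 2 / 2) * ‖x‖ ^ 2) : ℝ) : ℂ) * testFourier φ x =
      ∫ y, (gaussianRadon g h y : ℂ) * φ y := by
  have hd : finrank ℝ (EuclideanSpace ℝ (Fin (k + 1))) = k + 1 := by simp
  have hG := (integrable_gaussian_angular hg hd hh).ofReal (𝕜 := ℂ)
  have hprod := (hG.mul_prod (ν := volume) φ.integrable).mul_bdd (c := 1)
    (g := fun p : EuclideanSpace ℝ (Fin (k + 1)) × EuclideanSpace ℝ (Fin (k + 1)) ↦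
      Complex.exp (-(Complex.I * ((inner ℝ p.1 p.2 : ℝ) : ℂ))))
    (Continuous.aestronglyMeasurable (by fun_prop)) (.of_forall fun p ↦ by
      rw [show -(Complex.I * ((inner ℝ p.1 p.2 : ℝ) : ℂ)) =
        ((-inner ℝ p.1 p.2 : ℝ) : ℂ) * Complex.I by push_cast; ring]
      exact (Complex.norm_exp_ofReal_mul_I _).le)
  simp_rw [← integral_gaussian_angular_cexp hg hd hh, testFourier, ← integral_const_mul,
    ← integral_mul_const]
  rw [integral_integral_swap]
  · congr with y
    congr with x
    ring
  · refine hprod.congr (.of_forall fun p ↦ ?_)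
    simp only [Function.uncurry]
    rw [mul_assoc]
    rfl

theorem tendsto_integral_gaussian_angular_mul_testFourier (hg : IsEvenAngular g)
    (φ : 𝓢(EuclideanSpace ℝ (Fin (k + 1)), ℂ)) :
    Tendsto (fun h : ℝ ↦ ∫ x, ((g x * (‖x‖ ^ k)⁻¹ * Real.exp (-(h ^ 2 / 2) * ‖x‖ ^ 2) : ℝ) : ℂ) *
        testFourier φ x) (𝓝 0)
      (𝓝 (∫ x, ((g x * (‖x‖ ^ k)⁻¹ : ℝ) : ℂ) * testFourier φ x)) := by
  have hg' := hg.measurable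
  have hφ := (continuous_testFourier φ).measurable
  refine tendsto_integral_filter_of_dominated_convergence _
    (.of_forall fun h ↦ Measurable.aestronglyMeasurable (by fun_prop))
    (.of_forall fun h ↦ .of_forall fun x ↦ ?_) (integrable_angular_mul_testFourier hg φ).norm
    (.of_forall fun x ↦ ?_)
  · have hexp : Real.exp (-(h ^ 2 / 2) * ‖x‖ ^ 2) ≤ 1 :=
      Real.exp_le_one_iff.2 (by rw [neg_mul, neg_nonpos]; positivity)
    rw [norm_mul, norm_mul, Complex.norm_real, Complex.norm_real, norm_mul,
      Real.norm_eq_abs (.exp _), Real.abs_exp]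
    gcongr
    exact mul_le_of_le_one_right (norm_nonneg _) hexp
  · have : Continuous fun h : ℝ ↦ ((g x * (‖x‖ ^ k)⁻¹ *
      Real.exp (-(h ^ 2 / 2) * ‖x‖ ^ 2) : ℝ) : ℂ) * testFourier φ x := by fun_prop
    simpa using this.tendsto 0

theorem ae_tendsto_gaussianRadon (hk : 1 ≤ k) (hg : IsEvenAngular g) :
    ∀ᵐ x, Tendsto (fun h ↦ gaussianRadon g h x) (𝓝[>] 0)
      (𝓝 (Real.pi * ‖x‖⁻¹ * sphericalRadon g x)) :=
  (Measure.ae_ne volume 0).mono fun _ hx ↦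
    tendsto_gaussianRadon_sphericalRadon (by simpa using hk) hg hx

theorem integrable_sphericalRadon_mul_schwartz (hk : 1 ≤ k) (hg : IsEvenAngular g)
    (φ : 𝓢(EuclideanSpace ℝ (Fin (k + 1)), ℂ)) :
    Integrable fun x ↦ ((Real.pi * ‖x‖⁻¹ * sphericalRadon g x : ℝ) : ℂ) * φ x := by
  obtain ⟨C, -, hC⟩ := exists_abs_gaussianRadon_le (by simpa using hk) hg
  have hmeas : AEStronglyMeasurable (fun x ↦ Real.pi * ‖x‖⁻¹ * sphericalRadon g x) :=
    aestronglyMeasurable_of_tendsto_ae (𝓝[>] 0)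
      (fun h ↦ (measurable_gaussianRadon hg h).aestronglyMeasurable)
      (ae_tendsto_gaussianRadon hk hg)
  refine ((integrable_inv_norm_mul_schwartz hk φ).const_mul C).mono'
    ((Complex.continuous_ofReal.comp_aestronglyMeasurable hmeas).mul
      φ.continuous.aestronglyMeasurable) ?_
  filter_upwards [Measure.ae_ne volume 0, ae_tendsto_gaussianRadon hk hg] with x hx hlim
  rw [norm_mul, Complex.norm_real, ← mul_assoc]
  gcongr
  exact le_of_tendsto hlim.norm
    (eventually_nhdsWithin_of_forall fun h (hh : 0 < h) ↦ hC h hh x hx)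

theorem tendsto_integral_gaussianRadon_mul_schwartz (hk : 1 ≤ k) (hg : IsEvenAngular g)
    (φ : 𝓢(EuclideanSpace ℝ (Fin (k + 1)), ℂ)) :
    Tendsto (fun h : ℝ ↦ ∫ x, (gaussianRadon g h x : ℂ) * φ x) (𝓝[>] 0)
      (𝓝 (∫ x, ((Real.pi * ‖x‖⁻¹ * sphericalRadon g x : ℝ) : ℂ) * φ x)) := by
  obtain ⟨C, -, hC⟩ := exists_abs_gaussianRadon_le (by simpa using hk) hg
  refine tendsto_integral_filter_of_dominated_convergence _
    (.of_forall fun h ↦ (Complex.measurable_ofReal.comp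
      (measurable_gaussianRadon hg h)).aestronglyMeasurable.mul φ.continuous.aestronglyMeasurable)
    (eventually_nhdsWithin_of_forall fun h (hh : 0 < h) ↦ ?_)
    ((integrable_inv_norm_mul_schwartz hk φ).const_mul C) ?_
  · filter_upwards [Measure.ae_ne volume 0] with x hx
    rw [norm_mul, Complex.norm_real, ← mul_assoc]
    gcongr
    exact hC h hh x hx
  · filter_upwards [ae_tendsto_gaussianRadon hk hg] with x hlim
    exact ((Complex.continuous_ofReal.tendsto _).comp hlim).mul_const _

theorem isDistributionalFourierTransform_angular (hk : 1 ≤ k) (hg : IsEvenAngular g) :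
    IsDistributionalFourierTransform (fun x ↦ g x * (‖x‖ ^ k)⁻¹)
      (fun x ↦ Real.pi * ‖x‖⁻¹ * sphericalRadon g x) := fun φ ↦
  ⟨integrable_angular_mul_testFourier hg φ, integrable_sphericalRadon_mul_schwartz hk hg φ,
    tendsto_nhds_unique (tendsto_integral_gaussianRadon_mul_schwartz hk hg φ)
      (((tendsto_integral_gaussian_angular_mul_testFourier hg φ).mono_left
        nhdsWithin_le_nhds).congr' (eventually_nhdsWithin_of_forall fun _ hh ↦
          integral_gaussian_angular_mul_testFourier hg hh φ))⟩

end Fourier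

section Positivity

open Set Metric Module Filter
open scoped Topology FourierTransform

theorem IsMinkowskiFunctional.isEvenAngular {E : Type*} [NormedAddCommGroup E]
    [InnerProductSpace ℝ E] {N : E → ℝ} (h : IsMinkowskiFunctional N) (c : ℝ) (k : ℕ) :
    IsEvenAngular fun x ↦ c * (‖x‖ * (N x)⁻¹) ^ k where
  continuousOn := ((continuous_norm.continuousOn.mul
    (h.continuous.continuousOn.inv₀ fun x hx ↦ (h.pos x hx).ne')).pow k).const_mul c
  smul a x ha := by
    have : |a| ≠ 0 := abs_ne_zero.2 ha
    simp only [norm_smul, h.smul, Real.norm_eq_abs]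
    congr 2
    field_simp

section General

variable {E : Type*} [NormedAddCommGroup E] [InnerProductSpace ℝ E] [FiniteDimensional ℝ E]
  [MeasurableSpace E] [BorelSpace E]

theorem sphericalRadon_smul (g : E → ℝ) {c : ℝ} (hc : c ≠ 0) (ξ : E) :
    sphericalRadon g (c • ξ) = sphericalRadon g ξ := by
  have hspan : (ℝ ∙ (c • ξ)) = (ℝ ∙ ξ) := Submodule.span_singleton_smul_eq (IsUnit.mk0 c hc) ξ
  let radon (S : Submodule ℝ E) : ℝ := ∫ θ : sphere (0 : Sᗮ) 1, g (θ : Sᗮ) ∂(lebesgue Sᗮ).toSphere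
  change radon _ = radon _
  rw [hspan]

theorem sphericalRadon_const_mul (g : E → ℝ) (c : ℝ) (ξ : E) :
    sphericalRadon (fun x ↦ c * g x) ξ = c * sphericalRadon g ξ :=
  integral_const_mul _ _

theorem IsMinkowskiFunctional.mul_centralSectionVolume {N : E → ℝ}
    (h : IsMinkowskiFunctional N) {k : ℕ} (hk : 1 ≤ k) (hd : finrank ℝ E = k + 1) {ξ : E}
    (hξ : ξ ≠ 0) :
    k * centralSectionVolume {x | N x ≤ 1} ξ =
      sphericalRadon (fun x ↦ (‖x‖ * (N x)⁻¹) ^ k) ξ := by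
  have := nontrivial_orthogonal_span (by lia) hξ
  have hrank : finrank ℝ (ℝ ∙ ξ)ᗮ = k := by rw [finrank_orthogonal_span hξ] at hd; lia
  have hvol := (h.comp_linearIsometry (ℝ ∙ ξ)ᗮ.subtypeₗᵢ).finrank_mul_measureReal
    (lebesgue (ℝ ∙ ξ)ᗮ)
  rw [hrank] at hvol
  refine hvol.trans ?_
  rw [sphericalRadon]
  congr with θ
  rw [Submodule.norm_coe, norm_eq_of_mem_sphere, one_mul]
  rfl

end General

theorem IsIntersectionBodyOf.exists_radialFunction_eq_sphericalRadon {E : Type*}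
    [NormedAddCommGroup E] [InnerProductSpace ℝ E] [FiniteDimensional ℝ E] [MeasurableSpace E]
    [BorelSpace E] {k : ℕ} (hk : 1 ≤ k) (hd : finrank ℝ E = k + 1) {M L : Set E}
    (hML : IsIntersectionBodyOf M L) :
    ∃ f : E → ℝ, IsEvenAngular f ∧ (∀ x, 0 ≤ f x) ∧
      ∀ ξ, ‖ξ‖ = 1 → radialFunction M ξ = Real.pi * sphericalRadon f ξ := by
  have hN := hML.starBody_right.isMinkowskiFunctional_gauge hML.symmetric_right
  refine ⟨fun x ↦ (Real.pi * k)⁻¹ * (‖x‖ * (gauge L x)⁻¹) ^ k, hN.isEvenAngular _ k,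
    fun x ↦ ?_, fun ξ hξ ↦ ?_⟩
  · have := gauge_nonneg (s := L) x
    positivity
  · rw [hML.radial_eq ξ hξ, sphericalRadon_const_mul, ← hN.mul_centralSectionVolume hk hd
      (norm_ne_zero_iff.1 (hξ.trans_ne one_ne_zero)),
      ← hML.starBody_right.eq_gauge_le_one]
    have : (k : ℝ) ≠ 0 := by positivity
    field_simp

theorem exists_testFourier_eq_bump {n : ℕ} (x₀ : EuclideanSpace ℝ (Fin n)) {r : ℝ} (hr : 0 < r) :
    ∃ (φ : 𝓢(EuclideanSpace ℝ (Fin n), ℂ)) (b : EuclideanSpace ℝ (Fin n) → ℝ),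
      (∀ x, testFourier φ x = b x) ∧ (∀ x, 0 ≤ b x) ∧ Function.support b = ball x₀ r := by
  have : 0 < 2 * Real.pi := by positivity
  let f : ContDiffBump ((2 * Real.pi)⁻¹ • x₀) :=
    ⟨(2 * Real.pi)⁻¹ * (r / 2), (2 * Real.pi)⁻¹ * r, by positivity, by gcongr; linarith⟩
  have hs : HasCompactSupport fun x ↦ (f x : ℂ) :=
    f.hasCompactSupport.comp_left (g := ((↑) : ℝ → ℂ)) Complex.ofReal_zero
  have hc : ContDiff ℝ (⊤ : ℕ∞) fun x ↦ (f x : ℂ) := Complex.ofRealCLM.contDiff.comp f.contDiff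
  refine ⟨𝓕⁻ (hs.toSchwartzMap hc), fun x ↦ f ((2 * Real.pi)⁻¹ • x), fun x ↦ ?_,
    fun x ↦ f.nonneg, ?_⟩
  · rw [testFourier_eq, FourierTransform.fourier_fourierInv_eq]
    rfl
  · ext x
    change _ ∈ Function.support f ↔ _
    rw [f.support_eq, mem_ball, mem_ball, dist_smul₀, Real.norm_of_nonneg (by positivity)]
    exact mul_lt_mul_iff_right₀ (by positivity)

variable {k : ℕ}

theorem norm_integral_angular_mul_testFourier_sub_le (hk : 1 ≤ k)
    {f g : EuclideanSpace ℝ (Fin (k + 1)) → ℝ} (hf : IsEvenAngular f) (hg : IsEvenAngular g)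
    {δ : ℝ} (hδ : ∀ ξ, ‖ξ‖ = 1 → |Real.pi * sphericalRadon f ξ - Real.pi * sphericalRadon g ξ| ≤ δ)
    (φ : 𝓢(EuclideanSpace ℝ (Fin (k + 1)), ℂ)) :
    ‖(∫ x, ((f x * (‖x‖ ^ k)⁻¹ : ℝ) : ℂ) * testFourier φ x) -
      ∫ x, ((g x * (‖x‖ ^ k)⁻¹ : ℝ) : ℂ) * testFourier φ x‖ ≤ δ * ∫ x, ‖x‖⁻¹ * ‖φ x‖ := by
  obtain ⟨-, hfi, hf_eq⟩ := isDistributionalFourierTransform_angular hk hf φ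
  obtain ⟨-, hgi, hg_eq⟩ := isDistributionalFourierTransform_angular hk hg φ
  rw [← hf_eq, ← hg_eq, ← integral_sub hfi hgi, ← integral_const_mul]
  refine norm_integral_le_of_norm_le ((integrable_inv_norm_mul_schwartz hk φ).const_mul _) ?_
  filter_upwards [Measure.ae_ne volume 0] with x hx
  have hx' : ‖x‖⁻¹ ≠ 0 := inv_ne_zero (norm_ne_zero_iff.2 hx)
  have hclose := hδ (‖x‖⁻¹ • x) (norm_smul_inv_norm hx)
  rw [sphericalRadon_smul _ hx', sphericalRadon_smul _ hx'] at hclose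
  rw [← sub_mul, ← Complex.ofReal_sub, norm_mul, Complex.norm_real, ← mul_assoc]
  gcongr
  calc ‖Real.pi * ‖x‖⁻¹ * sphericalRadon f x - Real.pi * ‖x‖⁻¹ * sphericalRadon g x‖
      = ‖(Real.pi * sphericalRadon f x - Real.pi * sphericalRadon g x) * ‖x‖⁻¹‖ := by ring_nf
    _ ≤ δ * ‖x‖⁻¹ := by
      rw [norm_mul, norm_inv, norm_norm]
      gcongr
      exact hclose

theorem integral_angular_mul_neg {g b : EuclideanSpace ℝ (Fin (k + 1)) → ℝ}
    {x₀ : EuclideanSpace ℝ (Fin (k + 1))} {r : ℝ} (hr : 0 < r)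
    (hg : ∀ x ∈ ball x₀ r, g x < 0 ∧ x ≠ 0) (hb : ∀ x, 0 ≤ b x)
    (hsupp : Function.support b = ball x₀ r)
    (hint : Integrable fun x ↦ g x * (‖x‖ ^ k)⁻¹ * b x) :
    ∫ x, g x * (‖x‖ ^ k)⁻¹ * b x < 0 := by
  have hzero (x) (hx : x ∉ ball x₀ r) : b x = 0 := by rwa [← hsupp, Function.notMem_support] at hx
  have hnonneg (x) : 0 ≤ -(g x * (‖x‖ ^ k)⁻¹ * b x) := by
    by_cases hx : x ∈ ball x₀ r
    · rw [neg_nonneg, mul_assoc]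
      exact mul_nonpos_of_nonpos_of_nonneg (hg x hx).1.le (mul_nonneg (by positivity) (hb x))
    · rw [hzero x hx, mul_zero, neg_zero]
  rw [← neg_pos, ← integral_neg, integral_pos_iff_support_of_nonneg hnonneg hint.neg]
  refine (measure_ball_pos volume x₀ hr).trans_le (measure_mono fun x hx ↦ ?_)
  obtain ⟨hgx, hx0⟩ := hg x hx
  have hbx : b x ≠ 0 := by rwa [← hsupp] at hx
  have := norm_ne_zero_iff.2 hx0
  exact neg_ne_zero.2 (mul_ne_zero (mul_ne_zero hgx.ne (by positivity)) hbx)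

theorem not_isIntersectionBody_of_neg (hk : 1 ≤ k) {g : EuclideanSpace ℝ (Fin (k + 1)) → ℝ}
    (hg : IsEvenAngular g) {K : Set (EuclideanSpace ℝ (Fin (k + 1)))}
    (hK : ∀ ξ, ‖ξ‖ = 1 → radialFunction K ξ = Real.pi * sphericalRadon g ξ)
    {x₀ : EuclideanSpace ℝ (Fin (k + 1))} (hx₀ : x₀ ≠ 0) (hneg : g x₀ < 0) :
    ¬ IsIntersectionBody K := by
  intro hI
  obtain ⟨r, hr, hball⟩ := Metric.eventually_nhds_iff_ball.1
    (((hg.continuousAt hx₀).eventually_lt_const hneg).and (isOpen_compl_singleton.mem_nhds hx₀))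
  obtain ⟨φ, b, hφ, hb, hsupp⟩ := exists_testFourier_eq_bump x₀ hr
  have hreal (f : EuclideanSpace ℝ (Fin (k + 1)) → ℝ) (x) :
      ((f x * (‖x‖ ^ k)⁻¹ : ℝ) : ℂ) * testFourier φ x = (f x * (‖x‖ ^ k)⁻¹ * b x : ℝ) := by
    rw [hφ, Complex.ofReal_mul _ (b x)]
  have hint : Integrable fun x ↦ g x * (‖x‖ ^ k)⁻¹ * b x := by
    have hI := integrable_angular_mul_testFourier hg φ
    simp_rw [hreal] at hI
    exact hI.re
  set c := ∫ x, g x * (‖x‖ ^ k)⁻¹ * b x with hc_def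
  have hc : c < 0 := integral_angular_mul_neg hr hball hb hsupp hint
  set D := ∫ x, ‖x‖⁻¹ * ‖φ x‖
  have : 0 ≤ D := integral_nonneg fun x ↦ by positivity
  obtain ⟨M, L, hML, hclose⟩ :=
    hI.mem_closure (-c / (D + 1)) (div_pos (neg_pos.2 hc) (by positivity))
  obtain ⟨f, hf, hf0, hM⟩ := hML.exists_radialFunction_eq_sphericalRadon hk (by simp)
  have hdiff := norm_integral_angular_mul_testFourier_sub_le hk hg hf
    (fun ξ hξ ↦ by simpa only [hK ξ hξ, hM ξ hξ] using hclose ξ hξ) φ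
  simp_rw [hreal, integral_complex_ofReal] at hdiff
  rw [← Complex.ofReal_sub, Complex.norm_real, Real.norm_eq_abs, ← hc_def] at hdiff
  have hf_int : 0 ≤ ∫ x, f x * (‖x‖ ^ k)⁻¹ * b x :=
    integral_nonneg fun x ↦ mul_nonneg (mul_nonneg (hf0 x) (by positivity)) (hb x)
  have hδ : -c / (D + 1) * D < -c := by
    rw [div_mul_eq_mul_div, div_lt_iff₀ (by positivity)]
    linarith
  linarith [neg_abs_le (c - ∫ x, f x * (‖x‖ ^ k)⁻¹ * b x)]

end Positivity

section Profile

open Set Metric Module Filter Polynomial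
open scoped Topology

/-- The function `y ↦ p (1 / y) * exp (-1 / y)` for a polynomial `p`, extended by zero to `y ≤ 0`.
This class of smooth functions is closed under differentiation. -/
def polyExpNegInv (p : ℝ[X]) (y : ℝ) : ℝ := p.eval y⁻¹ * expNegInvGlue y

theorem continuous_polyExpNegInv (p : ℝ[X]) : Continuous (polyExpNegInv p) :=
  expNegInvGlue.continuous_polynomial_eval_inv_mul p

theorem hasDerivAt_polyExpNegInv (p : ℝ[X]) (y : ℝ) :
    HasDerivAt (polyExpNegInv p) (polyExpNegInv (X ^ 2 * (p - derivative p)) y) y :=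
  expNegInvGlue.hasDerivAt_polynomial_eval_inv_mul p y

theorem polyExpNegInv_of_nonpos (p : ℝ[X]) {y : ℝ} (hy : y ≤ 0) : polyExpNegInv p y = 0 := by
  rw [polyExpNegInv, expNegInvGlue.zero_of_nonpos hy, mul_zero]

theorem exists_abs_polyExpNegInv_le (p : ℝ[X]) :
    ∃ A, 0 ≤ A ∧ ∀ y ≤ 1, |polyExpNegInv p y| ≤ A := by
  obtain ⟨A, hA⟩ := (isCompact_Icc (a := (0 : ℝ)) (b := 1)).exists_bound_of_continuousOn
    (continuous_polyExpNegInv p).continuousOn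
  have hA0 : 0 ≤ A := (norm_nonneg _).trans (hA 0 (by simp))
  refine ⟨A, hA0, fun y hy ↦ ?_⟩
  rcases le_total y 0 with h | h
  · rwa [polyExpNegInv_of_nonpos p h, abs_zero]
  · exact hA y ⟨h, hy⟩

/-- The affine image of `√v = |cos α|` which runs from `0` on the boundary of the double cap
`1 - |cos α| < δ` to `1` at its poles. -/
def capCoord (δ v : ℝ) : ℝ := 1 - (1 - √v) / δ

/-- The bump `f_ε` as a function of `v = cos² α`, where `α` is the angle to `x₀` and
`δ = ε² / 2`; see `bump_eq_bumpProfile`. -/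
def bumpProfile (δ v : ℝ) : ℝ := 2 * Real.exp 1 * polyExpNegInv 1 (capCoord δ v)

/-- The derivative of `bumpProfile δ`. -/
def bumpProfileDeriv (δ v : ℝ) : ℝ :=
  2 * Real.exp 1 * (polyExpNegInv (X ^ 2) (capCoord δ v) * (2 * δ * √v)⁻¹)

/-- The second derivative of `bumpProfile δ`. -/
def bumpProfileDeriv₂ (δ v : ℝ) : ℝ :=
  2 * Real.exp 1 *
    (polyExpNegInv (X ^ 2 * (X ^ 2 - C 2 * X)) (capCoord δ v) * ((2 * δ * √v)⁻¹) ^ 2 -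
      polyExpNegInv (X ^ 2) (capCoord δ v) * (4 * δ * √v ^ 3)⁻¹)

theorem continuous_bumpProfile (δ : ℝ) : Continuous (bumpProfile δ) := by
  have := continuous_polyExpNegInv 1
  unfold bumpProfile capCoord
  fun_prop

theorem measurable_bumpProfileDeriv (δ : ℝ) : Measurable (bumpProfileDeriv δ) := by
  have := (continuous_polyExpNegInv (X ^ 2)).measurable
  unfold bumpProfileDeriv capCoord
  fun_prop

theorem measurable_bumpProfileDeriv₂ (δ : ℝ) : Measurable (bumpProfileDeriv₂ δ) := by
  have := (continuous_polyExpNegInv (X ^ 2)).measurable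
  have := (continuous_polyExpNegInv (X ^ 2 * (X ^ 2 - C 2 * X))).measurable
  unfold bumpProfileDeriv₂ capCoord
  fun_prop

theorem bumpProfile_nonneg (δ v : ℝ) : 0 ≤ bumpProfile δ v := by
  have := expNegInvGlue.nonneg (capCoord δ v)
  simp only [bumpProfile, polyExpNegInv, eval_one, one_mul]
  positivity

variable {δ : ℝ}

theorem hasDerivAt_capCoord {v : ℝ} (hv : 0 < v) :
    HasDerivAt (capCoord δ) ((2 * δ * √v)⁻¹) v := by
  refine (((Real.hasDerivAt_sqrt hv.ne').const_sub 1).div_const δ).const_sub 1 |>.congr_deriv ?_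
  ring

section Support

variable (hδ : 0 < δ) {v : ℝ} (hv : √v ≤ 1 - δ)
include hδ hv

theorem capCoord_nonpos : capCoord δ v ≤ 0 := by
  rw [capCoord, sub_nonpos, le_div_iff₀ hδ]
  linarith

theorem bumpProfile_eq_zero : bumpProfile δ v = 0 := by
  rw [bumpProfile, polyExpNegInv_of_nonpos _ (capCoord_nonpos hδ hv), mul_zero]

theorem bumpProfileDeriv_eq_zero : bumpProfileDeriv δ v = 0 := by
  rw [bumpProfileDeriv, polyExpNegInv_of_nonpos _ (capCoord_nonpos hδ hv), zero_mul, mul_zero]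

theorem bumpProfileDeriv₂_eq_zero : bumpProfileDeriv₂ δ v = 0 := by
  simp only [bumpProfileDeriv₂, polyExpNegInv_of_nonpos _ (capCoord_nonpos hδ hv), zero_mul,
    sub_zero, mul_zero]

end Support

theorem capCoord_le_one (hδ : 0 ≤ δ) {v : ℝ} (hv : v ≤ 1) : capCoord δ v ≤ 1 :=
  sub_le_self 1 (div_nonneg (sub_nonneg.2 (Real.sqrt_le_one.2 hv)) hδ)

theorem bumpProfile_le_two (hδ : 0 ≤ δ) {v : ℝ} (hv : v ≤ 1) : bumpProfile δ v ≤ 2 := by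
  have hle := expNegInvGlue.monotone (capCoord_le_one hδ hv)
  have hone : expNegInvGlue 1 = Real.exp (-1) := by simp [expNegInvGlue]
  rw [hone] at hle
  simp only [bumpProfile, polyExpNegInv, eval_one, one_mul]
  calc 2 * Real.exp 1 * expNegInvGlue (capCoord δ v)
      ≤ 2 * Real.exp 1 * Real.exp (-1) := by gcongr
    _ = 2 := by rw [mul_assoc, ← Real.exp_add, add_neg_cancel, Real.exp_zero, mul_one]

theorem eventually_sqrt_le (hδ1 : δ < 1) {v : ℝ} (hv : v ≤ 0) : ∀ᶠ u in 𝓝 v, √u ≤ 1 - δ := by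
  have hlim : Tendsto (fun u ↦ √u) (𝓝 v) (𝓝 (√v)) := Real.continuous_sqrt.tendsto v
  rw [Real.sqrt_eq_zero_of_nonpos hv] at hlim
  exact hlim.eventually_le_const (sub_pos.2 hδ1)

theorem hasDerivAt_bumpProfile (hδ : 0 < δ) (hδ1 : δ < 1) (v : ℝ) :
    HasDerivAt (bumpProfile δ) (bumpProfileDeriv δ v) v := by
  rcases le_or_gt v 0 with hv | hv
  · have hsupp := eventually_sqrt_le hδ1 hv
    rw [bumpProfileDeriv_eq_zero hδ hsupp.self_of_nhds]
    exact (hasDerivAt_const v (0 : ℝ)).congr_of_eventuallyEq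
      (hsupp.mono fun u hu ↦ bumpProfile_eq_zero hδ hu)
  · have := hasDerivAt_polyExpNegInv 1 (capCoord δ v)
    rw [derivative_one, sub_zero, mul_one] at this
    exact (this.comp v (hasDerivAt_capCoord hv)).const_mul _

theorem hasDerivAt_bumpProfileDeriv (hδ : 0 < δ) (hδ1 : δ < 1) (v : ℝ) :
    HasDerivAt (bumpProfileDeriv δ) (bumpProfileDeriv₂ δ v) v := by
  rcases le_or_gt v 0 with hv | hv
  · have hsupp := eventually_sqrt_le hδ1 hv
    rw [bumpProfileDeriv₂_eq_zero hδ hsupp.self_of_nhds]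
    exact (hasDerivAt_const v (0 : ℝ)).congr_of_eventuallyEq
      (hsupp.mono fun u hu ↦ bumpProfileDeriv_eq_zero hδ hu)
  · have hs : 2 * δ * √v ≠ 0 := by positivity
    have hinv : HasDerivAt (fun v ↦ (2 * δ * √v)⁻¹) (-(4 * δ * √v ^ 3)⁻¹) v := by
      refine ((Real.hasDerivAt_sqrt hv.ne').const_mul (2 * δ)).fun_inv hs |>.congr_deriv ?_
      field_simp
      norm_num
    have hglue := hasDerivAt_polyExpNegInv (X ^ 2) (capCoord δ v)
    rw [derivative_X_sq] at hglue
    refine ((hglue.comp v (hasDerivAt_capCoord hv)).mul hinv).const_mul _ |>.congr_deriv ?_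
    rw [bumpProfileDeriv₂, Function.comp_apply]
    ring

theorem exists_bumpProfile_bound : ∃ A, 0 ≤ A ∧ ∀ δ, 0 < δ → δ ≤ 1 / 2 → ∀ v ≤ 1,
    |bumpProfileDeriv δ v| ≤ A / δ ∧ |bumpProfileDeriv₂ δ v| ≤ A / δ ^ 2 := by
  obtain ⟨A₁, hA₁, hbound₁⟩ := exists_abs_polyExpNegInv_le (X ^ 2)
  obtain ⟨A₂, hA₂, hbound₂⟩ := exists_abs_polyExpNegInv_le (X ^ 2 * (X ^ 2 - C 2 * X))
  refine ⟨2 * Real.exp 1 * (A₂ + 2 * A₁), by positivity, fun δ hδ hδ2 v hv ↦ ?_⟩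
  rcases le_or_gt (√v) (1 - δ) with hs | hs
  · rw [bumpProfileDeriv_eq_zero hδ hs, bumpProfileDeriv₂_eq_zero hδ hs, abs_zero]
    constructor <;> positivity
  have hs2 : 1 / 2 ≤ √v := by linarith
  have hy := capCoord_le_one hδ.le hv
  have hexp : 0 < 2 * Real.exp 1 := by positivity
  have hinv : |(2 * δ * √v)⁻¹| ≤ δ⁻¹ := by
    rw [abs_of_nonneg (by positivity)]
    apply inv_anti₀ hδ
    nlinarith
  have hinv₃ : |(4 * δ * √v ^ 3)⁻¹| ≤ 2 / δ ^ 2 := by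
    have : (1 / 2 : ℝ) ^ 3 ≤ √v ^ 3 := by gcongr
    rw [abs_of_nonneg (by positivity), ← one_div, div_le_div_iff₀ (by positivity) (by positivity)]
    nlinarith [mul_pos hδ hδ]
  constructor
  · rw [bumpProfileDeriv, abs_mul, abs_of_pos hexp, mul_div_assoc, div_eq_mul_inv, abs_mul]
    gcongr
    linarith [hbound₁ _ hy]
  · rw [bumpProfileDeriv₂, abs_mul, abs_of_pos hexp, mul_div_assoc]
    gcongr
    refine (abs_sub _ _).trans ?_
    rw [abs_mul, abs_mul, abs_pow]
    calc _ ≤ A₂ * δ⁻¹ ^ 2 + A₁ * (2 / δ ^ 2) := by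
          gcongr
          exacts [hbound₂ _ hy, hbound₁ _ hy]
      _ = (A₂ + 2 * A₁) / δ ^ 2 := by ring

theorem bumpProfile_sq {ε : ℝ} (hε : 0 < ε) {a : ℝ} (ha : 0 ≤ a) :
    bumpProfile (ε ^ 2 / 2) (a ^ 2) =
      if 2 - 2 * a < ε ^ 2 then 2 * Real.exp (-((2 - 2 * a) / (ε ^ 2 - (2 - 2 * a)))) else 0 := by
  have hcoord : capCoord (ε ^ 2 / 2) (a ^ 2) = (ε ^ 2 - (2 - 2 * a)) / ε ^ 2 := by
    rw [capCoord, Real.sqrt_sq ha]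
    field_simp
  rw [bumpProfile, polyExpNegInv, eval_one, one_mul, hcoord]
  split_ifs with hin
  · have hgap : 0 < ε ^ 2 - (2 - 2 * a) := sub_pos.2 hin
    rw [expNegInvGlue, if_neg (by rw [not_le]; positivity), mul_assoc, ← Real.exp_add]
    congr 2
    generalize 2 - 2 * a = c at hgap
    field_simp
    ring
  · rw [expNegInvGlue.zero_of_nonpos, mul_zero]
    exact div_nonpos_of_nonpos_of_nonneg (by linarith) (by positivity)

theorem bump_eq_bumpProfile {E : Type*} [NormedAddCommGroup E] [InnerProductSpace ℝ E] {x₀ x : E}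
    (hx₀ : ‖x₀‖ = 1) (hx : ‖x‖ = 1) {ε : ℝ} (hε : 0 < ε) (hε1 : ε ≤ 1) :
    bump x₀ ε x = bumpProfile (ε ^ 2 / 2) (inner ℝ x x₀ ^ 2) := by
  have hsub : ‖x - x₀‖ ^ 2 = 2 - 2 * inner ℝ x x₀ := by rw [norm_sub_sq_real, hx, hx₀]; ring
  have hadd : ‖x + x₀‖ ^ 2 = 2 + 2 * inner ℝ x x₀ := by rw [norm_add_sq_real, hx, hx₀]; ring
  have hlt (y : E) : ‖y‖ < ε ↔ ‖y‖ ^ 2 < ε ^ 2 := (sq_lt_sq₀ (norm_nonneg y) hε.le).symm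
  have hε2 : ε ^ 2 ≤ 1 := pow_le_one₀ hε.le hε1
  rw [← sq_abs (inner ℝ x x₀), bumpProfile_sq hε (abs_nonneg _), bump]
  simp only [hlt, hsub, hadd]
  rcases le_total 0 (inner ℝ x x₀) with h0 | h0
  · rw [abs_of_nonneg h0, if_neg (show ¬ 2 + 2 * inner ℝ x x₀ < ε ^ 2 by linarith)]
  · rw [abs_of_nonpos h0, if_neg (show ¬ 2 - 2 * inner ℝ x x₀ < ε ^ 2 by linarith)]
    simp only [mul_neg, sub_neg_eq_add]

end Profile

section SectionProfile

open Set Metric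

/-- The bump `f_ε`, with `δ = ε² / 2`, at a point of a great subsphere, as a function of the
cosine `z` of the angle between the normal of the subsphere and `x₀`. Here `c` is the squared
cosine of the angle between the point and the projection of `x₀` to the subsphere. -/
def sectionProfile (δ c z : ℝ) : ℝ := bumpProfile δ ((1 - z ^ 2) * c)

/-- The derivative of `sectionProfile δ c`. -/
def sectionProfileDeriv (δ c z : ℝ) : ℝ := bumpProfileDeriv δ ((1 - z ^ 2) * c) * (-(2 * z) * c)

/-- The second derivative of `sectionProfile δ c`. -/
def sectionProfileDeriv₂ (δ c z : ℝ) : ℝ :=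
  bumpProfileDeriv₂ δ ((1 - z ^ 2) * c) * (-(2 * z) * c) ^ 2 +
    bumpProfileDeriv δ ((1 - z ^ 2) * c) * (-2 * c)

section Deriv

variable {δ : ℝ} (hδ : 0 < δ) (hδ1 : δ < 1) (c z : ℝ)
include hδ hδ1

theorem hasDerivAt_sectionProfile :
    HasDerivAt (sectionProfile δ c) (sectionProfileDeriv δ c z) z := by
  have harg : HasDerivAt (fun z : ℝ ↦ (1 - z ^ 2) * c) (-(2 * z) * c) z := by
    simpa using ((hasDerivAt_pow 2 z).const_sub 1).mul_const c
  exact (hasDerivAt_bumpProfile hδ hδ1 _).comp z harg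

theorem hasDerivAt_sectionProfileDeriv :
    HasDerivAt (sectionProfileDeriv δ c) (sectionProfileDeriv₂ δ c z) z := by
  have harg : HasDerivAt (fun z : ℝ ↦ (1 - z ^ 2) * c) (-(2 * z) * c) z := by
    simpa using ((hasDerivAt_pow 2 z).const_sub 1).mul_const c
  have hfactor : HasDerivAt (fun z : ℝ ↦ -(2 * z) * c) (-2 * c) z := by
    simpa using ((hasDerivAt_id z).const_mul (-2)).mul_const c
  refine ((hasDerivAt_bumpProfileDeriv hδ hδ1 _).comp z harg).mul hfactor |>.congr_deriv ?_
  rw [sectionProfileDeriv₂, Function.comp_apply, sq (-(2 * z) * c), mul_assoc]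

end Deriv

section Support

variable {δ c z : ℝ} (hδ : 0 < δ) (hv : √((1 - z ^ 2) * c) ≤ 1 - δ)
include hδ hv

theorem sectionProfile_eq_zero : sectionProfile δ c z = 0 := bumpProfile_eq_zero hδ hv

theorem sectionProfileDeriv_eq_zero : sectionProfileDeriv δ c z = 0 := by
  rw [sectionProfileDeriv, bumpProfileDeriv_eq_zero hδ hv, zero_mul]

theorem sectionProfileDeriv₂_eq_zero : sectionProfileDeriv₂ δ c z = 0 := by
  rw [sectionProfileDeriv₂, bumpProfileDeriv₂_eq_zero hδ hv, bumpProfileDeriv_eq_zero hδ hv,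
    zero_mul, zero_mul, add_zero]

end Support

theorem sqrt_one_sub_sq_mul_le {δ c : ℝ} (hδ1 : δ ≤ 1) (hc0 : 0 ≤ c) (hc : c ≤ (1 - δ) ^ 2)
    (z : ℝ) : √((1 - z ^ 2) * c) ≤ 1 - δ := by
  refine Real.sqrt_le_iff.2 ⟨sub_nonneg.2 hδ1, ?_⟩
  nlinarith [mul_nonneg (sq_nonneg z) hc0]

theorem sqrt_one_sub_sq_mul_le_of_lt_sq {δ c z : ℝ} (hδ : 0 ≤ δ) (hδ2 : δ ≤ 1 / 2)
    (hc : c ∈ Icc (0 : ℝ) 1) (hz : 2 * δ < z ^ 2) : √((1 - z ^ 2) * c) ≤ 1 - δ := by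
  refine Real.sqrt_le_iff.2 ⟨by linarith, ?_⟩
  calc (1 - z ^ 2) * c ≤ (1 - 2 * δ) * c := mul_le_mul_of_nonneg_right (by linarith) hc.1
    _ ≤ 1 - 2 * δ := mul_le_of_le_one_right (by linarith) hc.2
    _ ≤ (1 - δ) ^ 2 := by nlinarith

/-- Each derivative of the bump costs `δ⁻¹`, but on its support `z² ≤ 2 δ`, so the factors `z`
from the chain rule save one power of `δ` in the second derivative. -/
theorem exists_abs_sectionProfile_le : ∃ A, 0 ≤ A ∧ ∀ δ, 0 < δ → δ ≤ 1 / 2 →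
    ∀ c ∈ Icc (0 : ℝ) 1, ∀ z, |sectionProfile δ c z| ≤ A / δ ∧
      |sectionProfileDeriv δ c z| ≤ A / δ ∧ |sectionProfileDeriv₂ δ c z| ≤ A / δ := by
  obtain ⟨A, hA, hbound⟩ := exists_bumpProfile_bound
  refine ⟨2 + 10 * A, by positivity, fun δ hδ hδ2 c hc z ↦ ?_⟩
  rcases lt_or_ge (2 * δ) (z ^ 2) with hz | hz
  · have hv := sqrt_one_sub_sq_mul_le_of_lt_sq hδ.le hδ2 hc hz
    rw [sectionProfile_eq_zero hδ hv, sectionProfileDeriv_eq_zero hδ hv,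
      sectionProfileDeriv₂_eq_zero hδ hv, abs_zero]
    have : 0 ≤ (2 + 10 * A) / δ := by positivity
    exact ⟨this, this, this⟩
  obtain ⟨hc0, hc1⟩ := hc
  have harg : (1 - z ^ 2) * c ≤ 1 := by nlinarith [mul_nonneg (sq_nonneg z) hc0]
  obtain ⟨hbound₁, hbound₂⟩ := hbound δ hδ hδ2 _ harg
  have hfactor_sq : |(-(2 * z) * c) ^ 2| ≤ 8 * δ := by
    rw [abs_of_nonneg (sq_nonneg _)]
    calc (-(2 * z) * c) ^ 2 = 4 * z ^ 2 * c ^ 2 := by ring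
      _ ≤ 4 * (2 * δ) * 1 := by gcongr; exact pow_le_one₀ hc0 hc1
      _ = 8 * δ := by ring
  have hfactor : |-(2 * z) * c| ≤ 2 :=
    abs_le_of_sq_le_sq (by rw [← abs_of_nonneg (sq_nonneg (-(2 * z) * c))]; linarith) zero_le_two
  refine ⟨?_, ?_, ?_⟩
  · rw [sectionProfile, abs_of_nonneg (bumpProfile_nonneg _ _), le_div_iff₀ hδ]
    nlinarith [bumpProfile_le_two hδ.le harg]
  · rw [sectionProfileDeriv, abs_mul]
    calc _ ≤ A / δ * 2 := mul_le_mul hbound₁ hfactor (abs_nonneg _) (by positivity)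
      _ = 2 * A / δ := by ring
      _ ≤ (2 + 10 * A) / δ := by gcongr; linarith
  · have hfactor' : |-2 * c| ≤ 2 := by rw [abs_le]; constructor <;> linarith
    refine (abs_add_le _ _).trans ?_
    rw [abs_mul, abs_mul]
    calc _ ≤ A / δ ^ 2 * (8 * δ) + A / δ * 2 :=
          add_le_add (mul_le_mul hbound₂ hfactor_sq (abs_nonneg _) (by positivity))
            (mul_le_mul hbound₁ hfactor' (abs_nonneg _) (by positivity))
      _ = 10 * A / δ := by field_simp; norm_num
      _ ≤ (2 + 10 * A) / δ := by gcongr; linarith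

end SectionProfile

section Cap

open Set Metric Module
open scoped Pointwise

theorem hasDerivAt_integral_of_bounded_deriv {α : Type*} [MeasurableSpace α] {μ : Measure α}
    [IsFiniteMeasure μ] {F F' : ℝ → α → ℝ} {C : ℝ} (hF : ∀ z, Measurable (F z))
    (hF' : ∀ z, Measurable (F' z)) (hC : ∀ z a, |F z a| ≤ C) (hC' : ∀ z a, |F' z a| ≤ C)
    (hderiv : ∀ z a, HasDerivAt (F · a) (F' z a) z) (z : ℝ) :
    HasDerivAt (fun z ↦ ∫ a, F z a ∂μ) (∫ a, F' z a ∂μ) z :=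
  (hasDerivAt_integral_of_dominated_loc_of_deriv_le (bound := fun _ ↦ C) Filter.univ_mem
    (.of_forall fun y ↦ (hF y).aestronglyMeasurable)
    (.of_bound (hF z).aestronglyMeasurable C (.of_forall (hC z))) (hF' z).aestronglyMeasurable
    (.of_forall fun a y _ ↦ hC' y a) (integrable_const C)
    (.of_forall fun a y _ ↦ hderiv y a)).2

theorem IsUnitNormal.measure_cylinder {U W : Type*} [NormedAddCommGroup U]
    [InnerProductSpace ℝ U] [FiniteDimensional ℝ U] [MeasurableSpace U] [BorelSpace U]
    [NormedAddCommGroup W] [InnerProductSpace ℝ W] [FiniteDimensional ℝ W] [MeasurableSpace W]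
    [BorelSpace W] [Nontrivial U] {i : U →ₗᵢ[ℝ] W} {v : W} (h : IsUnitNormal i v) {ρ : ℝ}
    (hρ : 0 ≤ ρ) :
    lebesgue W {x | ‖x‖ ^ 2 - inner ℝ x v ^ 2 < ρ ^ 2 ∧ |inner ℝ x v| ≤ 1} =
      ENNReal.ofReal (ρ ^ finrank ℝ U) * lebesgue U (ball 0 1) * 2 := by
  obtain ⟨e, he, hmp⟩ := h.exists_homeomorph
  have hpre : e ⁻¹' {x | ‖x‖ ^ 2 - inner ℝ x v ^ 2 < ρ ^ 2 ∧ |inner ℝ x v| ≤ 1} =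
      ball (0 : U) ρ ×ˢ Icc (-1) 1 := by
    ext ⟨u, t⟩
    have hinner : inner ℝ (i u + t • v) v = t := by
      rw [inner_add_left, h.inner_eq_zero, real_inner_smul_left, real_inner_self_eq_norm_sq,
        h.norm_eq_one, one_pow, mul_one, zero_add]
    simp only [mem_preimage, mem_ofPred_eq, he, h.norm_add_smul_sq, hinner, add_sub_cancel_right,
      mem_prod, mem_ball_zero_iff, mem_Icc, abs_le, sq_lt_sq₀ (norm_nonneg u) hρ]
  have hmeas : MeasurableSet {x | ‖x‖ ^ 2 - inner ℝ x v ^ 2 < ρ ^ 2 ∧ |inner ℝ x v| ≤ 1} := by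
    exact (measurableSet_lt (f := fun x : W ↦ ‖x‖ ^ 2 - inner ℝ x v ^ 2) (by fun_prop)
      measurable_const).inter
      (measurableSet_le (f := fun x : W ↦ |inner ℝ x v|) (by fun_prop) measurable_const)
  rw [← hmp.measure_preimage hmeas.nullMeasurableSet, hpre, Measure.prod_prod, Real.volume_Icc,
    Measure.addHaar_ball _ _ hρ]
  norm_num

variable {F : Type*} [NormedAddCommGroup F] [InnerProductSpace ℝ F]

theorem inner_sq_mem_Icc {e : F} (he : ‖e‖ = 1) (θ : sphere (0 : F) 1) :
    inner ℝ (θ : F) e ^ 2 ∈ Icc (0 : ℝ) 1 := by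
  refine ⟨sq_nonneg _, ?_⟩
  rw [sq_le_one_iff_abs_le_one]
  refine (abs_real_inner_le_norm _ _).trans_eq ?_
  rw [norm_eq_of_mem_sphere, he, one_mul]

/-- The set of unit vectors at angle less than `arccos (1 - δ)` from one of `±e`. -/
def doubleCap (e : F) (δ : ℝ) : Set (sphere (0 : F) 1) := {θ | (1 - δ) ^ 2 < inner ℝ (θ : F) e ^ 2}

variable [FiniteDimensional ℝ F] [MeasurableSpace F] [BorelSpace F]

theorem measurableSet_doubleCap (e : F) (δ : ℝ) : MeasurableSet (doubleCap e δ) :=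
  measurableSet_lt measurable_const (by fun_prop)

theorem toSphere_real_doubleCap_le (hd : 2 ≤ finrank ℝ F) {e : F} (he : ‖e‖ = 1) {δ : ℝ}
    (hδ : 0 < δ) :
    (lebesgue F).toSphere.real (doubleCap e δ) ≤
      finrank ℝ F *
        (√(2 * δ) ^ finrank ℝ (ℝ ∙ e)ᗮ * (lebesgue (ℝ ∙ e)ᗮ).real (ball 0 1) * 2) := by
  have he0 : e ≠ 0 := norm_ne_zero_iff.1 (he.trans_ne one_ne_zero)
  have := nontrivial_orthogonal_span hd he0
  have h := isUnitNormal_orthogonal_span he0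
  rw [he, inv_one, one_smul] at h
  have hsub : Ioo (0 : ℝ) 1 • ((↑) '' doubleCap e δ : Set F) ⊆
      {x | ‖x‖ ^ 2 - inner ℝ x e ^ 2 < √(2 * δ) ^ 2 ∧ |inner ℝ x e| ≤ 1} := by
    rintro - ⟨r, ⟨hr0, hr1⟩, -, ⟨θ, hθ, rfl⟩, rfl⟩
    have hc : inner ℝ (θ : F) e ^ 2 ≤ 1 := (inner_sq_mem_Icc he θ).2
    have hθ : (1 - δ) ^ 2 < inner ℝ (θ : F) e ^ 2 := hθ
    have hr : r ^ 2 < 1 := pow_lt_one₀ hr0.le hr1 two_ne_zero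
    have : 0 < r ^ 2 := by positivity
    simp only [mem_ofPred_eq, norm_smul, norm_eq_of_mem_sphere, real_inner_smul_left, mul_one,
      Real.norm_eq_abs, sq_abs, Real.sq_sqrt (show 0 ≤ 2 * δ by positivity),
      ← sq_le_one_iff_abs_le_one, mul_pow]
    constructor <;> nlinarith
  rw [measureReal_def, Measure.toSphere_apply' _ (measurableSet_doubleCap e δ), ENNReal.toReal_mul,
    ENNReal.toReal_natCast]
  gcongr
  have hle := (measure_mono hsub).trans_eq (h.measure_cylinder (Real.sqrt_nonneg (2 * δ)))
  refine (ENNReal.toReal_mono ?_ hle).trans_eq ?_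
  · exact ENNReal.mul_ne_top
      (ENNReal.mul_ne_top ENNReal.ofReal_ne_top measure_ball_lt_top.ne) ENNReal.ofNat_ne_top
  · rw [ENNReal.toReal_mul, ENNReal.toReal_mul, ENNReal.toReal_ofReal (by positivity),
      ENNReal.toReal_ofNat, measureReal_def]

theorem exists_toSphere_real_doubleCap_le (hd : 4 ≤ finrank ℝ F) {e : F} (he : ‖e‖ = 1) :
    ∃ B, 0 ≤ B ∧ ∀ δ, 0 < δ → δ ≤ 1 / 2 →
      (lebesgue F).toSphere.real (doubleCap e δ) ≤ B * (δ * √δ) := by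
  have hrank := finrank_orthogonal_span (norm_ne_zero_iff.1 (he.trans_ne one_ne_zero))
  refine ⟨finrank ℝ F * (√2 ^ 3 * (lebesgue (ℝ ∙ e)ᗮ).real (ball 0 1) * 2), by positivity,
    fun δ hδ hδ2 ↦ (toSphere_real_doubleCap_le (by lia) he hδ).trans ?_⟩
  have hpow : √(2 * δ) ^ finrank ℝ (ℝ ∙ e)ᗮ ≤ √2 ^ 3 * (δ * √δ) := by
    calc √(2 * δ) ^ finrank ℝ (ℝ ∙ e)ᗮ ≤ √(2 * δ) ^ 3 :=
          pow_le_pow_of_le_one (Real.sqrt_nonneg _) (Real.sqrt_le_one.2 (by linarith)) (by lia)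
      _ = √2 ^ 3 * (δ * √δ) := by
          rw [Real.sqrt_mul zero_le_two, mul_pow, pow_succ √δ, Real.sq_sqrt hδ.le]
  calc _ ≤ finrank ℝ F *
        (√2 ^ 3 * (δ * √δ) * (lebesgue (ℝ ∙ e)ᗮ).real (ball 0 1) * 2) := by gcongr
    _ = _ := by ring

/-- The integral of `f_ε`, with `δ = ε² / 2`, over the unit sphere of a hyperplane whose unit
normal has scalar product `z` with `x₀`. The hyperplane is modelled on `F`, with `e` in the
direction of the projection of `x₀`. -/
def capIntegral (e : F) (δ z : ℝ) : ℝ :=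
  ∫ θ : sphere (0 : F) 1, sectionProfile δ (inner ℝ (θ : F) e ^ 2) z ∂(lebesgue F).toSphere

/-- The derivative of `capIntegral e δ`. -/
def capIntegralDeriv (e : F) (δ z : ℝ) : ℝ :=
  ∫ θ : sphere (0 : F) 1, sectionProfileDeriv δ (inner ℝ (θ : F) e ^ 2) z ∂(lebesgue F).toSphere

/-- The second derivative of `capIntegral e δ`. -/
def capIntegralDeriv₂ (e : F) (δ z : ℝ) : ℝ :=
  ∫ θ : sphere (0 : F) 1, sectionProfileDeriv₂ δ (inner ℝ (θ : F) e ^ 2) z ∂(lebesgue F).toSphere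

variable {e : F} {δ : ℝ}

theorem hasDerivAt_capIntegral (he : ‖e‖ = 1) (hδ : 0 < δ) (hδ2 : δ ≤ 1 / 2) (z : ℝ) :
    HasDerivAt (capIntegral e δ) (capIntegralDeriv e δ z) z := by
  obtain ⟨A, -, hA⟩ := exists_abs_sectionProfile_le
  have := (continuous_bumpProfile δ).measurable
  have := measurable_bumpProfileDeriv δ
  exact hasDerivAt_integral_of_bounded_deriv
    (fun z ↦ by unfold sectionProfile; fun_prop)
    (fun z ↦ by unfold sectionProfileDeriv; fun_prop)
    (fun z θ ↦ (hA δ hδ hδ2 _ (inner_sq_mem_Icc he θ) z).1)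
    (fun z θ ↦ (hA δ hδ hδ2 _ (inner_sq_mem_Icc he θ) z).2.1)
    (fun z θ ↦ hasDerivAt_sectionProfile hδ (by linarith) _ z) z

theorem hasDerivAt_capIntegralDeriv (he : ‖e‖ = 1) (hδ : 0 < δ) (hδ2 : δ ≤ 1 / 2) (z : ℝ) :
    HasDerivAt (capIntegralDeriv e δ) (capIntegralDeriv₂ e δ z) z := by
  obtain ⟨A, -, hA⟩ := exists_abs_sectionProfile_le
  have := measurable_bumpProfileDeriv δ
  have := measurable_bumpProfileDeriv₂ δ
  exact hasDerivAt_integral_of_bounded_deriv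
    (fun z ↦ by unfold sectionProfileDeriv; fun_prop)
    (fun z ↦ by unfold sectionProfileDeriv₂; fun_prop)
    (fun z θ ↦ (hA δ hδ hδ2 _ (inner_sq_mem_Icc he θ) z).2.1)
    (fun z θ ↦ (hA δ hδ hδ2 _ (inner_sq_mem_Icc he θ) z).2.2)
    (fun z θ ↦ hasDerivAt_sectionProfileDeriv hδ (by linarith) _ z) z

theorem abs_integral_le_doubleCap {f : sphere (0 : F) 1 → ℝ} {C : ℝ}
    (hzero : ∀ θ ∉ doubleCap e δ, f θ = 0) (hC : ∀ θ, |f θ| ≤ C) :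
    |∫ θ, f θ ∂(lebesgue F).toSphere| ≤ C * (lebesgue F).toSphere.real (doubleCap e δ) := by
  rw [← setIntegral_eq_integral_of_forall_compl_eq_zero hzero]
  exact norm_setIntegral_le_of_norm_le_const (f := f) (measure_lt_top _ _) fun θ _ ↦ hC θ

/-- The caps have measure at most of order `δ ^ (3 / 2)`, which
beats the factor `δ⁻¹` lost by the second derivative. -/
theorem exists_abs_capIntegral_le_mul_sqrt (hd : 4 ≤ finrank ℝ F) (he : ‖e‖ = 1) :
    ∃ D, 0 ≤ D ∧ ∀ δ, 0 < δ → δ ≤ 1 / 2 → ∀ z, |capIntegral e δ z| ≤ D * √δ ∧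
      |capIntegralDeriv e δ z| ≤ D * √δ ∧ |capIntegralDeriv₂ e δ z| ≤ D * √δ := by
  obtain ⟨A, hA, hprofile⟩ := exists_abs_sectionProfile_le
  obtain ⟨B, hB, hcap⟩ := exists_toSphere_real_doubleCap_le hd he
  refine ⟨A * B, by positivity, fun δ hδ hδ2 z ↦ ?_⟩
  have hzero (θ) (hθ : θ ∉ doubleCap e δ) : √((1 - z ^ 2) * inner ℝ (θ : F) e ^ 2) ≤ 1 - δ :=
    sqrt_one_sub_sq_mul_le (by linarith) (sq_nonneg _) (not_lt.1 hθ) z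
  have hbound (θ : sphere (0 : F) 1) := hprofile δ hδ hδ2 _ (inner_sq_mem_Icc he θ) z
  have hmeasure : A / δ * (lebesgue F).toSphere.real (doubleCap e δ) ≤ A * B * √δ := by
    calc _ ≤ A / δ * (B * (δ * √δ)) := by gcongr; exact hcap δ hδ hδ2
      _ = A * B * √δ := by field_simp
  exact ⟨(abs_integral_le_doubleCap (fun θ hθ ↦ sectionProfile_eq_zero hδ (hzero θ hθ))
      fun θ ↦ (hbound θ).1).trans hmeasure,
    (abs_integral_le_doubleCap (fun θ hθ ↦ sectionProfileDeriv_eq_zero hδ (hzero θ hθ))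
      fun θ ↦ (hbound θ).2.1).trans hmeasure,
    (abs_integral_le_doubleCap (fun θ hθ ↦ sectionProfileDeriv₂_eq_zero hδ (hzero θ hθ))
      fun θ ↦ (hbound θ).2.2).trans hmeasure⟩

theorem exists_abs_capIntegral_le (hd : 4 ≤ finrank ℝ F) (he : ‖e‖ = 1) {η : ℝ} (hη : 0 < η) :
    ∃ δ₀, 0 < δ₀ ∧ δ₀ ≤ 1 / 2 ∧ ∀ δ, 0 < δ → δ < δ₀ → ∀ z, |capIntegral e δ z| ≤ η ∧
      |capIntegralDeriv e δ z| ≤ η ∧ |capIntegralDeriv₂ e δ z| ≤ η := by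
  obtain ⟨D, hD, hbound⟩ := exists_abs_capIntegral_le_mul_sqrt hd he
  refine ⟨min (1 / 2) ((η / (D + 1)) ^ 2), by positivity, min_le_left _ _, fun δ hδ hδ₀ z ↦ ?_⟩
  have hδ2 : δ ≤ 1 / 2 := hδ₀.le.trans (min_le_left _ _)
  have hsqrt : √δ ≤ η / (D + 1) :=
    Real.sqrt_le_iff.2 ⟨by positivity, hδ₀.le.trans (min_le_right _ _)⟩
  have hη' : D * √δ ≤ η := by
    calc D * √δ ≤ (D + 1) * (η / (D + 1)) := by gcongr; linarith
      _ = η := by field_simp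
  exact (hbound δ hδ hδ2 z).imp (·.trans hη') (.imp (·.trans hη') (·.trans hη'))

end Cap

section Convexity

open Set

/-- The inner product of the direction of `p + t • u` with `x₀`, for orthonormal `p` and `u` with
`inner p x₀ = a` and `inner u x₀ = b`. -/
def cosLine (a b t : ℝ) : ℝ := (a + b * t) / √(1 + t ^ 2)

theorem hasDerivAt_sqrt_one_add_sq (t : ℝ) :
    HasDerivAt (fun t : ℝ ↦ √(1 + t ^ 2)) (cosLine 0 1 t) t := by
  refine ((hasDerivAt_pow 2 t).const_add 1).sqrt (by positivity) |>.congr_deriv ?_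
  simp only [cosLine, Nat.cast_ofNat, Nat.add_one_sub_one, pow_one, zero_add, one_mul]
  rw [mul_div_mul_left _ _ two_ne_zero]

theorem hasDerivAt_cosLine (a b t : ℝ) :
    HasDerivAt (cosLine a b) (cosLine b (-a) t / (1 + t ^ 2)) t := by
  have hsqrt : √(1 + t ^ 2) ≠ 0 := by positivity
  have hsq : √(1 + t ^ 2) ^ 2 = 1 + t ^ 2 := Real.sq_sqrt (by positivity)
  refine (((hasDerivAt_id t).const_mul b).const_add a).div (hasDerivAt_sqrt_one_add_sq t) hsqrt
    |>.congr_deriv ?_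
  simp only [cosLine, id, mul_one, zero_add, one_mul]
  rw [hsq]
  field_simp
  rw [hsq]
  ring

theorem cosLine_sq_add_sq (a b t : ℝ) :
    cosLine a b t ^ 2 + cosLine b (-a) t ^ 2 = a ^ 2 + b ^ 2 := by
  rw [cosLine, cosLine, div_pow, div_pow, Real.sq_sqrt (by positivity)]
  field_simp
  ring

variable {m m₁ m₂ : ℝ → ℝ}

theorem hasDerivAt_sqrt_mul_comp_cosLine (hm : ∀ z, HasDerivAt m (m₁ z) z) (a b t : ℝ) :
    HasDerivAt (fun t ↦ √(1 + t ^ 2) * m (cosLine a b t))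
      (cosLine 0 1 t * m (cosLine a b t) +
        m₁ (cosLine a b t) * (cosLine b (-a) t / √(1 + t ^ 2))) t := by
  refine (hasDerivAt_sqrt_one_add_sq t).mul ((hm _).comp t (hasDerivAt_cosLine a b t))
    |>.congr_deriv ?_
  have hsqrt : √(1 + t ^ 2) ≠ 0 := by positivity
  rw [Function.comp_apply, ← Real.sq_sqrt (show 0 ≤ 1 + t ^ 2 by positivity),
    Real.sqrt_sq (by positivity)]
  field_simp

theorem hasDerivAt_deriv_sqrt_mul_comp_cosLine (hm : ∀ z, HasDerivAt m (m₁ z) z)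
    (hm₁ : ∀ z, HasDerivAt m₁ (m₂ z) z) (a b t : ℝ) :
    HasDerivAt (fun t ↦ cosLine 0 1 t * m (cosLine a b t) +
        m₁ (cosLine a b t) * (cosLine b (-a) t / √(1 + t ^ 2)))
      ((m (cosLine a b t) + m₂ (cosLine a b t) * cosLine b (-a) t ^ 2 -
        m₁ (cosLine a b t) * cosLine a b t) / √(1 + t ^ 2) ^ 3) t := by
  have hsqrt : √(1 + t ^ 2) ≠ 0 := by positivity
  have hz := hasDerivAt_cosLine a b t
  have hw := (hasDerivAt_cosLine b (-a) t).fun_div (hasDerivAt_sqrt_one_add_sq t) hsqrt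
  refine ((hasDerivAt_cosLine 0 1 t).mul ((hm _).comp t hz)).add (((hm₁ _).comp t hz).mul hw)
    |>.congr_deriv ?_
  have hneg : cosLine (-a) (-b) t = -cosLine a b t := by rw [cosLine, cosLine]; ring
  have hunit : cosLine 1 (-0) t = 1 / √(1 + t ^ 2) := by rw [cosLine]; ring
  have hsq : 1 + t ^ 2 = √(1 + t ^ 2) ^ 2 := (Real.sq_sqrt (by positivity)).symm
  rw [hneg, hunit, Function.comp_apply, Function.comp_apply]
  generalize √(1 + t ^ 2) = R at *
  rw [hsq]
  field_simp
  ring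

theorem convexOn_sqrt_mul_comp_cosLine (hm : ∀ z, HasDerivAt m (m₁ z) z)
    (hm₁ : ∀ z, HasDerivAt m₁ (m₂ z) z) (hle : ∀ z, |m₁ z| + |m₂ z| ≤ m z) {a b : ℝ}
    (hab : a ^ 2 + b ^ 2 ≤ 1) :
    ConvexOn ℝ univ fun t ↦ √(1 + t ^ 2) * m (cosLine a b t) := by
  have hderiv := funext fun t ↦ (hasDerivAt_sqrt_mul_comp_cosLine hm a b t).deriv
  have hderiv₂ := hasDerivAt_deriv_sqrt_mul_comp_cosLine hm hm₁ a b
  refine convexOn_univ_of_deriv2_nonneg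
    (fun t ↦ (hasDerivAt_sqrt_mul_comp_cosLine hm a b t).differentiableAt) ?_ fun t ↦ ?_
  · rw [hderiv]
    exact fun t ↦ (hderiv₂ t).differentiableAt
  rw [Function.iterate_succ, Function.iterate_one, Function.comp_apply, hderiv, (hderiv₂ t).deriv]
  refine div_nonneg ?_ (by positivity)
  have hsum := (cosLine_sq_add_sq a b t).trans_le hab
  generalize cosLine a b t = z at *
  generalize cosLine b (-a) t = w at *
  have hm₁z : |m₁ z * z| ≤ |m₁ z| := by
    rw [abs_mul]
    refine mul_le_of_le_one_right (abs_nonneg _) ?_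
    rw [← sq_le_one_iff_abs_le_one]
    linarith [sq_nonneg w]
  have hm₂w : |m₂ z * w ^ 2| ≤ |m₂ z| := by
    rw [abs_mul, abs_of_nonneg (sq_nonneg w)]
    exact mul_le_of_le_one_right (abs_nonneg _) (by linarith [sq_nonneg z])
  linarith [neg_abs_le (m₂ z * w ^ 2), le_abs_self (m₁ z * z), hle z]

variable {E : Type*} [NormedAddCommGroup E] [InnerProductSpace ℝ E]

theorem exists_orthogonal_line_through {x y : E} (hxy : x ≠ y) :
    ∃ (p u : E) (α β : ℝ), ‖u‖ = 1 ∧ inner ℝ p u = 0 ∧ x = p + α • u ∧ y = p + β • u := by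
  have hne : y - x ≠ 0 := sub_ne_zero.2 hxy.symm
  set u := ‖y - x‖⁻¹ • (y - x) with hu_def
  have hu : ‖u‖ = 1 := norm_smul_inv_norm hne
  refine ⟨x - inner ℝ x u • u, u, inner ℝ x u, inner ℝ x u + ‖y - x‖, hu, ?_,
    (sub_add_cancel _ _).symm, ?_⟩
  · rw [inner_sub_left, real_inner_smul_left, real_inner_self_eq_norm_sq, hu, one_pow, mul_one,
      sub_self]
  · rw [add_smul, hu_def, smul_inv_smul₀ (norm_ne_zero_iff.2 hne)]
    abel

theorem IsMinkowskiFunctional.convexOn_of_orthonormal_lines {N : E → ℝ}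
    (h : IsMinkowskiFunctional N)
    (hline : ∀ p u : E, ‖p‖ = 1 → ‖u‖ = 1 → inner ℝ p u = 0 →
      ConvexOn ℝ univ fun t : ℝ ↦ N (p + t • u)) :
    ConvexOn ℝ univ N := by
  refine ⟨convex_univ, fun x _ y _ a b ha hb hab ↦ ?_⟩
  rcases eq_or_ne x y with rfl | hxy
  · rw [Convex.combo_self hab, Convex.combo_self hab]
  obtain ⟨p, u, α, β, hu, hpu, hx, hy⟩ := exists_orthogonal_line_through hxy
  have hcomb : a • (p + α • u) + b • (p + β • u) = p + (a * α + b * β) • u := by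
    calc _ = (a + b) • p + (a * α + b * β) • u := by module
      _ = _ := by rw [hab, one_smul]
  rw [hx, hy, hcomb]
  rcases eq_or_ne p 0 with hp | hp
  · simp only [hp, zero_add, h.smul, smul_eq_mul]
    have habs : |a * α + b * β| ≤ a * |α| + b * |β| := by
      simpa only [abs_mul, abs_of_nonneg ha, abs_of_nonneg hb] using abs_add_le (a * α) (b * β)
    linarith [mul_le_mul_of_nonneg_right habs (h.nonneg u)]
  · have hd : 0 < ‖p‖ := norm_pos_iff.2 hp
    have hscale (t : ℝ) : N (p + t • u) = ‖p‖ * N (‖p‖⁻¹ • p + (t / ‖p‖) • u) := by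
      rw [← abs_of_pos hd, ← h.smul, abs_of_pos hd, smul_add, smul_inv_smul₀ hd.ne',
        smul_smul ‖p‖ (t / ‖p‖) u, mul_div_cancel₀ _ hd.ne']
    have hconv := (hline (‖p‖⁻¹ • p) u (norm_smul_inv_norm hp) hu
      (by rw [real_inner_smul_left, hpu, mul_zero])).2 (mem_univ (α / ‖p‖)) (mem_univ (β / ‖p‖))
      ha hb hab
    simp only [smul_eq_mul] at hconv ⊢
    rw [hscale, hscale α, hscale β, add_div, mul_div_assoc, mul_div_assoc]
    linarith [mul_le_mul_of_nonneg_left hconv hd.le]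

/-- The homogeneous function of degree one and of revolution about the axis `x₀` whose value at a
unit vector at angle `α` from `x₀` is `m (cos α)`. -/
def revolutionGauge (m : ℝ → ℝ) (x₀ x : E) : ℝ := ‖x‖ * m (inner ℝ (‖x‖⁻¹ • x) x₀)

theorem isMinkowskiFunctional_revolutionGauge [FiniteDimensional ℝ E] (hm : Continuous m)
    (heven : m.Even) (hpos : ∀ z, 0 < m z) (x₀ : E) :
    IsMinkowskiFunctional (revolutionGauge m x₀) :=
  (isEvenAngular_comp_inner hm heven x₀).isMinkowskiFunctional fun _ _ ↦ hpos _

theorem revolutionGauge_add_smul {p u : E} (hp : ‖p‖ = 1) (hu : ‖u‖ = 1) (hpu : inner ℝ p u = 0)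
    (x₀ : E) (t : ℝ) :
    revolutionGauge m x₀ (p + t • u) =
      √(1 + t ^ 2) * m (cosLine (inner ℝ p x₀) (inner ℝ u x₀) t) := by
  have hnorm : ‖p + t • u‖ = √(1 + t ^ 2) := by
    rw [← Real.sqrt_sq (norm_nonneg (p + t • u)), norm_add_sq_real, inner_smul_right, hpu,
      norm_smul, hu, hp, Real.norm_eq_abs, mul_one, sq_abs]
    congr 1
    ring
  rw [revolutionGauge, hnorm, real_inner_smul_left, inner_add_left, real_inner_smul_left, cosLine]
  congr 2
  ring

theorem inner_sq_add_inner_sq_le_one {x₀ p u : E} (hx₀ : ‖x₀‖ = 1) (hp : ‖p‖ = 1) (hu : ‖u‖ = 1)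
    (hpu : inner ℝ p u = 0) : inner ℝ p x₀ ^ 2 + inner ℝ u x₀ ^ 2 ≤ 1 := by
  have hon : Orthonormal ℝ ![p, u] := by simp [orthonormal_vecCons_iff, hp, hu, hpu]
  have := hon.sum_inner_products_le (x := x₀) (s := Finset.univ)
  simpa [Fin.sum_univ_two, hx₀] using this

theorem convexOn_revolutionGauge (hm : ∀ z, HasDerivAt m (m₁ z) z)
    (hm₁ : ∀ z, HasDerivAt m₁ (m₂ z) z) (hle : ∀ z, |m₁ z| + |m₂ z| ≤ m z) {x₀ : E}
    (hx₀ : ‖x₀‖ = 1) (h : IsMinkowskiFunctional (revolutionGauge m x₀)) :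
    ConvexOn ℝ univ (revolutionGauge m x₀) := by
  refine h.convexOn_of_orthonormal_lines fun p u hp hu hpu ↦ ?_
  simp_rw [revolutionGauge_add_smul hp hu hpu]
  exact convexOn_sqrt_mul_comp_cosLine hm hm₁ hle (inner_sq_add_inner_sq_le_one hx₀ hp hu hpu)

theorem abs_div_sq_add_abs_le_inv {g g₁ g₂ : ℝ} (hg : 0 < g) (hg₁ : |g₁| ≤ g / 4)
    (hg₂ : |g₂| ≤ g / 4) : |-g₁ / g ^ 2| + |2 * g₁ ^ 2 / g ^ 3 - g₂ / g ^ 2| ≤ g⁻¹ := by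
  have hfst : |-g₁ / g ^ 2| ≤ g / 4 / g ^ 2 := by
    rw [abs_div, abs_neg, abs_of_pos (pow_pos hg 2)]
    gcongr
  have hsnd : |2 * g₁ ^ 2 / g ^ 3 - g₂ / g ^ 2| ≤ 2 * (g / 4) ^ 2 / g ^ 3 + g / 4 / g ^ 2 := by
    refine (abs_sub _ _).trans ?_
    rw [abs_div, abs_div, abs_of_pos (pow_pos hg 2), abs_of_pos (pow_pos hg 3), abs_mul, abs_two,
      abs_pow]
    gcongr
  calc _ ≤ g / 4 / g ^ 2 + (2 * (g / 4) ^ 2 / g ^ 3 + g / 4 / g ^ 2) := add_le_add hfst hsnd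
    _ = 5 / 8 * g⁻¹ := by field_simp; norm_num
    _ ≤ g⁻¹ := mul_le_of_le_one_left (inv_pos.2 hg).le (by norm_num)

theorem convexOn_revolutionGauge_inv {g g₁ g₂ : ℝ → ℝ} (hg : ∀ z, HasDerivAt g (g₁ z) z)
    (hg₁ : ∀ z, HasDerivAt g₁ (g₂ z) z) (hpos : ∀ z, 0 < g z) (hle₁ : ∀ z, |g₁ z| ≤ g z / 4)
    (hle₂ : ∀ z, |g₂ z| ≤ g z / 4) {x₀ : E} (hx₀ : ‖x₀‖ = 1)
    (h : IsMinkowskiFunctional (revolutionGauge (fun z ↦ (g z)⁻¹) x₀)) :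
    ConvexOn ℝ univ (revolutionGauge (fun z ↦ (g z)⁻¹) x₀) := by
  refine convexOn_revolutionGauge (m₁ := fun z ↦ -g₁ z / g z ^ 2)
    (m₂ := fun z ↦ 2 * g₁ z ^ 2 / g z ^ 3 - g₂ z / g z ^ 2)
    (fun z ↦ (hg z).fun_inv (hpos z).ne') (fun z ↦ ?_)
    (fun z ↦ abs_div_sq_add_abs_le_inv (hpos z) (hle₁ z) (hle₂ z)) hx₀ h
  have := (hpos z).ne'
  refine (hg₁ z).fun_neg.fun_div ((hg z).fun_pow 2) (pow_ne_zero 2 this) |>.congr_deriv ?_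
  field_simp
  ring

end Convexity

section Arc

open Set Metric Filter
open scoped Topology

/-- The set of `t` such that the line through `(1, t)` makes an angle of cosine more than `1 - δ`
with `(a, b)`. It parametrizes the arc of a great semicircle inside a double cap; `(a, b)` is the
orthogonal projection of the axis of the cap to the plane of the semicircle. -/
def arcSet (a b δ : ℝ) : Set ℝ := {t | (1 - δ) ^ 2 * (1 + t ^ 2) < (a + b * t) ^ 2}

theorem measurableSet_arcSet (a b δ : ℝ) : MeasurableSet (arcSet a b δ) :=
  measurableSet_lt (by fun_prop) (by fun_prop)

variable {a b δ t : ℝ}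

theorem mul_sub_sq_le_of_mem_arcSet (hab : a ^ 2 + b ^ 2 ≤ 1) (ht : t ∈ arcSet a b δ) :
    (a * t - b) ^ 2 ≤ 2 * δ * (1 + t ^ 2) := by
  have ht : (1 - δ) ^ 2 * (1 + t ^ 2) < (a + b * t) ^ 2 := ht
  have hle : (a ^ 2 + b ^ 2) * (1 + t ^ 2) ≤ 1 * (1 + t ^ 2) := by gcongr
  calc (a * t - b) ^ 2 = (a ^ 2 + b ^ 2) * (1 + t ^ 2) - (a + b * t) ^ 2 := by ring
    _ ≤ 2 * δ * (1 + t ^ 2) := by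
      linarith [mul_nonneg (sq_nonneg δ) (by positivity : 0 ≤ 1 + t ^ 2)]

theorem one_fourth_lt_of_mem_arcSet (hδ : δ ≤ 1 / 2) (ht : t ∈ arcSet a b δ) :
    1 / 4 < a ^ 2 + b ^ 2 := by
  have ht : (1 - δ) ^ 2 * (1 + t ^ 2) < (a + b * t) ^ 2 := ht
  have hδ : (1 / 2) ^ 2 ≤ (1 - δ) ^ 2 := by gcongr; linarith
  have hlt : 1 / 4 * (1 + t ^ 2) < (a ^ 2 + b ^ 2) * (1 + t ^ 2) :=
    calc 1 / 4 * (1 + t ^ 2) ≤ (1 - δ) ^ 2 * (1 + t ^ 2) := by gcongr; linarith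
      _ < (a + b * t) ^ 2 := ht
      _ ≤ (a ^ 2 + b ^ 2) * (1 + t ^ 2) := by linarith [sq_nonneg (a * t - b)]
  exact lt_of_mul_lt_mul_right hlt (by positivity)

theorem one_le_four_mul_abs {κ M : ℝ} (hM : 1 ≤ M) (htM : |t| ≤ M) (hκ : κ ≤ 1 / 8)
    (hab : 1 / 4 < a ^ 2 + b ^ 2) (hsub : |a * t - b| ≤ κ) : 1 ≤ 4 * M * |a| := by
  by_contra! hlt
  have hat : |a * t| ≤ 1 / 4 := by
    rw [abs_mul]
    calc |a| * |t| ≤ |a| * M := by gcongr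
      _ ≤ 1 / 4 := by linarith
  have ha : |a| ≤ 1 / 4 := by nlinarith [abs_nonneg a]
  have hb : |b| ≤ 3 / 8 := by linarith [abs_sub_abs_le_abs_sub b (a * t), abs_sub_comm b (a * t)]
  have ha2 : a ^ 2 ≤ (1 / 4) ^ 2 := sq_le_sq.2 (ha.trans (le_abs_self _))
  have hb2 : b ^ 2 ≤ (3 / 8) ^ 2 := sq_le_sq.2 (hb.trans (le_abs_self _))
  linarith

theorem arcSet_inter_Icc_subset {κ M : ℝ} (hab : a ^ 2 + b ^ 2 ≤ 1) (hM : 1 ≤ M) (hδ : 0 ≤ δ)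
    (hδ2 : δ ≤ 1 / 2) (hκ0 : 0 ≤ κ) (hκ : κ ≤ 1 / 8) (hκδ : 2 * δ * (1 + M ^ 2) ≤ κ ^ 2) :
    arcSet a b δ ∩ Icc (-M) M ⊆ closedBall (b / a) (4 * M * κ) := by
  rintro t ⟨ht, htM⟩
  have htM : |t| ≤ M := abs_le.2 htM
  have ht2 : t ^ 2 ≤ M ^ 2 := sq_le_sq.2 (htM.trans (le_abs_self _))
  have hsub : |a * t - b| ≤ κ := by
    refine abs_le_of_sq_le_sq ?_ hκ0
    calc (a * t - b) ^ 2 ≤ 2 * δ * (1 + t ^ 2) := mul_sub_sq_le_of_mem_arcSet hab ht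
      _ ≤ 2 * δ * (1 + M ^ 2) := by gcongr
      _ ≤ κ ^ 2 := hκδ
  have ha := one_le_four_mul_abs hM htM hκ (one_fourth_lt_of_mem_arcSet hδ2 ht) hsub
  have ha0 : a ≠ 0 := by
    rintro rfl
    norm_num at ha
  rw [mem_closedBall, Real.dist_eq, sub_div' ha0, abs_div, div_le_iff₀ (abs_pos.2 ha0), mul_comm t]
  nlinarith

theorem exists_setIntegral_compl_Icc_le {f : ℝ → ℝ} (hf : Integrable f) {η : ℝ} (hη : 0 < η) :
    ∃ M : ℝ, 1 ≤ M ∧ ∫ t in (Icc (-M) M)ᶜ, f t ≤ η := by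
  have hempty : ⋂ M : ℝ, (Icc (-M) M)ᶜ = ∅ := eq_empty_of_forall_notMem fun t ht ↦
    mem_iInter.1 ht |t| (abs_le.1 le_rfl)
  have hlim := tendsto_setIntegral_of_antitone (μ := volume) (f := f)
    (s := fun M : ℝ ↦ (Icc (-M) M)ᶜ) (fun M ↦ measurableSet_Icc.compl)
    (fun M M' h ↦ compl_subset_compl.2 (Icc_subset_Icc (neg_le_neg h) h)) ⟨0, hf.integrableOn⟩
  rw [hempty, setIntegral_empty] at hlim
  obtain ⟨M, hM1, hM⟩ := ((eventually_ge_atTop 1).and (hlim.eventually (gt_mem_nhds hη))).exists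
  exact ⟨M, hM1, hM.le⟩

theorem setIntegral_le_of_inter_subset {T S B : Set ℝ} (hB : MeasurableSet B)
    (hBfin : volume B ≠ ⊤) (hsub : T ∩ S ⊆ B) :
    ∫ t in T, (1 + t ^ 2)⁻¹ ≤ (∫ t in Sᶜ, (1 + t ^ 2)⁻¹) + volume.real B := by
  have hint (s : Set ℝ) : IntegrableOn (fun t : ℝ ↦ (1 + t ^ 2)⁻¹) s :=
    integrable_inv_one_add_sq.integrableOn
  have hTSB : T ⊆ Sᶜ ∪ B := fun t ht ↦ (em (t ∈ S)).elim (fun hS ↦ .inr (hsub ⟨ht, hS⟩)) .inl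
  have hB1 : ∫ t in B, (1 + t ^ 2)⁻¹ ≤ volume.real B := by
    rw [← setIntegral_one_eq_measureReal]
    exact setIntegral_mono (hint B) (integrableOn_const hBfin) fun t ↦
      inv_le_one_of_one_le₀ (le_add_of_nonneg_right (sq_nonneg t))
  have hnonneg (s : Set ℝ) : ∀ᵐ t ∂volume.restrict s, 0 ≤ (1 + t ^ 2)⁻¹ :=
    .of_forall fun t ↦ by positivity
  calc ∫ t in T, (1 + t ^ 2)⁻¹ ≤ ∫ t in Sᶜ ∪ B, (1 + t ^ 2)⁻¹ :=
        setIntegral_mono_set (hint _) (hnonneg _) hTSB.eventuallyLE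
    _ = (∫ t in Sᶜ \ B, (1 + t ^ 2)⁻¹) + ∫ t in B, (1 + t ^ 2)⁻¹ := by
        rw [← sdiff_union_self, setIntegral_union disjoint_sdiff_left hB (hint _) (hint _)]
    _ ≤ _ := add_le_add
        (setIntegral_mono_set (hint _) (hnonneg _) (sdiff_subset.eventuallyLE)) hB1

theorem exists_setIntegral_arcSet_le {η : ℝ} (hη : 0 < η) :
    ∃ δ₀, 0 < δ₀ ∧ ∀ δ, 0 < δ → δ < δ₀ → ∀ a b : ℝ, a ^ 2 + b ^ 2 ≤ 1 →
      ∫ t in arcSet a b δ, (1 + t ^ 2)⁻¹ ≤ η := by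
  obtain ⟨M, hM, htail⟩ := exists_setIntegral_compl_Icc_le integrable_inv_one_add_sq (half_pos hη)
  set κ := min (1 / 8) (η / (16 * M))
  have hκ0 : 0 < κ := by positivity
  have hκη : κ * (16 * M) ≤ η := (le_div_iff₀ (by positivity)).1 (min_le_right _ _)
  refine ⟨min (1 / 2) (κ ^ 2 / (2 * (1 + M ^ 2))), by positivity, fun δ hδ hδ₀ a b hab ↦ ?_⟩
  have hκδ : 2 * δ * (1 + M ^ 2) ≤ κ ^ 2 := by
    linarith [(le_div_iff₀ (by positivity)).1 (hδ₀.le.trans (min_le_right _ _))]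
  have hsub := arcSet_inter_Icc_subset hab hM hδ.le (hδ₀.le.trans (min_le_left _ _)) hκ0.le
    (min_le_left _ _) hκδ
  have hle := setIntegral_le_of_inter_subset measurableSet_closedBall
    measure_closedBall_lt_top.ne hsub
  rw [Real.volume_real_closedBall (by positivity)] at hle
  linarith

end Arc

section OneSubBump

open Set Metric Module

variable {W : Type*} [NormedAddCommGroup W] [InnerProductSpace ℝ W]

/-- The function `1 - f_ε` of the theorem, with `δ = ε² / 2`. -/
def oneSubBump (x₀ : W) (δ : ℝ) (x : W) : ℝ := 1 - bumpProfile δ (inner ℝ (‖x‖⁻¹ • x) x₀ ^ 2)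

theorem isEvenAngular_oneSubBump (x₀ : W) (δ : ℝ) : IsEvenAngular (oneSubBump x₀ δ) :=
  isEvenAngular_comp_inner (m := fun z ↦ 1 - bumpProfile δ (z ^ 2))
    (continuous_const.sub ((continuous_bumpProfile δ).comp (continuous_pow 2)))
    (fun z ↦ by simp only [neg_sq]) x₀

variable {x₀ : W} {δ : ℝ}

theorem neg_one_le_oneSubBump (hx₀ : ‖x₀‖ = 1) (hδ : 0 ≤ δ) (x : W) : -1 ≤ oneSubBump x₀ δ x := by
  have hinner : inner ℝ (‖x‖⁻¹ • x) x₀ ^ 2 ≤ 1 := by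
    rw [sq_le_one_iff_abs_le_one]
    refine (abs_real_inner_le_norm _ _).trans ?_
    rw [hx₀, mul_one, norm_smul, norm_inv, norm_norm]
    exact inv_mul_le_one
  linarith [bumpProfile_le_two hδ hinner, oneSubBump.eq_1 x₀ δ x]

theorem inv_sqrt_one_add_sq_pow_le {k : ℕ} (hk : 2 ≤ k) (t : ℝ) :
    (√(1 + t ^ 2) ^ k)⁻¹ ≤ (1 + t ^ 2)⁻¹ := by
  refine inv_anti₀ (by positivity) ?_
  calc 1 + t ^ 2 = √(1 + t ^ 2) ^ 2 := (Real.sq_sqrt (by positivity)).symm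
    _ ≤ √(1 + t ^ 2) ^ k :=
      pow_le_pow_right₀ (Real.one_le_sqrt.2 (le_add_of_nonneg_right (sq_nonneg t))) hk

theorem integrable_inv_sqrt_one_add_sq_pow {k : ℕ} (hk : 2 ≤ k) :
    Integrable fun t : ℝ ↦ (√(1 + t ^ 2) ^ k)⁻¹ := by
  refine integrable_inv_one_add_sq.mono'
    (Measurable.aestronglyMeasurable (by fun_prop)) (.of_forall fun t ↦ ?_)
  rw [Real.norm_of_nonneg (by positivity)]
  exact inv_sqrt_one_add_sq_pow_le hk t

theorem integral_inv_sqrt_one_add_sq_pow_pos {k : ℕ} (hk : 2 ≤ k) :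
    0 < ∫ t : ℝ, (√(1 + t ^ 2) ^ k)⁻¹ := by
  have hsupp : Function.support (fun t : ℝ ↦ (√(1 + t ^ 2) ^ k)⁻¹) = univ :=
    eq_univ_of_forall fun t ↦ Function.mem_support.2 (by positivity)
  rw [integral_pos_iff_support_of_nonneg (fun t ↦ by positivity)
    (integrable_inv_sqrt_one_add_sq_pow hk), hsupp]
  simp

variable {U : Type*} [NormedAddCommGroup U] [InnerProductSpace ℝ U]
  {i : U →ₗᵢ[ℝ] W} {v : W} {k : ℕ}

namespace IsUnitNormal

theorem norm_add_smul_eq_sqrt (h : IsUnitNormal i v) {u : U} (hu : ‖u‖ = 1) (t : ℝ) :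
    ‖i u + t • v‖ = √(1 + t ^ 2) := by
  rw [← Real.sqrt_sq (norm_nonneg _), h.norm_add_smul_sq, hu, one_pow]

theorem inner_direction_line_sq (h : IsUnitNormal i v) {u : U} (hu : ‖u‖ = 1) (x₀ : W) (t : ℝ) :
    inner ℝ (‖i u + t • v‖⁻¹ • (i u + t • v)) x₀ ^ 2 =
      (inner ℝ (i u) x₀ + inner ℝ v x₀ * t) ^ 2 / (1 + t ^ 2) := by
  rw [real_inner_smul_left, inner_add_left, real_inner_smul_left, mul_pow, inv_pow,
    h.norm_add_smul_sq, hu, one_pow, mul_comm t, inv_mul_eq_div]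

theorem oneSubBump_eq_one (h : IsUnitNormal i v) {u : U} (hu : ‖u‖ = 1) (hδ : 0 < δ) (hδ1 : δ ≤ 1)
    {t : ℝ} (ht : t ∉ arcSet (inner ℝ (i u) x₀) (inner ℝ v x₀) δ) :
    oneSubBump x₀ δ (i u + t • v) = 1 := by
  rw [oneSubBump, bumpProfile_eq_zero hδ, sub_zero]
  refine Real.sqrt_le_iff.2 ⟨sub_nonneg.2 hδ1, ?_⟩
  rw [h.inner_direction_line_sq hu, div_le_iff₀ (by positivity)]
  exact not_lt.1 ht

variable [FiniteDimensional ℝ W] [MeasurableSpace W] [BorelSpace W]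

theorem integrable_line (h : IsUnitNormal i v) (hk : 2 ≤ k) {g : W → ℝ} (hg : IsEvenAngular g)
    {u : U} (hu : 1 ≤ ‖u‖) :
    Integrable fun t : ℝ ↦ g (i u + t • v) * (‖i u + t • v‖ ^ k)⁻¹ := by
  obtain ⟨C, -, hC⟩ := hg.exists_bound
  have := hg.measurable
  exact (integrable_inv_one_add_sq.const_mul C).mono'
    (Measurable.aestronglyMeasurable (by fun_prop))
    (.of_forall (h.abs_mul_inv_norm_pow_le hk hC hu))

theorem le_lineIntegral_oneSubBump (h : IsUnitNormal i v) (hk : 2 ≤ k) (hx₀ : ‖x₀‖ = 1)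
    {u : U} (hu : ‖u‖ = 1) (hδ : 0 < δ) (hδ1 : δ ≤ 1) :
    (∫ t : ℝ, (√(1 + t ^ 2) ^ k)⁻¹) -
        2 * ∫ t in arcSet (inner ℝ (i u) x₀) (inner ℝ v x₀) δ, (1 + t ^ 2)⁻¹ ≤
      lineIntegral (oneSubBump x₀ δ) k i v u := by
  set T := arcSet (inner ℝ (i u) x₀) (inner ℝ v x₀) δ
  have hT : MeasurableSet T := measurableSet_arcSet _ _ _
  have hweight := integrable_inv_sqrt_one_add_sq_pow hk
  have harc : Integrable (T.indicator fun t : ℝ ↦ (1 + t ^ 2)⁻¹) :=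
    integrable_inv_one_add_sq.indicator hT
  rw [← integral_indicator hT, ← integral_const_mul, ← integral_sub hweight (harc.const_mul 2)]
  refine integral_mono (hweight.sub (harc.const_mul 2))
    (h.integrable_line hk (isEvenAngular_oneSubBump x₀ δ) hu.ge) fun t ↦ ?_
  simp only [h.norm_add_smul_eq_sqrt hu]
  have hpos : 0 < (√(1 + t ^ 2) ^ k)⁻¹ := by positivity
  by_cases ht : t ∈ T
  · rw [indicator_of_mem ht]
    nlinarith [neg_one_le_oneSubBump hx₀ hδ.le (i u + t • v), inv_sqrt_one_add_sq_pow_le hk t]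
  · rw [indicator_of_notMem ht, h.oneSubBump_eq_one hu hδ hδ1 ht, mul_zero, sub_zero, one_mul]

end IsUnitNormal

variable (W) [FiniteDimensional ℝ W] [MeasurableSpace W] [BorelSpace W] in
theorem exists_lineIntegral_oneSubBump_pos (hk : 2 ≤ k) :
    ∃ δ₀, 0 < δ₀ ∧ ∀ δ, 0 < δ → δ < δ₀ → ∀ {U : Type*} [NormedAddCommGroup U]
      [InnerProductSpace ℝ U] {i : U →ₗᵢ[ℝ] W} {v x₀ : W},
      IsUnitNormal i v → ‖x₀‖ = 1 → ∀ u : U, ‖u‖ = 1 →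
      0 < lineIntegral (oneSubBump x₀ δ) k i v u := by
  have hJ := integral_inv_sqrt_one_add_sq_pow_pos hk
  set J := ∫ t : ℝ, (√(1 + t ^ 2) ^ k)⁻¹
  obtain ⟨δ₁, hδ₁, harc⟩ := exists_setIntegral_arcSet_le (show 0 < J / 4 by positivity)
  refine ⟨min δ₁ 1, by positivity, fun δ hδ hδ₀ U _ _ i v x₀ h hx₀ u hu ↦ ?_⟩
  have hbessel := inner_sq_add_inner_sq_le_one hx₀ ((i.norm_map u).trans hu) h.norm_eq_one
    (h.inner_eq_zero u)
  have hsmall := harc δ hδ (hδ₀.trans_le (min_le_left _ _)) _ _ hbessel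
  have hle := h.le_lineIntegral_oneSubBump hk hx₀ hu hδ (hδ₀.le.trans (min_le_right _ _))
  linarith

end OneSubBump

section HyperplaneSections

open Set Metric Module

variable {E : Type*} [NormedAddCommGroup E] [InnerProductSpace ℝ E] [FiniteDimensional ℝ E]

theorem exists_isUnitNormal_subtype {V : Submodule ℝ E} (hV : finrank ℝ E = finrank ℝ V + 1) :
    ∃ v, IsUnitNormal V.subtypeₗᵢ v := by
  have hrank := V.finrank_add_finrank_orthogonal
  have : Nontrivial Vᗮ := nontrivial_of_finrank_pos (R := ℝ) (by lia)
  obtain ⟨v, hv⟩ := exists_norm_eq Vᗮ zero_le_one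
  exact ⟨v, hv, fun u ↦ Submodule.inner_right_of_mem_orthogonal u.2 v.2, hV⟩

theorem IsUnitNormal.exists_orthogonal_span {V : Submodule ℝ E} {v : E}
    (h : IsUnitNormal V.subtypeₗᵢ v) {ξ : V} (hξ : ξ ≠ 0) :
    ∃ (i : (ℝ ∙ ξ)ᗮ →ₗᵢ[ℝ] (ℝ ∙ (ξ : E))ᗮ) (w : (ℝ ∙ (ξ : E))ᗮ),
      IsUnitNormal i w ∧ (∀ y, (i y : E) = (y : V)) ∧ (w : E) = v := by
  have hmem (y : (ℝ ∙ ξ)ᗮ) : ((y : V) : E) ∈ (ℝ ∙ (ξ : E))ᗮ :=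
    Submodule.mem_orthogonal_singleton_iff_inner_right.2
      ((Submodule.mem_orthogonal_singleton_iff_inner_right (𝕜 := ℝ) (u := ξ)).1 y.2)
  let i : (ℝ ∙ ξ)ᗮ →ₗᵢ[ℝ] (ℝ ∙ (ξ : E))ᗮ :=
    { toLinearMap := (V.subtype ∘ₗ (ℝ ∙ ξ)ᗮ.subtype).codRestrict _ hmem
      norm_map' _ := rfl }
  let w : (ℝ ∙ (ξ : E))ᗮ :=
    ⟨v, Submodule.mem_orthogonal_singleton_iff_inner_right.2 (h.inner_eq_zero ξ)⟩
  refine ⟨i, w, ⟨h.norm_eq_one, fun y ↦ h.inner_eq_zero y, ?_⟩, fun y ↦ rfl, rfl⟩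
  have hE := finrank_orthogonal_span (Submodule.coe_eq_zero.not.2 hξ)
  have hV := finrank_orthogonal_span hξ
  have := h.finrank_eq
  lia

variable [MeasurableSpace E] [BorelSpace E]

theorem IsUnitNormal.sphericalRadon_eq {V : Submodule ℝ E} {v : E}
    (h : IsUnitNormal V.subtypeₗᵢ v) (hV : 2 ≤ finrank ℝ V) {g : E → ℝ} (hg : IsEvenAngular g)
    {ξ : V} (hξ : ξ ≠ 0) :
    sphericalRadon g (ξ : E) =
      sphericalRadon (fun u ↦ lineIntegral g (finrank ℝ V) V.subtypeₗᵢ v (‖u‖⁻¹ • u)) ξ := by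
  have := nontrivial_orthogonal_span hV hξ
  obtain ⟨i, w, hi, hi_coe, hw⟩ := h.exists_orthogonal_span hξ
  have hrank : finrank ℝ (ℝ ∙ (ξ : E))ᗮ = finrank ℝ V := by
    rw [hi.finrank_eq, ← finrank_orthogonal_span hξ]
  have hproj := hi.integral_toSphere_eq_integral_lineIntegral
    (hg.comp_linearIsometry (ℝ ∙ (ξ : E))ᗮ.subtypeₗᵢ)
  refine hproj.trans (integral_congr_ae (.of_forall fun θ ↦ ?_))
  simp only [lineIntegral, hrank, Submodule.norm_coe, norm_eq_of_mem_sphere, inv_one, one_smul]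
  congr with t
  have hpoint : ((i θ + t • w : (ℝ ∙ (ξ : E))ᗮ) : E) = V.subtypeₗᵢ θ + t • v := by
    rw [Submodule.coe_add, Submodule.coe_smul, hi_coe, hw]
    rfl
  rw [← hpoint]
  rfl

theorem IsIntersectionBodyOf.isIntersectionBody {K L : Set E} (h : IsIntersectionBodyOf K L) :
    IsIntersectionBody K where
  starBody := h.starBody_left
  symmetric := h.symmetric_left
  mem_closure δ hδ := ⟨K, L, h, fun ξ _ ↦ by rw [sub_self, abs_zero]; exact hδ.le⟩

theorem IsMinkowskiFunctional.isIntersectionBody_of_pos {N : E → ℝ}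
    (hN : IsMinkowskiFunctional N) (hd : 2 ≤ finrank ℝ E) {g : E → ℝ} (hg : IsEvenAngular g)
    (hpos : ∀ x ≠ 0, 0 < g x)
    (hNg : ∀ ξ, ‖ξ‖ = 1 → (N ξ)⁻¹ = Real.pi * sphericalRadon g ξ) :
    IsIntersectionBody {x | N x ≤ 1} := by
  obtain ⟨k, hk, hE⟩ : ∃ k, 1 ≤ k ∧ finrank ℝ E = k + 1 := ⟨finrank ℝ E - 1, by lia, by lia⟩
  have hk0 : (0 : ℝ) < k := by positivity
  have hc (x : E) (hx : x ≠ 0) : 0 < Real.pi * k * g x :=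
    mul_pos (by positivity) (hpos x hx)
  set q : E → ℝ := fun x ↦ ((Real.pi * k * g x) ^ (k : ℝ)⁻¹)⁻¹ with hq_def
  have hq : IsEvenAngular q :=
    { continuousOn := ((continuousOn_const.mul hg.continuousOn).rpow_const fun x hx ↦
          Or.inl (hc x hx).ne').inv₀ fun x hx ↦ (Real.rpow_pos_of_pos (hc x hx) _).ne'
      smul := fun c x hc ↦ by simp only [hq_def, hg.smul c x hc] }
  have hL := hq.isMinkowskiFunctional fun x hx ↦ inv_pos.2 (Real.rpow_pos_of_pos (hc x hx) _)
  refine IsIntersectionBodyOf.isIntersectionBody (L := {x | ‖x‖ * q x ≤ 1})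
    ⟨hN.isStarBody, hN.isOriginSymmetric, hL.isStarBody, hL.isOriginSymmetric, fun ξ hξ ↦ ?_⟩
  have hξ0 : ξ ≠ 0 := norm_ne_zero_iff.1 (hξ.trans_ne one_ne_zero)
  have hpow (θ : sphere (0 : (ℝ ∙ ξ)ᗮ) 1) :
      (‖((θ : (ℝ ∙ ξ)ᗮ) : E)‖ * (‖((θ : (ℝ ∙ ξ)ᗮ) : E)‖ * q (θ : (ℝ ∙ ξ)ᗮ))⁻¹) ^ k =
        Real.pi * k * g (θ : (ℝ ∙ ξ)ᗮ) := by
    have hθ : ‖((θ : (ℝ ∙ ξ)ᗮ) : E)‖ = 1 := norm_eq_of_mem_sphere θ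
    have hθ0 := norm_ne_zero_iff.1 (hθ.trans_ne one_ne_zero)
    rw [hθ, one_mul, one_mul, hq_def, inv_inv,
      Real.rpow_inv_natCast_pow (hc _ hθ0).le (Nat.one_le_iff_ne_zero.1 hk)]
  have hvol := hL.mul_centralSectionVolume hk hE hξ0
  simp only [sphericalRadon, hpow] at hvol
  rw [integral_const_mul] at hvol
  rw [radialFunction, hN.gauge_eq, hNg ξ hξ, sphericalRadon]
  refine mul_left_cancel₀ hk0.ne' ?_
  rw [hvol]
  ring

theorem IsUnitNormal.isIntersectionBody_section {V : Submodule ℝ E} {v : E}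
    (h : IsUnitNormal V.subtypeₗᵢ v) (hV : 2 ≤ finrank ℝ V) {g : E → ℝ} (hg : IsEvenAngular g)
    {N : E → ℝ} (hN : IsMinkowskiFunctional N)
    (hNg : ∀ ξ, ‖ξ‖ = 1 → (N ξ)⁻¹ = Real.pi * sphericalRadon g ξ)
    (hpos : ∀ u : V, ‖u‖ = 1 → 0 < lineIntegral g (finrank ℝ V) V.subtypeₗᵢ v u) :
    IsIntersectionBody {w : V | N w ≤ 1} := by
  refine (hN.comp_linearIsometry V.subtypeₗᵢ).isIntersectionBody_of_pos hV
    (h.isEvenAngular_lineIntegral hV hg)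
    (fun u hu ↦ hpos _ (norm_smul_inv_norm (𝕜 := ℝ) hu)) fun ξ hξ ↦ ?_
  rw [← h.sphericalRadon_eq hV hg (norm_ne_zero_iff.1 (hξ.trans_ne one_ne_zero))]
  exact hNg ξ hξ

end HyperplaneSections

section BumpRadon

open Set Metric Module

variable {E : Type*} [NormedAddCommGroup E] [InnerProductSpace ℝ E]

theorem exists_unit_inner_sq_eq {x₀ ξ : E} (hx₀ : ‖x₀‖ = 1) (hξ : ‖ξ‖ = 1)
    [Nontrivial (ℝ ∙ ξ)ᗮ] : ∃ w : (ℝ ∙ ξ)ᗮ, ‖w‖ = 1 ∧ ∀ y : (ℝ ∙ ξ)ᗮ,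
      inner ℝ (y : E) x₀ ^ 2 = (1 - inner ℝ ξ x₀ ^ 2) * inner ℝ y w ^ 2 := by
  have hp : x₀ - inner ℝ ξ x₀ • ξ ∈ (ℝ ∙ ξ)ᗮ := by
    rw [Submodule.mem_orthogonal_singleton_iff_inner_right, inner_sub_right, inner_smul_right,
      real_inner_self_eq_norm_sq, hξ, one_pow, mul_one, sub_self]
  set p : (ℝ ∙ ξ)ᗮ := ⟨x₀ - inner ℝ ξ x₀ • ξ, hp⟩
  have hinner (y : (ℝ ∙ ξ)ᗮ) : inner ℝ (y : E) x₀ = inner ℝ y p := by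
    rw [Submodule.coe_inner, inner_sub_right, inner_smul_right,
      Submodule.mem_orthogonal_singleton_iff_inner_left.1 y.2, mul_zero, sub_zero]
  have hnorm : ‖p‖ ^ 2 = 1 - inner ℝ ξ x₀ ^ 2 := by
    rw [Submodule.coe_norm, norm_sub_sq_real, inner_smul_right, norm_smul, hx₀, hξ,
      real_inner_comm ξ x₀, Real.norm_eq_abs, mul_one, sq_abs]
    ring
  rw [← hnorm]
  rcases eq_or_ne p 0 with hp0 | hp0
  · obtain ⟨w, hw⟩ := exists_norm_eq (ℝ ∙ ξ)ᗮ zero_le_one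
    exact ⟨w, hw, fun y ↦ by rw [hinner, hp0]; simp⟩
  · refine ⟨‖p‖⁻¹ • p, norm_smul_inv_norm (𝕜 := ℝ) hp0, fun y ↦ ?_⟩
    have := norm_ne_zero_iff.2 hp0
    rw [hinner, inner_smul_right]
    field_simp

variable {F : Type*} [NormedAddCommGroup F] [InnerProductSpace ℝ F] [FiniteDimensional ℝ F]
  [MeasurableSpace F] [BorelSpace F]

theorem integral_toSphere_comp_linearIsometryEquiv {U : Type*} [NormedAddCommGroup U]
    [InnerProductSpace ℝ U] [FiniteDimensional ℝ U] [MeasurableSpace U] [BorelSpace U]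
    [Nontrivial U] (f : U ≃ₗᵢ[ℝ] F) (a : F → ℝ) :
    ∫ θ : sphere (0 : U) 1, a (f θ) ∂(lebesgue U).toSphere =
      ∫ θ : sphere (0 : F) 1, a θ ∂(lebesgue F).toSphere := by
  have : Nontrivial F := f.injective.nontrivial
  have hU := setIntegral_ball_radial_mul_norm_pow (lebesgue U) (a ∘ f) 0
  have hF := setIntegral_ball_radial_mul_norm_pow (lebesgue F) a 0
  rw [← (measurePreserving_lebesgue f).setIntegral_preimage_emb
    f.toHomeomorph.measurableEmbedding, f.preimage_ball, map_zero] at hF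
  simp only [pow_zero, mul_one, Nat.cast_zero, add_zero, map_smul, f.norm_map,
    Function.comp_apply, f.toLinearEquiv.finrank_eq] at hU hF
  have hrank : ((finrank ℝ F : ℝ))⁻¹ ≠ 0 := inv_ne_zero (Nat.cast_ne_zero.2 finrank_pos.ne')
  exact mul_left_cancel₀ hrank (hU.symm.trans hF)

theorem sphericalRadon_oneSubBump [FiniteDimensional ℝ E] [MeasurableSpace E] [BorelSpace E]
    [Nontrivial F] (hEF : finrank ℝ E = finrank ℝ F + 1) {e : F} (he : ‖e‖ = 1) {x₀ ξ : E}
    (hx₀ : ‖x₀‖ = 1) (hξ : ‖ξ‖ = 1) (δ : ℝ) :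
    sphericalRadon (oneSubBump x₀ δ) ξ =
      (lebesgue F).toSphere.real univ - capIntegral e δ (inner ℝ ξ x₀) := by
  have hξ0 : ξ ≠ 0 := norm_ne_zero_iff.1 (hξ.trans_ne one_ne_zero)
  have hrank : finrank ℝ (ℝ ∙ ξ)ᗮ = finrank ℝ F := by
    rw [finrank_orthogonal_span hξ0] at hEF
    lia
  have : Nontrivial (ℝ ∙ ξ)ᗮ := nontrivial_of_finrank_pos (R := ℝ) (hrank ▸ finrank_pos)
  obtain ⟨w, hw, hinner⟩ := exists_unit_inner_sq_eq hx₀ hξ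
  obtain ⟨f, hf⟩ := exists_linearIsometryEquiv_map_eq hrank hw he
  have hprofile (θ : sphere (0 : (ℝ ∙ ξ)ᗮ) 1) : oneSubBump x₀ δ (θ : (ℝ ∙ ξ)ᗮ) =
      1 - sectionProfile δ (inner ℝ (f θ) e ^ 2) (inner ℝ ξ x₀) := by
    rw [oneSubBump, sectionProfile, Submodule.norm_coe, norm_eq_of_mem_sphere, inv_one, one_smul,
      hinner, ← hf, f.inner_map_map]
  have hcont : Continuous fun θ : sphere (0 : F) 1 ↦
      sectionProfile δ (inner ℝ (θ : F) e ^ 2) (inner ℝ ξ x₀) := by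
    have := continuous_bumpProfile δ
    unfold sectionProfile
    fun_prop
  simp only [sphericalRadon, hprofile]
  rw [integral_toSphere_comp_linearIsometryEquiv f fun y ↦
      1 - sectionProfile δ (inner ℝ y e ^ 2) (inner ℝ ξ x₀),
    integral_sub (integrable_const 1)
      (hcont.integrable_of_hasCompactSupport (.of_compactSpace _)), integral_const, smul_eq_mul,
    mul_one, capIntegral]

end BumpRadon

section ConvexRadonGauge

open Set Metric Module

variable {E : Type*} [NormedAddCommGroup E] [InnerProductSpace ℝ E] [FiniteDimensional ℝ E]

theorem convexOn_revolutionGauge_of_small {c c₁ c₂ : ℝ → ℝ} (hc : ∀ z, HasDerivAt c (c₁ z) z)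
    (hc₁ : ∀ z, HasDerivAt c₁ (c₂ z) z) (heven : c.Even) {a ω : ℝ} (ha : 0 < a) (hω : 0 < ω)
    (hsmall : ∀ z, |c z| ≤ ω / 10 ∧ |c₁ z| ≤ ω / 10 ∧ |c₂ z| ≤ ω / 10) {x₀ : E}
    (hx₀ : ‖x₀‖ = 1) :
    IsMinkowskiFunctional (revolutionGauge (fun z ↦ (a * (ω - c z))⁻¹) x₀) ∧
      ConvexOn ℝ univ (revolutionGauge (fun z ↦ (a * (ω - c z))⁻¹) x₀) := by
  have hlower (z : ℝ) : a * (9 / 10 * ω) ≤ a * (ω - c z) :=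
    mul_le_mul_of_nonneg_left (by linarith [(abs_le.1 (hsmall z).1).2]) ha.le
  have hpos (z : ℝ) : 0 < a * (ω - c z) :=
    (by positivity : 0 < a * (9 / 10 * ω)).trans_le (hlower z)
  have hle {b : ℝ} (hb : |b| ≤ ω / 10) (z : ℝ) : |a * -b| ≤ a * (ω - c z) / 4 := by
    rw [abs_mul, abs_neg, abs_of_pos ha]
    nlinarith [hlower z]
  have hderiv (z : ℝ) : HasDerivAt (fun z ↦ a * (ω - c z)) (a * -c₁ z) z :=
    ((hc z).const_sub ω).const_mul a
  have hderiv₂ (z : ℝ) : HasDerivAt (fun z ↦ a * -c₁ z) (a * -c₂ z) z :=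
    (hc₁ z).fun_neg.const_mul a
  have hinv_even : (fun z ↦ (a * (ω - c z))⁻¹).Even := fun z ↦ by simp only [heven z]
  have hN : IsMinkowskiFunctional (revolutionGauge (fun z ↦ (a * (ω - c z))⁻¹) x₀) :=
    isMinkowskiFunctional_revolutionGauge
      (continuous_iff_continuousAt.2 fun z ↦ (hderiv z).continuousAt.inv₀ (hpos z).ne')
      hinv_even (fun z ↦ inv_pos.2 (hpos z)) x₀
  exact ⟨hN, convexOn_revolutionGauge_inv hderiv hderiv₂ hpos
    (fun z ↦ hle (hsmall z).2.1 z) (fun z ↦ hle (hsmall z).2.2 z) hx₀ hN⟩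

theorem toSphere_real_univ_pos (F : Type*) [NormedAddCommGroup F] [InnerProductSpace ℝ F]
    [FiniteDimensional ℝ F] [MeasurableSpace F] [BorelSpace F] [Nontrivial F] :
    0 < (lebesgue F).toSphere.real univ := by
  have : 0 < finrank ℝ F := finrank_pos
  have : 0 < (lebesgue F).real (ball 0 1) :=
    ENNReal.toReal_pos (measure_ball_pos _ _ one_pos).ne' measure_ball_lt_top.ne
  rw [Measure.toSphere_real_apply_univ]
  positivity

theorem exists_convexOn_inv_eq_sphericalRadon [MeasurableSpace E] [BorelSpace E]
    (hd : 5 ≤ finrank ℝ E) {x₀ : E} (hx₀ : ‖x₀‖ = 1) :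
    ∃ δ₀, 0 < δ₀ ∧ ∀ δ, 0 < δ → δ < δ₀ →
      ∃ N : E → ℝ, IsMinkowskiFunctional N ∧ ConvexOn ℝ univ N ∧
        ∀ ξ, ‖ξ‖ = 1 → (N ξ)⁻¹ = Real.pi * sphericalRadon (oneSubBump x₀ δ) ξ := by
  have hEF := finrank_orthogonal_span (norm_ne_zero_iff.1 (hx₀.trans_ne one_ne_zero))
  have : Nontrivial (ℝ ∙ x₀)ᗮ := nontrivial_of_finrank_pos (R := ℝ) (by lia)
  obtain ⟨e, he⟩ := exists_norm_eq (ℝ ∙ x₀)ᗮ zero_le_one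
  have hω := toSphere_real_univ_pos (ℝ ∙ x₀)ᗮ
  obtain ⟨δ₀, hδ₀, hδ₀2, hsmall⟩ :=
    exists_abs_capIntegral_le (by lia) he (div_pos hω (by norm_num : (0 : ℝ) < 10))
  refine ⟨δ₀, hδ₀, fun δ hδ hδδ₀ ↦ ?_⟩
  have hδ2 : δ ≤ 1 / 2 := hδδ₀.le.trans hδ₀2
  have heven : (capIntegral e δ).Even := fun z ↦ by simp only [capIntegral, sectionProfile, neg_sq]
  obtain ⟨hN, hconv⟩ := convexOn_revolutionGauge_of_small (hasDerivAt_capIntegral he hδ hδ2)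
    (hasDerivAt_capIntegralDeriv he hδ hδ2) heven Real.pi_pos hω (hsmall δ hδ hδδ₀) hx₀
  refine ⟨_, hN, hconv, fun ξ hξ ↦ ?_⟩
  rw [sphericalRadon_oneSubBump hEF he hx₀ hξ, revolutionGauge, hξ, inv_one, one_smul, one_mul,
    inv_inv]

end ConvexRadonGauge

section PerturbedKernel

open Set Module

variable {k : ℕ} {x₀ : EuclideanSpace ℝ (Fin (k + 1))}

theorem perturbedKernel_eq (hk : 1 ≤ k) (hx₀ : ‖x₀‖ = 1) {ε : ℝ} (hε : 0 < ε) (hε1 : ε ≤ 1) :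
    perturbedKernel x₀ ε = fun x ↦ oneSubBump x₀ (ε ^ 2 / 2) x * (‖x‖ ^ k)⁻¹ := by
  funext x
  have hexp : -((k + 1 : ℕ) : ℤ) + 1 = -(k : ℤ) := by push_cast; ring
  rw [perturbedKernel, hexp, zpow_neg, zpow_natCast]
  rcases eq_or_ne x 0 with rfl | hx
  · rw [norm_zero, zero_pow (by lia), inv_zero, mul_zero, mul_zero]
  · have hunit : ‖‖x‖⁻¹ • x‖ = 1 := norm_smul_inv_norm (𝕜 := ℝ) hx
    rw [oneSubBump, bump_eq_bumpProfile hx₀ hunit hε hε1]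

theorem oneSubBump_self {E : Type*} [NormedAddCommGroup E] [InnerProductSpace ℝ E] {x₀ : E}
    (hx₀ : ‖x₀‖ = 1) {ε : ℝ} (hε : 0 < ε) (hε1 : ε ≤ 1) : oneSubBump x₀ (ε ^ 2 / 2) x₀ = -1 := by
  rw [oneSubBump, hx₀, inv_one, one_smul, ← bump_eq_bumpProfile hx₀ hx₀ hε hε1, bump, sub_self,
    norm_zero, if_pos hε]
  norm_num

theorem isDistributionalFourierTransform_inv_of_inv_eq_sphericalRadon (hk : 1 ≤ k)
    {g : EuclideanSpace ℝ (Fin (k + 1)) → ℝ} (hg : IsEvenAngular g)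
    {N : EuclideanSpace ℝ (Fin (k + 1)) → ℝ} (hN : IsMinkowskiFunctional N)
    (hNg : ∀ ξ, ‖ξ‖ = 1 → (N ξ)⁻¹ = Real.pi * sphericalRadon g ξ) :
    IsDistributionalFourierTransform (fun x ↦ g x * (‖x‖ ^ k)⁻¹) fun x ↦ (N x)⁻¹ := by
  convert isDistributionalFourierTransform_angular hk hg with x
  rcases eq_or_ne x 0 with rfl | hx
  · rw [hN.zero, norm_zero, inv_zero, mul_zero, zero_mul]
  · have hx' : ‖x‖ ≠ 0 := norm_ne_zero_iff.2 hx
    have hunit := hNg (‖x‖⁻¹ • x) (norm_smul_inv_norm (𝕜 := ℝ) hx)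
    rw [hN.smul, sphericalRadon_smul _ (inv_ne_zero hx'), abs_inv, abs_norm, mul_inv,
      inv_inv] at hunit
    rw [mul_right_comm, ← hunit]
    field_simp

end PerturbedKernel

end

theorem theorem1 (n : ℕ) (hn : 5 ≤ n) (x₀ : EuclideanSpace ℝ (Fin n)) (hx₀ : ‖x₀‖ = 1) :
    ∃ ε₀ : ℝ, 0 < ε₀ ∧ ∀ ε : ℝ, 0 < ε → ε < ε₀ →
      ∃ K : Set (EuclideanSpace ℝ (Fin n)),
        IsConvexBody K ∧ IsOriginSymmetric K ∧
        IsDistributionalFourierTransform (perturbedKernel x₀ ε) (fun x => (gauge K x)⁻¹) ∧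
        ¬ IsIntersectionBody K ∧
        ∀ V : Submodule ℝ (EuclideanSpace ℝ (Fin n)), Module.finrank ℝ V = n - 1 →
          IsIntersectionBody {v : V | (v : EuclideanSpace ℝ (Fin n)) ∈ K} := by
  obtain ⟨k, rfl⟩ : ∃ k, n = k + 1 := ⟨n - 1, by lia⟩
  have hrank := finrank_euclideanSpace_fin (𝕜 := ℝ) (n := k + 1)
  obtain ⟨δ₁, hδ₁, hconvex⟩ := exists_convexOn_inv_eq_sphericalRadon (hn.trans_eq hrank.symm) hx₀
  obtain ⟨δ₂, hδ₂, hline⟩ := exists_lineIntegral_oneSubBump_pos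
    (EuclideanSpace ℝ (Fin (k + 1))) (k := k) (by lia)
  refine ⟨min 1 (min δ₁ δ₂), by positivity, fun ε hε hε₀ ↦ ?_⟩
  obtain ⟨hε1, hεδ₁, hεδ₂⟩ : ε < 1 ∧ ε < δ₁ ∧ ε < δ₂ := by simpa only [lt_min_iff] using hε₀
  have hδ : 0 < ε ^ 2 / 2 := by positivity
  have hδε : ε ^ 2 / 2 < ε := by nlinarith
  obtain ⟨N, hN, hNconv, hNg⟩ := hconvex _ hδ (hδε.trans hεδ₁)
  have hg := isEvenAngular_oneSubBump x₀ (ε ^ 2 / 2)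
  refine ⟨{x | N x ≤ 1}, hN.isConvexBody hNconv, hN.isOriginSymmetric, ?_, ?_, fun V hV ↦ ?_⟩
  · rw [perturbedKernel_eq (by lia) hx₀ hε hε1.le, hN.gauge_eq]
    exact isDistributionalFourierTransform_inv_of_inv_eq_sphericalRadon (by lia) hg hN hNg
  · refine not_isIntersectionBody_of_neg (by lia) hg (fun ξ hξ ↦ ?_)
      (norm_ne_zero_iff.1 (hx₀.trans_ne one_ne_zero))
      ((oneSubBump_self hx₀ hε hε1.le).trans_lt neg_one_lt_zero)
    rw [radialFunction, hN.gauge_eq, hNg ξ hξ]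
  · rw [Nat.add_sub_cancel] at hV
    obtain ⟨v, hv⟩ := exists_isUnitNormal_subtype (hrank.trans (congrArg (· + 1) hV.symm))
    have hV2 : 2 ≤ Module.finrank ℝ V := (by lia : 2 ≤ k).trans_eq hV.symm
    refine hv.isIntersectionBody_section hV2 hg hN hNg fun u hu ↦ ?_
    rw [hV]
    exact hline _ hδ (hδε.trans hεδ₂) hv hx₀ u hu
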